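/- Let $n\ge 1$ and let $A\subseteq C[0,1]\otimes M_n$ be a special continuous-trace C*-algebra, i.e. a full step-hereditary subalgebra: a closed *-subalgebra with $A\,(C[0,1]\otimes M_n)\,A\subseteq A$, contained in no proper closed two-sided ideal of $C[0,1]\otimes M_n$, whose dimension function $d(t)=\dim A(t)\mathbb C^n$ is constant on each member of some partition of $[0,1]$ into finitely many intervals. For $1\le i\le n$ put $A_i=\{t: d(t)\ge n+1-i\}$, so that $A_1\subseteq\dots\subseteq A_n=[0,1]$ and $d=\sum_i 1_{A_i}$, and let $A_i^k$ $(1\le k\le c_i)$ be the connected components of $A_i$. Let $H\subseteq C[0,1]\otimes M_n$ be the algebra of all $g$ whose $(i,j)$ entry vanishes off $A_{\min(i,j)}$. Then there are finitely many components in all; there exist continuous functions $f_i^k:[0,1]\to[0,2]$ $(i\le n-1,\ k\le c_i)$ that are nonzero exactly on $A_i^k$; and there is a *-isomorphism $\varphi:A\to H$ such that for every such choice of functions $f_i^k$ the following hold. (a) $A$ is the universal C*-algebra $C^*\langle G\mid R\rangle$ on the finite set of generators $G=\{P,\ X_n,\ X_i^k : i\le n-1,\ k\le c_i\}$ subject to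 the finite set $R$ of relations $$P=P^*=P^2,\quad \|X_i^k\|\le 2,\quad \|X_n\|\le 1,$$ $$X_i^kX_j^l=0,\quad X_i^k(X_j^l)^*=0\ \text{ if } (i,k)\ne(j,l),\quad PX_i^k=X_i^k,\quad X_i^kP=0,$$ $$PX_n=X_nP=X_n,\quad 0\le X_n\le 1,\quad X_i^k(X_i^k)^*=(f_i^k)^2(X_n)\qquad(i,j\le n-1),$$ where $h(X_n)$ is formed in the corner with unit $P$, i.e. $h(X_n)=(h-h(0))(X_n)+h(0)P$. Under $\varphi$ the generators $P$, $X_n$, $X_i^k$ correspond to $1\otimes e_{nn}$, $t\otimes e_{nn}$, $f_i^k\otimes e_{ni}$. (b) The relations $R$ are weakly stable: for every $\delta>0$ there is $\varepsilon>0$ such that whenever a family $(b_g)_{g\in G}$ in a C*-algebra $B$ satisfies the relations within $\varepsilon$, there is a *-homomorphism $\sigma:C^*\langle G\mid R\rangle\to B$ with $\|\sigma(g)-b_g\|\le\delta$ for all $g\in G$. (A relation $\|x\|\le r$ is satisfied within $\varepsilon$ if $\|x\|\le r+\varepsilon$, and $x=y$ if $\|x-y\|\le\varepsilon$; $0\le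 X_n\le1$ is read as $X_n=\kappa(X_n)$ with $\kappa(s)=\min(\max(s,0),1)$; for functional calculus at an arbitrary $X_n$, functions on $[0,1]$ are extended to $\mathbb R$ by constants and applied to the self-adjoint part of $X_n$.) -/

import Mathlib

universe u v

open scoped unitInterval Matrix.Norms.L2Operator ContinuousMapZero ComplexStarModule

noncomputable section

/-! ### C*-algebras presented by generators and relations -/

/-- Noncommutative expressions in the generators `G`, built with the operations of a (not
necessarily unital) complex *-algebra and with continuous functional calculus. -/
inductive CStarExpr (G : Type v) : Type v
  | gen : G → CStarExpr G
  | add : CStarExpr G → CStarExpr G → CStarExpr G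
  | mul : CStarExpr G → CStarExpr G → CStarExpr G
  | smul : ℂ → CStarExpr G → CStarExpr G
  | adj : CStarExpr G → CStarExpr G
  | fc : C(ℝ, ℝ)₀ → CStarExpr G → CStarExpr G

namespace CStarExpr

variable {G : Type v}

instance : Add (CStarExpr G) := ⟨add⟩
instance : Mul (CStarExpr G) := ⟨mul⟩
instance : SMul ℂ (CStarExpr G) := ⟨smul⟩
instance : Star (CStarExpr G) := ⟨adj⟩
instance : Sub (CStarExpr G) := ⟨fun x y => add x (smul (-1) y)⟩

/-- The value of an expression at a family `b` of elements of a C*-algebra. The expression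
`fc h x` is evaluated by applying the continuous function `h` (with `h 0 = 0`) to the self-adjoint
part of `x`; thus it is the usual `h(x)` whenever `x` is self-adjoint, and it also makes sense
(and is continuous) when `x` is only approximately self-adjoint. -/
def eval {B : Type u} [NonUnitalCStarAlgebra B] (b : G → B) : CStarExpr G → B
  | gen g => b g
  | add x y => eval b x + eval b y
  | mul x y => eval b x * eval b y
  | smul c x => c • eval b x
  | adj x => star (eval b x)
  | fc h x => cfcₙ (h : ℝ → ℝ) (ℜ (eval b x) : B)

end CStarExpr

/-- The relation `‖expr‖ ≤ bound`. -/
structure CStarRelation (G : Type v) where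
  expr : CStarExpr G
  bound : ℝ

namespace CStarRelation

variable {G : Type v}

/-- The relation `x = y`, written as `‖x - y‖ ≤ 0`. -/
def equal (x y : CStarExpr G) : CStarRelation G := ⟨x - y, 0⟩

/-- The relation `x = 0`, written as `‖x‖ ≤ 0`. -/
def isZero (x : CStarExpr G) : CStarRelation G := ⟨x, 0⟩

/-- The relation `‖x‖ ≤ r`. -/
def normLE (x : CStarExpr G) (r : ℝ) : CStarRelation G := ⟨x, r⟩

end CStarRelation

/-- The family `b` satisfies all relations in `R` within `ε`. -/
def ApproxRep {G : Type v} (R : Set (CStarRelation G)) (ε : ℝ)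
    {B : Type u} [NonUnitalCStarAlgebra B] (b : G → B) : Prop :=
  ∀ r ∈ R, ‖r.expr.eval b‖ ≤ r.bound + ε

/-- The family `b` satisfies all relations in `R` exactly. -/
def ExactRep {G : Type v} (R : Set (CStarRelation G))
    {B : Type u} [NonUnitalCStarAlgebra B] (b : G → B) : Prop :=
  ApproxRep R 0 b

/-- `A`, with the distinguished family `a`, is the universal C*-algebra `C*⟨G | R⟩`. -/
def IsUniversalCStar {G : Type v} (R : Set (CStarRelation G))
    {A : Type} [NonUnitalCStarAlgebra A] (a : G → A) : Prop :=
  ExactRep R a ∧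
    ∀ (B : Type u) [NonUnitalCStarAlgebra B] (b : G → B), ExactRep R b →
      ∃! ψ : A →⋆ₙₐ[ℂ] B, ∀ g, ψ (a g) = b g

/-- Weak stability of the relations `R`, where `A = C*⟨G | R⟩` with generators `a`: for every
`δ > 0` there is `ε > 0` such that whenever elements `b g` of a C*-algebra `B` satisfy the
relations within `ε`, there is a *-homomorphism `ψ : C*⟨G | R⟩ → B` with `‖ψ (a g) - b g‖ ≤ δ` for
all generators. (Taking for `B` the universal C*-algebra on the relations softened by `ε`, one
gets a *-homomorphism from `C*⟨G | R⟩` to it which moves the generators by at most `δ`.) -/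
def IsWeaklyStable {G : Type v} (R : Set (CStarRelation G))
    {A : Type} [NonUnitalCStarAlgebra A] (a : G → A) : Prop :=
  ∀ δ : ℝ, 0 < δ → ∃ ε : ℝ, 0 < ε ∧
    ∀ (B : Type u) [NonUnitalCStarAlgebra B] (b : G → B), ApproxRep R ε b →
      ∃ ψ : A →⋆ₙₐ[ℂ] B, ∀ g, ‖ψ (a g) - b g‖ ≤ δ

/-! ### Full step-hereditary subalgebras of `C[0,1] ⊗ Mₙ` -/

/-- The interval algebra `C[0,1] ⊗ Mₙ`. -/
abbrev IntervalAlg (n : ℕ) : Type := C(I, Matrix (Fin n) (Fin n) ℂ)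

section Subalgebras

variable {n : ℕ} (A : NonUnitalStarSubalgebra ℂ (IntervalAlg n))

/-- `A` is hereditary: `b₁ x b₂ ∈ A` for all `b₁, b₂ ∈ A` and all `x` in the interval algebra
(used for closed `A`). -/
def IsHereditarySubalg : Prop :=
  ∀ b₁ ∈ A, ∀ b₂ ∈ A, ∀ x : IntervalAlg n, b₁ * x * b₂ ∈ A

/-- `A` is full: no proper closed two-sided ideal of the interval algebra contains it. -/
def IsFullSubalg : Prop :=
  ∀ J : TwoSidedIdeal (IntervalAlg n), IsClosed (J : Set (IntervalAlg n)) →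
    (∀ a ∈ A, a ∈ J) → J = ⊤

/-- The space `A(t) ℂⁿ`, on which `A` acts by evaluation at `t`. For hereditary `A` these
representations (for those `t` where the space is nonzero; for every `t` when `A` is full) are the
irreducible representations of `A`. -/
def evalSpace (t : I) : Submodule ℂ (Fin n → ℂ) :=
  Submodule.span ℂ {w | ∃ a ∈ A, ∃ v : Fin n → ℂ, w = (a t).mulVec v}

/-- The dimension function of `A`. -/
def dimFun (t : I) : ℕ := Module.finrank ℂ (evalSpace A t)

/-- The dimension function is a finite step function: it is constant on each member of some
partition of `[0,1]` into finitely many intervals. -/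
def IsStepSubalg : Prop :=
  ∃ c : Set (Set I), c.Finite ∧ Setoid.IsPartition c ∧
    ∀ s ∈ c, s.OrdConnected ∧ ∀ x ∈ s, ∀ y ∈ s, dimFun A x = dimFun A y

end Subalgebras

/-! ### The generators, the relations, and the concrete model

From here on `n = m + 1`, and an index `i : Fin (m + 1)` stands for the index `i + 1 ∈ {1, …, n}` of
the usual numbering. -/

section Presentation

variable {m : ℕ}

/-- The set `A_i`, in the decomposition of the dimension function `d` as the sum of the
characteristic functions of the increasing sets `A_1 ⊆ ⋯ ⊆ A_n`, namely
`A_i = {t | d t ≥ n + 1 - i}` for `i ∈ {1, …, n}`. -/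
def levelSet (A : NonUnitalStarSubalgebra ℂ (IntervalAlg (m + 1))) (i : Fin (m + 1)) : Set I :=
  {t | m + 1 ≤ dimFun A t + (i : ℕ)}

/-- The connected components of a set. -/
def Component (U : Set I) : Type := {C : Set I // ∃ x ∈ U, C = connectedComponentIn U x}

/-- The pairs `(i, k)` with `1 ≤ i ≤ n - 1`, where `k` runs over the connected components of
`A_i`. -/
abbrev CompIndex (A : NonUnitalStarSubalgebra ℂ (IntervalAlg (m + 1))) : Type :=
  Σ i : Fin m, Component (levelSet A i.castSucc)

/-- The abstract generators: `P`, the last generator `T = X_n`, and `X s = X_i^k` for the pairs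
`s = (i, k)`, `i ≤ n - 1`. -/
inductive StepGen (S : Type) : Type
  | P : StepGen S
  | T : StepGen S
  | X : S → StepGen S

/-- A choice of functions `f_i^k : [0,1] → [0,2]`, continuous and nonzero precisely on the
corresponding connected component of `A_i`. -/
def IsComponentFamily (A : NonUnitalStarSubalgebra ℂ (IntervalAlg (m + 1)))
    (f : CompIndex A → C(I, ℝ)) : Prop :=
  ∀ s t, 0 ≤ f s t ∧ f s t ≤ 2 ∧ (f s t ≠ 0 ↔ t ∈ s.2.1)

/-- The function `x ↦ min (max x 0) 1` on `ℝ`. -/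
def clampFun : C(ℝ, ℝ)₀ :=
  ⟨⟨fun x => min (max x 0) 1, by fun_prop⟩, by simp⟩

/-- The function `t ↦ h t - h 0` on `[0,1]`, extended to `ℝ` by constants. -/
def recentred (h : C(I, ℝ)) : C(ℝ, ℝ)₀ :=
  ⟨⟨fun x => h (Set.projIcc 0 1 zero_le_one x) - h 0,
    (h.continuous.comp continuous_projIcc).sub continuous_const⟩, by simp⟩

/-- The expression `h(T)`, for `h` continuous on `[0,1]`, formed in the corner with unit `P`, that
is, `(h - h(0))(T) + h(0) P`. -/
def cornerFC {S : Type} (h : C(I, ℝ)) : CStarExpr (StepGen S) :=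
  .fc (recentred h) (.gen .T) + ((h 0 : ℝ) : ℂ) • .gen .P

/-- The relations between the generators. The relation `T = min (max T 0) 1` expresses
`0 ≤ T ≤ 1`. -/
def stepRelations {S : Type} (f : S → C(I, ℝ)) : Set (CStarRelation (StepGen S)) :=
  let P : CStarExpr (StepGen S) := .gen .P
  let T : CStarExpr (StepGen S) := .gen .T
  let X : S → CStarExpr (StepGen S) := fun s => .gen (.X s)
  -- norm and projection relations
  {.equal P (star P), .equal P (P * P), .normLE T 1} ∪
  {r | ∃ s, r = .normLE (X s) 2} ∪
  -- polynomial and order relations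
  {r | ∃ s s', r = .isZero (X s * X s')} ∪
  {r | ∃ s s', s ≠ s' ∧ r = .isZero (X s * star (X s'))} ∪
  {r | ∃ s, r = .equal (P * X s) (X s)} ∪
  {r | ∃ s, r = .isZero (X s * P)} ∪
  {.equal (P * T) T, .equal (T * P) T, .equal T (.fc clampFun T)} ∪
  -- functional-calculus relations: `X s * star (X s) = (f s)² (T)`
  {r | ∃ s, r = .equal (X s * star (X s)) (cornerFC (f s * f s))}

/-- The algebra of all continuous `g : [0,1] → M_n` whose `(i, j)` entry vanishes off `U_i ∩ U_j`.
For increasing open `U_i` its `(i, j)` entries form `C₀(U_{min(i,j)})`. -/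
def modelAlg (U : Fin (m + 1) → Set I) : NonUnitalStarSubalgebra ℂ (IntervalAlg (m + 1)) where
  carrier := {g | ∀ t i j, (t ∉ U i ∨ t ∉ U j) → g t i j = 0}
  add_mem' {a b} ha hb t i j h := by simp [ha t i j h, hb t i j h]
  zero_mem' t i j _ := by simp
  mul_mem' {a b} ha hb t i j h := by
    simp only [ContinuousMap.mul_apply, Matrix.mul_apply]
    refine Finset.sum_eq_zero fun k _ => ?_
    rcases h with h | h
    · rw [ha t i k (.inl h), zero_mul]
    · rw [hb t k j (.inr h), mul_zero]
  smul_mem' c a ha t i j h := by simp [ha t i j h]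
  star_mem' {a} ha t i j h := by
    simp [Matrix.star_apply, ha t j i h.symm]

/-- The function `t ↦ h t ⊗ e_{n,i}`. -/
def lastRow (h : C(I, ℝ)) (i : Fin (m + 1)) : IntervalAlg (m + 1) :=
  ⟨fun t => Matrix.single (Fin.last m) i ((h t : ℝ) : ℂ), by
    refine continuous_matrix fun a b => ?_
    simp only [Matrix.single_apply]
    split_ifs
    · fun_prop
    · fun_prop⟩

/-- The concrete generators: `P ↦ 1 ⊗ e_{nn}`, `X_n ↦ t ⊗ e_{nn}`, `X_i^k ↦ f_i^k ⊗ e_{ni}`. -/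
def concreteGen {A : NonUnitalStarSubalgebra ℂ (IntervalAlg (m + 1))}
    (f : CompIndex A → C(I, ℝ)) : StepGen (CompIndex A) → IntervalAlg (m + 1)
  | .P => lastRow 1 (Fin.last m)
  | .T => lastRow ⟨fun t => (t : ℝ), continuous_subtype_val⟩ (Fin.last m)
  | .X s => lastRow (f s) s.1.castSucc

end Presentation

end

/-! Write E(t) = A(t)ℂⁿ and d(t) = dim E(t). Over a one-dimensional base a generic complex function
has no zeros, so a Baire category argument yields globally defined, mutually orthogonal continuous
sections of E, exactly the first d(t) of which are nonzero at t (`exists_orthogonal_frame`).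
Normalised, they are the columns of a field W of partial isometries with W*W = diag(1_{A_i}).
Although W may jump at the ends of the A_i, W*aW is continuous for a in A. The map a ↦ W*aW is onto
H because a closed hereditary subalgebra contains every function whose values lie in the fibrewise
corners (`mem_of_pointwise_interpolation`, `exists_starAlgEquiv_modelAlg`). Fullness gives A_n =
[0,1], and the step condition gives finitely many components.

Universality. In a representation, P and X_n define a homomorphism ρ from C[0,1] to the corner of P,
and X_s X_s* = ρ(f_s²). The polar part v_s of X_s need not lie in B, but v_s* ρ(h) v_{s'} does
whenever h vanishes wherever f_s or f_{s'} does: it is a limit formed with the approximate inverses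
f/(f² + 1/(k+1)). Cutting the entries of an element of H along the components and adding up these
limits gives the homomorphism (`IsCellRep.exists_hom`). The same approximation and the
Stone–Weierstrass theorem show that the generators generate H (`mem_of_generators_mem`), hence
uniqueness.

Weak stability. Along a sequence of approximate representations with ε → 0, functional calculus
corrects P to a projection, X_n to a positive contraction in its corner, and X_s to P X_s (1 - P)
(`exists_asymptotic_hom`). What remains is that X_s X_{s'}* is only close to the diagonal matrix
ρ(f_s²). Put the X_s* into one row x, so that x*x ≈ f². This cannot be repaired by dividing by f,
which is small near the frontiers of the components. But the frontiers are finite, so there is a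
monotone map γ of [0,1], close to the identity, which is constant near each frontier point; then f
is bounded below on the set where f∘γ ≠ 0. Rescaling by r ≈ (f∘γ)/f makes (xr)*(xr) dominate (f∘γ)²,
and a polar decomposition argument (`exists_star_mul_self_eq`) produces a row z near xr with z*z =
(f∘γ)² exactly. With γ(X_n) in place of X_n this is an exact representation
(`exists_exactRep_near`). -/

noncomputable section

/-! ### Orthogonal frames of a field of subspaces -/

section Frames

variable {V : Type*} [NormedAddCommGroup V] [InnerProductSpace ℂ V]

local notation "⟪" x ", " y "⟫" => inner ℂ x y

/-- A continuous complex function on the unit interval can be translated by a small amount, up to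
a small continuous perturbation, so that it has no zeros. -/
theorem exists_small_perturbation_ne_zero (c : C(I, ℂ)) {ε : ℝ} (hε : 0 < ε) :
    ∃ q : C(I, ℂ), (∀ t, ‖q t - c t‖ < ε) ∧ ∀ t, q t ≠ 0 := by
  have approx : ∀ g : C(I, ℝ), ∃ p : Polynomial ℝ, ∀ t : I, |p.eval (t : ℝ) - g t| < ε / 4 := by
    intro g
    obtain ⟨p, hp⟩ := exists_polynomial_near_of_continuousOn 0 1
      (fun x => g (Set.projIcc 0 1 zero_le_one x))
      (g.continuous.comp continuous_projIcc).continuousOn (ε / 4) (by positivity)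
    refine ⟨p, fun t => ?_⟩
    simpa using hp t t.2
  obtain ⟨p₁, h₁⟩ := approx ⟨fun t => (c t).re, by fun_prop⟩
  obtain ⟨p₂, h₂⟩ := approx ⟨fun t => (c t).im, by fun_prop⟩
  let F : ℝ → ℂ := fun x => ((p₁.eval x : ℝ) : ℂ) + ((p₂.eval x : ℝ) : ℂ) * Complex.I
  have hF : ContDiff ℝ 1 F := by
    have e₁ : ContDiff ℝ 1 fun x : ℝ => ((p₁.eval x : ℝ) : ℂ) :=
      Complex.ofRealCLM.contDiff.comp (p₁.contDiff_aeval 1)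
    have e₂ : ContDiff ℝ 1 fun x : ℝ => ((p₂.eval x : ℝ) : ℂ) :=
      Complex.ofRealCLM.contDiff.comp (p₂.contDiff_aeval 1)
    exact e₁.add (e₂.mul contDiff_const)
  -- A C¹ curve in the plane has dense complement, so a translate by some small z avoids 0. The
  -- polynomial approximation serves only to make the curve smooth.
  have hd : Dense (Set.range F)ᶜ :=
    hF.dense_compl_range_of_finrank_lt_finrank (by simp [Complex.finrank_real_complex])
  obtain ⟨z, hz, hz'⟩ := hd.exists_dist_lt 0 (show (0 : ℝ) < ε / 4 by positivity)
  refine ⟨⟨fun t => F t - z, ?_⟩, fun t => ?_, fun t ht => ?_⟩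
  · exact (hF.continuous.comp continuous_subtype_val).sub continuous_const
  · have e : F t - z - c t = ((p₁.eval (t : ℝ) - (c t).re : ℝ) : ℂ)
        + ((p₂.eval (t : ℝ) - (c t).im : ℝ) : ℂ) * Complex.I - z := by
      conv_lhs => rw [← Complex.re_add_im (c t)]
      simp only [F]; push_cast; ring
    have h1 := h₁ t
    have h2 := h₂ t
    simp only [ContinuousMap.coe_mk] at h1 h2 ⊢
    rw [e]
    have hz2 : ‖z‖ < ε / 4 := by simpa [dist_eq_norm] using hz'
    calc _ ≤ ‖((p₁.eval (t : ℝ) - (c t).re : ℝ) : ℂ)‖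
          + ‖((p₂.eval (t : ℝ) - (c t).im : ℝ) : ℂ) * Complex.I‖ + ‖z‖ :=
            (norm_sub_le _ _).trans (by gcongr; exact norm_add_le _ _)
      _ < ε := by
        rw [norm_mul, Complex.norm_I, mul_one, Complex.norm_real, Complex.norm_real,
          Real.norm_eq_abs, Real.norm_eq_abs]
        linarith
  · exact hz ⟨t, sub_eq_zero.1 ht⟩

/-- In a closed submodule over `C[0,1]` of sections, the generic section vanishes at no point at
which some section of the submodule is nonzero. -/
theorem exists_generic_section [CompleteSpace V] (Γ : Submodule ℂ C(I, V))
    (hΓ : IsClosed (Γ : Set C(I, V))) (hmod : ∀ c : C(I, ℂ), ∀ ξ ∈ Γ, c • ξ ∈ Γ) :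
    ∃ ξ ∈ Γ, ∀ t, (∃ ζ ∈ Γ, ζ t ≠ 0) → ξ t ≠ 0 := by
  have : CompleteSpace Γ := hΓ.completeSpace_coe
  let U : Set I := {t | ∃ ζ ∈ Γ, ζ t ≠ 0}
  -- near each good point, nonvanishing sections are generic
  have key : ∀ ζ : Γ, ∀ δ : ℝ, 0 < δ →
      IsOpen {ξ : Γ | ∀ t ∈ {t | δ ≤ ‖(ζ : C(I, V)) t‖}, (ξ : C(I, V)) t ≠ 0} ∧
      Dense {ξ : Γ | ∀ t ∈ {t | δ ≤ ‖(ζ : C(I, V)) t‖}, (ξ : C(I, V)) t ≠ 0} := by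
    intro ζ δ hδ
    have hK : IsCompact {t | δ ≤ ‖(ζ : C(I, V)) t‖} :=
      (isClosed_le continuous_const (by fun_prop)).isCompact
    constructor
    · have := (ContinuousMap.isOpen_setOfPred_mapsTo (Y := V) hK
        (isOpen_compl_singleton (x := (0 : V)))).preimage
        (continuous_subtype_val : Continuous (Subtype.val : Γ → C(I, V)))
      convert this using 1
      ext ξ
      rfl
    · rw [Metric.dense_iff]
      intro ξ r hr
      -- Where ‖ζ‖ ≥ δ, this is the coefficient of ξ along ζ; the maximum only keeps it defined
      -- elsewhere. Adding (q - c)ζ replaces it by q, which has no zeros.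
      let c : C(I, ℂ) := ⟨fun t => ⟪(ζ : C(I, V)) t, (ξ : C(I, V)) t⟫ /
          ((max (‖(ζ : C(I, V)) t‖ ^ 2) (δ ^ 2) : ℝ) : ℂ), by
        refine Continuous.div (by fun_prop) (by fun_prop) fun t => ?_
        have : 0 < max (‖(ζ : C(I, V)) t‖ ^ 2) (δ ^ 2) := lt_max_of_lt_right (by positivity)
        exact_mod_cast this.ne'⟩
      obtain ⟨q, hq, hq0⟩ := exists_small_perturbation_ne_zero c
        (show 0 < r / (2 * (‖ζ‖ + 1)) by positivity)
      refine ⟨ξ + ⟨(q - c) • (ζ : C(I, V)), hmod _ _ ζ.2⟩, ?_, ?_⟩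
      · rw [Metric.mem_ball, dist_eq_norm, add_sub_cancel_left]
        change ‖(q - c) • (ζ : C(I, V))‖ < r
        refine lt_of_le_of_lt ((ContinuousMap.norm_le _ (C := r / 2) (by positivity)).2 fun t => ?_)
          (by linarith)
        change ‖(q t - c t) • (ζ : C(I, V)) t‖ ≤ _
        rw [norm_smul]
        calc _ ≤ r / (2 * (‖ζ‖ + 1)) * (‖ζ‖ + 1) := by
              gcongr
              · exact (hq t).le
              · exact ((ζ : C(I, V)).norm_coe_le_norm t).trans (by simp)
          _ = r / 2 := by field_simp
      · intro t ht h0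
        have ht' : δ ≤ ‖(ζ : C(I, V)) t‖ := ht
        have hz : (ζ : C(I, V)) t ≠ 0 := by
          intro h; rw [h, norm_zero] at ht'; linarith
        have h0' : (ξ : C(I, V)) t + (q t - c t) • (ζ : C(I, V)) t = 0 := h0
        have h1 : ⟪(ζ : C(I, V)) t, (ξ : C(I, V)) t + (q t - c t) • (ζ : C(I, V)) t⟫ = 0 := by
          rw [h0', inner_zero_right]
        have hc : ⟪(ζ : C(I, V)) t, (ξ : C(I, V)) t⟫ = c t * (‖(ζ : C(I, V)) t‖ : ℂ) ^ 2 := by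
          have : max (‖(ζ : C(I, V)) t‖ ^ 2) (δ ^ 2) = ‖(ζ : C(I, V)) t‖ ^ 2 :=
            max_eq_left (by gcongr)
          simp only [c, ContinuousMap.coe_mk, this]
          have : (‖(ζ : C(I, V)) t‖ : ℂ) ≠ 0 := by simpa using hz
          push_cast
          field_simp
        rw [inner_add_right, inner_smul_right, hc, inner_self_eq_norm_sq_to_K] at h1
        have h2 : q t * (‖(ζ : C(I, V)) t‖ : ℂ) ^ 2 = 0 := by
          rw [← h1]; simp only [Complex.coe_algebraMap]; ring
        rcases mul_eq_zero.1 h2 with h | h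
        · exact hq0 t h
        · exact hz (by simpa using h)
  -- countably many of these open dense sets suffice
  have hex : ∀ t : U, ∃ ζ : Γ, ∃ δ : ℝ, 0 < δ ∧ δ < ‖(ζ : C(I, V)) t‖ := by
    rintro ⟨t, ζ, hζ, hne⟩
    obtain ⟨δ, h1, h2⟩ := exists_between (norm_pos_iff.2 hne)
    exact ⟨⟨ζ, hζ⟩, δ, h1, h2⟩
  choose ζ δ hδ hδ' using hex
  obtain ⟨T, hT, hTU⟩ := TopologicalSpace.isOpen_iUnion_countable
    (fun s : U => {t | δ s < ‖(ζ s : C(I, V)) t‖})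
    (fun s => isOpen_lt continuous_const (by fun_prop))
  -- Baire category in the complete space Γ.
  have hd := dense_biInter_of_isOpen (fun s (_ : s ∈ T) => (key (ζ s) (δ s) (hδ s)).1) hT
    (fun s _ => (key (ζ s) (δ s) (hδ s)).2)
  obtain ⟨ξ, hξ⟩ := hd.nonempty
  refine ⟨ξ, ξ.2, fun t ht => ?_⟩
  have : t ∈ ⋃ s ∈ T, {t | δ s < ‖(ζ s : C(I, V)) t‖} := by
    rw [hTU]; exact Set.mem_iUnion.2 ⟨⟨t, ht⟩, hδ' ⟨t, ht⟩⟩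
  obtain ⟨s, hs, hst⟩ := Set.mem_iUnion₂.1 this
  exact Set.mem_iInter₂.1 hξ s hs t (show δ s ≤ ‖(ζ s : C(I, V)) t‖ from le_of_lt hst)

/-- A family of mutually orthogonal vectors, of which exactly the first `finrank E` are nonzero,
leaves no room in `E` for another orthogonal vector. -/
theorem eq_zero_of_orthogonal_frame [FiniteDimensional ℂ V] (E : Submodule ℂ V) (e : ℕ → V)
    (hE : ∀ j < Module.finrank ℂ E, e j ∈ E ∧ e j ≠ 0)
    (ho : ∀ j < Module.finrank ℂ E, ∀ l < Module.finrank ℂ E, j ≠ l → ⟪e j, e l⟫ = 0)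
    {v : V} (hv : v ∈ E) (hvo : ∀ j < Module.finrank ℂ E, ⟪e j, v⟫ = 0) : v = 0 := by
  by_contra hne
  let w : Option (Fin (Module.finrank ℂ E)) → E := fun o =>
    o.elim ⟨v, hv⟩ fun j => ⟨e j, (hE j j.2).1⟩
  have hw : LinearIndependent ℂ w := by
    refine linearIndependent_of_ne_zero_of_inner_eq_zero (𝕜 := ℂ) ?_ ?_
    · rintro (_ | j) h
      · exact hne (congrArg Subtype.val h)
      · exact (hE j j.2).2 (congrArg Subtype.val h)
    · rintro (_ | j) (_ | l) h
      · exact absurd rfl h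
      · exact inner_eq_zero_symm.1 (hvo l l.2)
      · exact hvo j j.2
      · exact ho j j.2 l l.2 fun h' => h (by rw [Fin.ext h'])
  have := hw.fintype_card_le_finrank
  simp at this

/-- A lower semicontinuous field of subspaces over `[0,1]` has continuous orthogonal sections, of
which exactly the first `finrank` many are nonzero at each point. -/
theorem exists_orthogonal_frame [FiniteDimensional ℂ V] (E : I → Submodule ℂ V)
    (hE : ∀ t, ∀ v ∈ E t, ∃ ξ : C(I, V), (∀ s, ξ s ∈ E s) ∧ ξ t = v) (K : ℕ) :
    ∃ e : ℕ → C(I, V), (∀ j < K, ∀ t, e j t ∈ E t) ∧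
      (∀ j < K, ∀ l < K, j ≠ l → ∀ t, ⟪e j t, e l t⟫ = 0) ∧
      ∀ j < K, ∀ t, e j t ≠ 0 ↔ j < Module.finrank ℂ (E t) := by
  have : CompleteSpace V := FiniteDimensional.complete ℂ V
  induction K with
  | zero => exact ⟨fun _ => 0, by simp, by simp, by simp⟩
  | succ K ih =>
    obtain ⟨e, he, ho, hr⟩ := ih
    -- Sections of E orthogonal to those already built; a generic element of this space is the next
    -- one.
    let Γ : Submodule ℂ C(I, V) :=
      { carrier := {ξ | ∀ t, ξ t ∈ E t ∧ ∀ j < K, ⟪e j t, ξ t⟫ = 0}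
        add_mem' := fun {a b} ha hb t => ⟨(E t).add_mem (ha t).1 (hb t).1, fun j hj => by
          simp [(ha t).2 j hj, (hb t).2 j hj]⟩
        zero_mem' := fun t => ⟨(E t).zero_mem, fun j _ => by simp⟩
        smul_mem' := fun c a ha t => ⟨(E t).smul_mem c (ha t).1, fun j hj => by
          simp [(ha t).2 j hj]⟩ }
    have hΓ : IsClosed (Γ : Set C(I, V)) := by
      have : (Γ : Set C(I, V)) = ⋂ t : I, ({ξ : C(I, V) | ξ t ∈ E t} ∩
          ⋂ j, ⋂ (_ : j < K), {ξ : C(I, V) | ⟪e j t, ξ t⟫ = 0}) := by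
        ext ξ; simp [Γ]
      rw [this]
      refine isClosed_iInter fun t => IsClosed.inter ?_ ?_
      · exact (E t).closed_of_finiteDimensional.preimage (continuous_eval_const t)
      · refine isClosed_iInter fun j => isClosed_iInter fun _ => isClosed_eq ?_ continuous_const
        exact continuous_const.inner (continuous_eval_const t)
    obtain ⟨ξ, hξ, hξ'⟩ := exists_generic_section Γ hΓ fun c ξ hξ t =>
      ⟨(E t).smul_mem _ (hξ t).1, fun j hj => by
        change ⟪e j t, c t • ξ t⟫ = 0
        rw [inner_smul_right, (hξ t).2 j hj, mul_zero]⟩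
    have hnew : ∀ t, ξ t ≠ 0 ↔ K < Module.finrank ℂ (E t) := by
      intro t
      constructor
      · intro hne
        by_contra hK
        push Not at hK
        exact hne (eq_zero_of_orthogonal_frame (E t) (fun j => e j t)
          (fun j hj => ⟨he j (by omega) t, (hr j (by omega) t).2 hj⟩)
          (fun j hj l hl h => ho j (by omega) l (by omega) h t) (hξ t).1
          (fun j hj => (hξ t).2 j (by omega)))
      · intro hK
        refine hξ' t ?_
        -- a vector of `E t` orthogonal to the first `K` sections
        have hv : ∃ v ∈ E t, v ≠ 0 ∧ ∀ j < K, ⟪e j t, v⟫ = 0 := by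
          let L : E t →ₗ[ℂ] (Fin K → ℂ) :=
            LinearMap.pi fun j => (innerₛₗ ℂ (e j t)).comp (E t).subtype
          have hL : LinearMap.ker L ≠ ⊥ := by
            intro h
            have := LinearMap.finrank_le_finrank_of_injective (LinearMap.ker_eq_bot.1 h)
            simp at this
            omega
          obtain ⟨v, hv, hv0⟩ := (LinearMap.ker L).ne_bot_iff.1 hL
          refine ⟨v, v.2, by simpa using hv0, fun j hj => ?_⟩
          exact congrFun (LinearMap.mem_ker.1 hv) ⟨j, hj⟩
        obtain ⟨v, hvE, hv0, hvo⟩ := hv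
        obtain ⟨ω, hω, hωt⟩ := hE t v hvE
        -- Gram–Schmidt with denominators cleared: multiplying by the product of all ‖e l‖² keeps ζ
        -- continuous where some e l vanishes. At t the product is nonzero, since K is less than the
        -- rank there.
        let ν : ℕ → C(I, ℂ) := fun l => ⟨fun s => (‖e l s‖ : ℂ) ^ 2, by fun_prop⟩
        let ζ : C(I, V) := ⟨fun s => (∏ l ∈ Finset.range K, ν l s) • ω s -
          ∑ k ∈ Finset.range K,
            ((∏ l ∈ (Finset.range K).erase k, ν l s) * ⟪e k s, ω s⟫) • e k s, by fun_prop⟩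
        refine ⟨ζ, fun s => ⟨?_, fun j hj => ?_⟩, ?_⟩
        · refine (E s).sub_mem ((E s).smul_mem _ (hω s)) ((E s).sum_mem fun k hk => ?_)
          exact (E s).smul_mem _ (he k (Finset.mem_range.1 hk) s)
        · change ⟪e j s, (∏ l ∈ Finset.range K, ν l s) • ω s - ∑ k ∈ Finset.range K,
            ((∏ l ∈ (Finset.range K).erase k, ν l s) * ⟪e k s, ω s⟫) • e k s⟫ = 0
          rw [inner_sub_right, inner_smul_right, inner_sum,
            Finset.sum_eq_single_of_mem j (Finset.mem_range.2 hj), inner_smul_right,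
            inner_self_eq_norm_sq_to_K, sub_eq_zero,
            ← Finset.prod_erase_mul _ _ (Finset.mem_range.2 hj)]
          · simp only [ν, ContinuousMap.coe_mk, Complex.coe_algebraMap]; ring
          · intro k hk hkj
            rw [inner_smul_right, ho j hj k (Finset.mem_range.1 hk) hkj.symm, mul_zero]
        · have : ζ t = (∏ l ∈ Finset.range K, ν l t) • v := by
            change (∏ l ∈ Finset.range K, ν l t) • ω t - ∑ k ∈ Finset.range K,
              ((∏ l ∈ (Finset.range K).erase k, ν l t) * ⟪e k t, ω t⟫) • e k t = _
            rw [hωt, Finset.sum_eq_zero, sub_zero]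
            intro k hk
            rw [hvo k (Finset.mem_range.1 hk), mul_zero, zero_smul]
          rw [this]
          refine smul_ne_zero (Finset.prod_ne_zero_iff.2 fun l hl => ?_) hv0
          have hl' := Finset.mem_range.1 hl
          have := (hr l hl' t).2 (by omega)
          simpa [ν] using this
    have hlt : ∀ {j}, j < K + 1 → j ≠ K → j < K := fun h h' => by omega
    refine ⟨Function.update e K ξ, fun j hj t => ?_, fun j hj l hl hjl t => ?_, fun j hj t => ?_⟩
    · by_cases h : j = K
      · subst h; simpa using (hξ t).1
      · simpa [h] using he j (hlt hj h) t
    · by_cases h : j = K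
      · subst h
        simpa [hjl.symm] using inner_eq_zero_symm.1 ((hξ t).2 l (hlt hl hjl.symm))
      · by_cases h' : l = K
        · subst h'; simpa [h] using (hξ t).2 j (hlt hj h)
        · simpa [h, h'] using ho j (hlt hj h) l (hlt hl h') hjl t
    · by_cases h : j = K
      · subst h; simpa using hnew t
      · simpa [h] using hr j (hlt hj h) t

end Frames

/-! ### Membership in a closed hereditary subalgebra -/

section Membership

variable {n : ℕ} {A : NonUnitalStarSubalgebra ℂ (IntervalAlg n)}

/-- The elements whose multiples by all continuous scalar functions lie in `A`. -/
def scalarStablePart (A : NonUnitalStarSubalgebra ℂ (IntervalAlg n)) :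
    Submodule ℂ (IntervalAlg n) where
  carrier := {b | ∀ c : C(I, ℂ), c • b ∈ A}
  zero_mem' c := by
    convert zero_mem A
    ext t i j
    simp
  add_mem' {a b} ha hb c := by
    convert add_mem (ha c) (hb c)
    ext t i j
    simp [mul_add]
  smul_mem' z b hb c := by
    have h : z • c • b ∈ A := A.smul_mem' z (hb c)
    convert h using 1
    ext t i j
    simp [mul_left_comm]


/-- A closed subspace of `C[0,1] ⊗ Mₙ` contains every function which it can interpolate at each
point by an element that may be multiplied by arbitrary scalar functions. -/
theorem mem_of_pointwise_interpolation (hclosed : IsClosed (A : Set (IntervalAlg n)))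
    (g : IntervalAlg n)
    (hg : ∀ t, ∃ b ∈ scalarStablePart A, b t = g t) : g ∈ A := by
  choose b hbA hb using hg
  refine hclosed.closure_subset (Metric.mem_closure_iff.2 fun ε hε => ?_)
  have hU : ∀ t, IsOpen {s | ‖b t s - g s‖ < ε / 2} := fun t =>
    isOpen_lt (by fun_prop) continuous_const
  obtain ⟨T, hT⟩ := isCompact_univ.elim_finite_subcover _ hU fun t _ =>
    Set.mem_iUnion.2 ⟨t, by simp [hb, hε]⟩
  -- The local interpolants are glued by a partition of unity; this is where multiples by arbitrary
  -- scalar functions must stay in A.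
  obtain ⟨ρ, hρ⟩ := PartitionOfUnity.exists_isSubordinate isClosed_univ
    (fun t : T => {s | ‖b t s - g s‖ < ε / 2}) (fun t => hU t) fun s hs => by
      obtain ⟨t, ht, hst⟩ := Set.mem_iUnion₂.1 (hT hs)
      exact Set.mem_iUnion.2 ⟨⟨t, ht⟩, hst⟩
  have hsum : ∀ s, ∑ t, ρ t s = 1 := fun s => by
    rw [← ρ.sum_eq_one (Set.mem_univ s), finsum_eq_sum_of_fintype]
  refine ⟨∑ t : T, (⟨fun s => (ρ t s : ℂ), by fun_prop⟩ : C(I, ℂ)) • b t,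
    sum_mem fun t _ => hbA t _, ?_⟩
  rw [dist_comm, dist_eq_norm]
  refine lt_of_le_of_lt ((ContinuousMap.norm_le _ (C := ε / 2) (by positivity)).2 fun s => ?_)
    (by linarith)
  have e : (∑ t : T, (⟨fun s => (ρ t s : ℂ), by fun_prop⟩ : C(I, ℂ)) • b t - g) s
      = ∑ t : T, (ρ t s : ℂ) • (b t s - g s) := by
    simp only [smul_sub, Finset.sum_sub_distrib, ← Finset.sum_smul, ContinuousMap.sub_apply,
      ContinuousMap.sum_apply]
    rw [← Complex.ofReal_sum, hsum]
    simp only [Complex.ofReal_one, one_smul]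
    rfl
  rw [e]
  calc _ ≤ ∑ t : T, ρ t s * (ε / 2) := (norm_sum_le _ _).trans (Finset.sum_le_sum fun t _ => by
        rw [norm_smul, Complex.norm_real, Real.norm_of_nonneg (ρ.nonneg t s)]
        by_cases h : ρ t s = 0
        · simp [h]
        · have : s ∈ {s | ‖b t s - g s‖ < ε / 2} := hρ t (subset_tsupport _ h)
          exact mul_le_mul_of_nonneg_left (le_of_lt (by simpa using this)) (ρ.nonneg t s))
    _ = ε / 2 := by rw [← Finset.sum_mul, hsum, one_mul]

/-- A scalar function can be moved into the middle factor, where heredity admits any element of the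
interval algebra. -/
theorem mul_const_mul_mem (hher : IsHereditarySubalg A) {a a' : IntervalAlg n} (ha : a ∈ A)
    (ha' : a' ∈ A) (x : Matrix (Fin n) (Fin n) ℂ) :
    a * ContinuousMap.const I x * a' ∈ scalarStablePart A := by
  intro c
  have := hher a ha a' ha' (c • ContinuousMap.const I x)
  convert this using 1
  ext t i j
  simp [mul_assoc]

/-- Rank one operators on the fibre of a hereditary subalgebra lie in the fibre. -/
theorem exists_vecMulVec (hher : IsHereditarySubalg A) (t : I) {v w : Fin n → ℂ}
    (hv : v ∈ evalSpace A t) (hw : w ∈ evalSpace A t) :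
    ∃ b ∈ scalarStablePart A, b t = Matrix.vecMulVec v (star w) := by
  induction hv using Submodule.span_induction with
  | mem v hv =>
    obtain ⟨a, ha, v', rfl⟩ := hv
    induction hw using Submodule.span_induction with
    | mem w hw =>
      obtain ⟨a', ha', w', rfl⟩ := hw
      -- The rank one operator (a v')(a' w')* is a (v' w'*) a'*, which has the hereditary form.
      refine ⟨a * ContinuousMap.const I (Matrix.vecMulVec v' (star w')) * star a',
        mul_const_mul_mem hher ha (star_mem ha') _, ?_⟩
      simp only [ContinuousMap.mul_apply, ContinuousMap.const_apply, ContinuousMap.star_apply]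
      rw [Matrix.mul_vecMulVec, Matrix.vecMulVec_mul, Matrix.star_mulVec]
      rfl
    | zero => exact ⟨0, zero_mem _, by simp⟩
    | add x y _ _ hx hy =>
      obtain ⟨b, hb, hb'⟩ := hx
      obtain ⟨d, hd, hd'⟩ := hy
      exact ⟨b + d, add_mem hb hd, by simp [hb', hd', Matrix.vecMulVec_add]⟩
    | smul z x _ hx =>
      obtain ⟨b, hb, hb'⟩ := hx
      exact ⟨star z • b, Submodule.smul_mem _ _ hb, by simp [hb', Matrix.vecMulVec_smul]⟩
  | zero => exact ⟨0, zero_mem _, by simp⟩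
  | add x y _ _ hx hy =>
    obtain ⟨b, hb, hb'⟩ := hx
    obtain ⟨d, hd, hd'⟩ := hy
    exact ⟨b + d, add_mem hb hd, by simp [hb', hd', Matrix.add_vecMulVec]⟩
  | smul z x _ hx =>
    obtain ⟨b, hb, hb'⟩ := hx
    exact ⟨z • b, Submodule.smul_mem _ _ hb, by simp [hb', Matrix.smul_vecMulVec]⟩

/-- Each vector of a fibre is the value of a continuous section. -/
theorem exists_section (t : I) {v : Fin n → ℂ} (hv : v ∈ evalSpace A t) :
    ∃ ξ : C(I, Fin n → ℂ), (∀ s, ξ s ∈ evalSpace A s) ∧ ξ t = v := by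
  induction hv using Submodule.span_induction with
  | mem v hv =>
    obtain ⟨a, ha, v', rfl⟩ := hv
    exact ⟨⟨fun s => (a s).mulVec v', by fun_prop⟩,
      fun s => Submodule.subset_span ⟨a, ha, v', rfl⟩, rfl⟩
  | zero => exact ⟨0, fun s => zero_mem _, rfl⟩
  | add x y _ _ hx hy =>
    obtain ⟨b, hb, hb'⟩ := hx
    obtain ⟨d, hd, hd'⟩ := hy
    exact ⟨b + d, fun s => add_mem (hb s) (hd s), by simp [hb', hd']⟩
  | smul z x _ hx =>
    obtain ⟨b, hb, hb'⟩ := hx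
    exact ⟨z • b, fun s => Submodule.smul_mem _ _ (hb s), by simp [hb']⟩

end Membership

/-! ### The field of partial isometries -/

section PartialIsometry

variable {m : ℕ} {A : NonUnitalStarSubalgebra ℂ (IntervalAlg (m + 1))}

/-- There is a field of partial isometries which carries the standard flag of length `dimFun` onto
the fibres of `A`, and whose columns are continuous where they do not vanish. -/
theorem exists_partialIsometry_field (A : NonUnitalStarSubalgebra ℂ (IntervalAlg (m + 1))) :
    ∃ W : I → Matrix (Fin (m + 1)) (Fin (m + 1)) ℂ,
      (∀ t i, (fun a => W t a i) ∈ evalSpace A t) ∧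
      (∀ t, (W t).conjTranspose * W t =
        Matrix.diagonal fun i => (levelSet A i).indicator (fun _ => (1 : ℂ)) t) ∧
      (∀ t, ∀ v ∈ evalSpace A t, (W t * (W t).conjTranspose).mulVec v = v) ∧
      ∀ i, IsOpen (levelSet A i) ∧ ∀ a, ContinuousOn (fun t => W t a i) (levelSet A i) := by
  let E : I → Submodule ℂ (EuclideanSpace ℂ (Fin (m + 1))) := fun t =>
    (evalSpace A t).comap (WithLp.linearEquiv 2 ℂ (Fin (m + 1) → ℂ)).toLinearMap
  have hE : ∀ t, Module.finrank ℂ (E t) = dimFun A t := fun t => by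
    have h : E t = (evalSpace A t).map
        ((WithLp.linearEquiv 2 ℂ (Fin (m + 1) → ℂ)).symm : _ →ₗ[ℂ] _) :=
      Submodule.comap_equiv_eq_map_symm _ _
    rw [h]
    exact LinearEquiv.finrank_map_eq _ _
  have hle : ∀ t, dimFun A t ≤ m + 1 := fun t => by
    simpa [dimFun] using Submodule.finrank_le (evalSpace A t)
  obtain ⟨e, heE, heo, hen⟩ := exists_orthogonal_frame E (fun t v hv => by
    obtain ⟨ξ, hξ, hξt⟩ := exists_section (A := A) t (v := WithLp.ofLp v) hv
    exact ⟨⟨fun s => WithLp.toLp 2 (ξ s), by fun_prop⟩, hξ, by simp [hξt]⟩) (m + 1)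
  -- The frame starts with the section that is nonzero most often, whereas the level sets increase
  -- with i. Reversing the order makes column i nonzero exactly on `levelSet A i`.
  let k : Fin (m + 1) → ℕ := fun i => m - i
  have hk : ∀ i, k i < m + 1 := fun i => by simp only [k]; omega
  have hkinj : ∀ i j, i ≠ j → k i ≠ k j := fun i j h h' => h (by
    have := i.2; have := j.2; simp only [k] at h'; ext; omega)
  have hlev : ∀ t i, e (k i) t ≠ 0 ↔ t ∈ levelSet A i := fun t i => by
    rw [hen _ (hk i), hE]
    have := i.2
    simp only [levelSet, Set.mem_ofPred_eq, k]
    omega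
  -- Since 0⁻¹ = 0, the normalised section is 0 where the section vanishes, and may be discontinuous
  -- there.
  let η : I → Fin (m + 1) → EuclideanSpace ℂ (Fin (m + 1)) := fun t i =>
    ((‖e (k i) t‖⁻¹ : ℝ) : ℂ) • e (k i) t
  have hη : ∀ t i j, inner ℂ (η t i) (η t j) =
      if i = j then (levelSet A i).indicator (fun _ => (1 : ℂ)) t else 0 := by
    intro t i j
    simp only [η, inner_smul_left, inner_smul_right]
    split_ifs with h
    · subst h
      by_cases hz : e (k i) t = 0
      · rw [Set.indicator_of_notMem (by rw [← hlev]; simpa using hz)]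
        simp [hz]
      · rw [Set.indicator_of_mem ((hlev t i).1 hz), inner_self_eq_norm_sq_to_K]
        have : (‖e (k i) t‖ : ℂ) ≠ 0 := by simpa using hz
        simp only [Complex.conj_ofReal]
        simp only [Complex.ofReal_inv, Complex.coe_algebraMap]
        field_simp
    · rw [heo _ (hk i) _ (hk j) (hkinj i j h)]; simp
  refine ⟨fun t => Matrix.of fun a i => η t i a, fun t i => ?_, fun t => ?_, fun t v hv => ?_,
    fun i => ⟨?_, fun a => ?_⟩⟩
  · exact (E t).smul_mem _ (heE _ (hk i) t)
  · ext i j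
    rw [Matrix.diagonal_apply, ← hη, Matrix.mul_apply, PiLp.inner_apply]
    refine Finset.sum_congr rfl fun a _ => ?_
    simp [mul_comm]
  · have hvE : WithLp.toLp 2 v ∈ E t := hv
    -- The component of v off the columns lies in E t and is orthogonal to a frame of full length.
    have key : WithLp.toLp 2 v - ∑ i, inner ℂ (η t i) (WithLp.toLp 2 v) • η t i = 0 := by
      refine eq_zero_of_orthogonal_frame (E t) (fun j => e j t) (fun j hj => ?_)
        (fun j hj l hl h => ?_) ((E t).sub_mem hvE ((E t).sum_mem fun i _ =>
          (E t).smul_mem _ ((E t).smul_mem _ (heE _ (hk i) t)))) fun j hj => ?_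
      · rw [hE] at hj
        have := hle t
        exact ⟨heE j (by omega) t, (hen j (by omega) t).2 (by rwa [hE])⟩
      · rw [hE] at hj hl
        have := hle t
        exact heo j (by omega) l (by omega) h t
      · have hj' : j < m + 1 := by rw [hE] at hj; exact hj.trans_le (hle t)
        let i : Fin (m + 1) := ⟨m - j, by omega⟩
        have hi : k i = j := by simp only [k, i]; omega
        have hne : e j t ≠ 0 := (hen j hj' t).2 hj
        have hej : e j t = (‖e j t‖ : ℂ) • η t i := by
          have : (‖e j t‖ : ℂ) ≠ 0 := by simpa using hne
          simp only [η, hi, smul_smul, Complex.ofReal_inv]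
          rw [mul_inv_cancel₀ this, one_smul]
        rw [hej, inner_smul_left, inner_sub_right, inner_sum,
          Finset.sum_eq_single_of_mem i (Finset.mem_univ i), inner_smul_right, hη, if_pos rfl,
          Set.indicator_of_mem ((hlev t i).1 (by rwa [hi]))]
        · simp
        · intro l _ hl
          rw [inner_smul_right, hη, if_neg hl.symm, mul_zero]
    funext a
    have := congrArg (fun w : EuclideanSpace ℂ (Fin (m + 1)) => w a) (sub_eq_zero.1 key)
    simp only [WithLp.ofLp_sum, Finset.sum_apply, WithLp.ofLp_smul, Pi.smul_apply,
      smul_eq_mul] at this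
    rw [this, ← Matrix.mulVec_mulVec]
    simp only [Matrix.mulVec, dotProduct, Matrix.of_apply, Matrix.conjTranspose_apply,
      PiLp.inner_apply]
    refine Finset.sum_congr rfl fun i _ => ?_
    rw [mul_comm]
    congr 1
    refine Finset.sum_congr rfl fun b _ => ?_
    simp [mul_comm]
  · have : levelSet A i = {t | e (k i) t ≠ 0} := by ext t; exact (hlev t i).symm
    rw [this]
    exact isOpen_ne_fun (by fun_prop) continuous_const
  · have h1 : ContinuousOn (fun t => η t i) (levelSet A i) := by
      refine ContinuousOn.smul (f := fun t => ((‖e (k i) t‖⁻¹ : ℝ) : ℂ)) ?_ (e (k i)).continuous.continuousOn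
      refine Complex.continuous_ofReal.comp_continuousOn (ContinuousOn.inv₀ (e (k i)).continuous.norm.continuousOn ?_)
      intro t ht
      simpa using (hlev t i).2 ht
    exact (EuclideanSpace.proj (𝕜 := ℂ) a).continuous.comp_continuousOn h1

end PartialIsometry

/-! ### The isomorphism with the model algebra -/

section ModelIso

variable {m : ℕ} {U : Fin (m + 1) → Set I} {W : I → Matrix (Fin (m + 1)) (Fin (m + 1)) ℂ}

open Filter Topology Matrix

/-- A field of partial isometries with domain projections `diag(1_{U_i})`, whose columns are
continuous where they do not vanish. -/
structure IsPartialIsometryField (U : Fin (m + 1) → Set I)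
    (W : I → Matrix (Fin (m + 1)) (Fin (m + 1)) ℂ) : Prop where
  conjTranspose_mul_self : ∀ t, (W t)ᴴ * W t =
    diagonal fun i => (U i).indicator (fun _ => (1 : ℂ)) t
  isOpen : ∀ i, IsOpen (U i)
  continuousOn : ∀ i a, ContinuousOn (fun t => W t a i) (U i)

theorem tendsto_zero_mul_of_norm_le_one {l : Filter I} {f g : I → ℂ} (hf : Tendsto f l (𝓝 0))
    (hg : ∀ t, ‖g t‖ ≤ 1) : Tendsto (fun t => f t * g t) l (𝓝 0) := by
  refine squeeze_zero_norm (fun t => ?_) (tendsto_zero_iff_norm_tendsto_zero.1 hf)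
  rw [norm_mul]
  exact mul_le_of_le_one_right (norm_nonneg _) (hg t)

namespace IsPartialIsometryField

theorem sum_star_mul (hW : IsPartialIsometryField U W) (t : I) (i j : Fin (m + 1)) :
    ∑ a, star (W t a i) * W t a j = if i = j then (U i).indicator (fun _ => (1 : ℂ)) t else 0 := by
  have := congrFun (congrFun (hW.conjTranspose_mul_self t) i) j
  rwa [mul_apply, diagonal_apply] at this

theorem sum_norm_sq (hW : IsPartialIsometryField U W) (t : I) (i : Fin (m + 1)) :
    ∑ a, ‖W t a i‖ ^ 2 = (U i).indicator (fun _ => (1 : ℝ)) t := by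
  have h := hW.sum_star_mul t i i
  rw [if_pos rfl] at h
  have : ((∑ a, ‖W t a i‖ ^ 2 : ℝ) : ℂ) = (((U i).indicator (fun _ => (1 : ℝ)) t : ℝ) : ℂ) := by
    push_cast
    simp only [← Complex.conj_mul']
    refine Eq.trans h ?_
    by_cases ht : t ∈ U i
    · rw [Set.indicator_of_mem ht, Set.indicator_of_mem ht, Complex.ofReal_one]
    · rw [Set.indicator_of_notMem ht, Set.indicator_of_notMem ht, Complex.ofReal_zero]
  exact_mod_cast this

theorem norm_le_one (hW : IsPartialIsometryField U W) (t : I) (a i : Fin (m + 1)) :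
    ‖W t a i‖ ≤ 1 := by
  have h : ‖W t a i‖ ^ 2 ≤ ∑ a, ‖W t a i‖ ^ 2 :=
    Finset.single_le_sum (f := fun a => ‖W t a i‖ ^ 2) (fun _ _ => by positivity)
      (Finset.mem_univ a)
  rw [hW.sum_norm_sq] at h
  have h' : (U i).indicator (fun _ => (1 : ℝ)) t ≤ 1 :=
    Set.indicator_le_self' (by simp) t |>.trans le_rfl
  exact (sq_le_one_iff₀ (norm_nonneg _)).1 (h.trans h')

theorem eq_zero (hW : IsPartialIsometryField U W) {t : I} {i : Fin (m + 1)} (ht : t ∉ U i)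
    (a : Fin (m + 1)) : W t a i = 0 := by
  have h := hW.sum_norm_sq t i
  rw [Set.indicator_of_notMem ht, Finset.sum_eq_zero_iff_of_nonneg (fun _ _ => by positivity)] at h
  simpa using h a (Finset.mem_univ a)

theorem continuousAt (hW : IsPartialIsometryField U W) {t : I} {i : Fin (m + 1)} (ht : t ∈ U i)
    (a : Fin (m + 1)) : ContinuousAt (fun t => W t a i) t :=
  (hW.continuousOn i a).continuousAt ((hW.isOpen i).mem_nhds ht)

/-- Column i may jump at t₀ but stays bounded. If t₀ ∈ U j, column j is continuous at t₀ and always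
orthogonal to column i, so W t₀ may be replaced by the small difference W t₀ - W t. Otherwise column
j of W t₀ is zero. -/
theorem tendsto_inner_zero (hW : IsPartialIsometryField U W) {t₀ : I} {i : Fin (m + 1)}
    (ht : t₀ ∉ U i) (j : Fin (m + 1)) :
    Tendsto (fun t => ((W t)ᴴ * W t₀) i j) (𝓝 t₀) (𝓝 0) := by
  by_cases hj : t₀ ∈ U j
  · have hij : i ≠ j := fun h => ht (h ▸ hj)
    have e : ∀ t, ((W t)ᴴ * W t₀) i j = ∑ a, (W t₀ a j - W t a j) * star (W t a i) := by
      intro t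
      have h := hW.sum_star_mul t i j
      rw [if_neg hij] at h
      simp only [sub_mul, Finset.sum_sub_distrib, mul_apply, conjTranspose_apply]
      rw [← sub_zero (∑ a, _), ← h]
      simp only [mul_comm]
    simp only [e]
    rw [← Finset.sum_const_zero (s := (Finset.univ : Finset (Fin (m + 1))))]
    refine tendsto_finsetSum _ fun a _ => tendsto_zero_mul_of_norm_le_one ?_ fun t => ?_
    · have := (tendsto_const_nhds (x := W t₀ a j)).sub (hW.continuousAt hj a).tendsto
      simpa using this
    · rw [norm_star]; exact hW.norm_le_one t a i
  · refine tendsto_const_nhds.congr fun t => ?_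
    rw [mul_apply]
    exact (Finset.sum_eq_zero fun a _ => by rw [hW.eq_zero hj, mul_zero]).symm

/-- The columns of g t₀ are combinations of the columns of W t₀. Up to the small term coming from g
t - g t₀, the row is therefore a combination of the inner products treated in `tendsto_inner_zero`.
-/
theorem tendsto_row_zero (hW : IsPartialIsometryField U W) {g : IntervalAlg (m + 1)}
    (hg : ∀ t, W t * (W t)ᴴ * g t = g t) {t₀ : I} {i : Fin (m + 1)} (ht : t₀ ∉ U i)
    (b : Fin (m + 1)) : Tendsto (fun t => ((W t)ᴴ * g t) i b) (𝓝 t₀) (𝓝 0) := by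
  have e : ∀ t, ((W t)ᴴ * g t) i b = ∑ a, (g t a b - g t₀ a b) * star (W t a i) +
      ∑ j, ((W t)ᴴ * W t₀) i j * ((W t₀)ᴴ * g t₀) j b := by
    intro t
    rw [← mul_apply, mul_assoc, ← mul_assoc (W t₀), hg]
    simp only [mul_apply, conjTranspose_apply, sub_mul, Finset.sum_sub_distrib]
    simp only [mul_comm (star _)]
    rw [sub_add_cancel]
  simp only [e]
  rw [show (0 : ℂ) = ∑ _a : Fin (m + 1), 0 + ∑ j, 0 * ((W t₀)ᴴ * g t₀) j b by simp]
  refine Tendsto.add (tendsto_finsetSum _ fun a _ => ?_) (tendsto_finsetSum _ fun j _ => ?_)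
  · refine tendsto_zero_mul_of_norm_le_one ?_ fun t => ?_
    · have h : Continuous fun t => g t a b := by fun_prop
      have := h.tendsto t₀ |>.sub_const (g t₀ a b)
      simpa using this
    · rw [norm_star]; exact hW.norm_le_one t a i
  · exact (hW.tendsto_inner_zero ht j).mul_const _

theorem tendsto_compress_zero (hW : IsPartialIsometryField U W) {g : IntervalAlg (m + 1)}
    (hg : ∀ t, W t * (W t)ᴴ * g t = g t) {t₀ : I} {i : Fin (m + 1)} (ht : t₀ ∉ U i)
    (j : Fin (m + 1)) : Tendsto (fun t => ((W t)ᴴ * g t * W t) i j) (𝓝 t₀) (𝓝 0) := by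
  simp only [mul_apply (N := W _)]
  rw [← Finset.sum_const_zero (s := (Finset.univ : Finset (Fin (m + 1))))]
  exact tendsto_finsetSum _ fun b _ => tendsto_zero_mul_of_norm_le_one
    (hW.tendsto_row_zero hg ht b) fun t => hW.norm_le_one t b j

theorem compress_eq_zero (hW : IsPartialIsometryField U W) (g : Matrix (Fin (m + 1)) (Fin (m + 1)) ℂ) {t : I}
    {i j : Fin (m + 1)} (h : t ∉ U i ∨ t ∉ U j) : ((W t)ᴴ * g * W t) i j = 0 := by
  rcases h with h | h
  · rw [mul_assoc, mul_apply]
    exact Finset.sum_eq_zero fun a _ => by rw [conjTranspose_apply, hW.eq_zero h]; simp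
  · rw [mul_apply]
    exact Finset.sum_eq_zero fun a _ => by rw [hW.eq_zero h, mul_zero]

/-- At t₀ an entry is either a polynomial in functions continuous there, or it is 0 and has to tend
to 0. The latter is `tendsto_compress_zero`, applied to the adjoint if it is the column index whose
set misses t₀. -/
theorem continuous_compress (hW : IsPartialIsometryField U W) {g : IntervalAlg (m + 1)}
    (hg : ∀ t, W t * (W t)ᴴ * g t = g t) (hg' : ∀ t, W t * (W t)ᴴ * star (g t) = star (g t)) :
    Continuous fun t => (W t)ᴴ * g t * W t := by
  refine continuous_matrix fun i j => continuous_iff_continuousAt.2 fun t₀ => ?_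
  by_cases hi : t₀ ∈ U i
  · by_cases hj : t₀ ∈ U j
    · simp only [mul_apply, conjTranspose_apply]
      refine tendsto_finsetSum _ fun a _ => Tendsto.mul (tendsto_finsetSum _ fun b _ =>
        Tendsto.mul ?_ ?_) (hW.continuousAt hj a)
      · exact (hW.continuousAt hi b).star
      · have h : Continuous fun t => g t b a := by fun_prop
        exact h.continuousAt
    · unfold ContinuousAt
      beta_reduce
      rw [hW.compress_eq_zero _ (.inr hj)]
      have := (hW.tendsto_compress_zero (g := star g) hg' hj i).star
      rw [star_zero] at this
      refine this.congr fun t => ?_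
      rw [← conjTranspose_apply, ContinuousMap.star_apply, star_eq_conjTranspose]
      simp only [conjTranspose_mul, conjTranspose_conjTranspose, mul_assoc]
  · unfold ContinuousAt
    beta_reduce
    rw [hW.compress_eq_zero _ (.inl hi)]
    exact hW.tendsto_compress_zero hg hi j

/-- Where a column may jump, the corresponding entry of h vanishes and suppresses the bounded
factors. -/
theorem continuous_expand (hW : IsPartialIsometryField U W) {h : IntervalAlg (m + 1)}
    (hh : h ∈ modelAlg U) : Continuous fun t => W t * h t * (W t)ᴴ := by
  refine continuous_matrix fun a b => ?_
  simp only [mul_apply, conjTranspose_apply, Finset.sum_mul]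
  refine continuous_finsetSum _ fun j _ => continuous_finsetSum _ fun i _ =>
    continuous_iff_continuousAt.2 fun t₀ => ?_
  have hc : Continuous fun t => h t i j := by fun_prop
  by_cases hij : t₀ ∈ U i ∧ t₀ ∈ U j
  · exact ((hW.continuousAt hij.1 a).mul hc.continuousAt).mul (hW.continuousAt hij.2 b).star
  · have h0 : h t₀ i j = 0 := hh t₀ i j (by tauto)
    unfold ContinuousAt
    beta_reduce
    rw [h0, mul_zero, zero_mul]
    have h1 : Tendsto (fun t => h t i j) (𝓝 t₀) (𝓝 0) := by
      rw [← h0]; exact hc.tendsto t₀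
    refine (tendsto_zero_mul_of_norm_le_one h1
      (g := fun t => W t a i * star (W t b j)) fun t => ?_).congr fun t => by ring
    rw [norm_mul, norm_star]
    exact mul_le_one₀ (hW.norm_le_one t a i) (norm_nonneg _) (hW.norm_le_one t b j)

theorem diagonal_mul_mul_diagonal (hW : IsPartialIsometryField U W) {h : IntervalAlg (m + 1)}
    (hh : h ∈ modelAlg U) (t : I) : (W t)ᴴ * (W t * h t * (W t)ᴴ) * W t = h t := by
  have : (W t)ᴴ * (W t * h t * (W t)ᴴ) * W t = ((W t)ᴴ * W t) * h t * ((W t)ᴴ * W t) := by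
    simp only [mul_assoc]
  rw [this, hW.conjTranspose_mul_self]
  ext i j
  rw [mul_diagonal, diagonal_mul]
  by_cases hi : t ∈ U i
  · by_cases hj : t ∈ U j
    · simp [hi, hj]
    · simp [hj, hh t i j (.inr hj)]
  · simp [hi, hh t i j (.inl hi)]

end IsPartialIsometryField

/-- A closed hereditary subalgebra of `C[0,1] ⊗ Mₙ` is isomorphic to the algebra of all matrix
valued functions whose entries vanish off the sets where the dimension function is large. -/
theorem exists_starAlgEquiv_modelAlg (A : NonUnitalStarSubalgebra ℂ (IntervalAlg (m + 1)))
    (hclosed : IsClosed (A : Set (IntervalAlg (m + 1)))) (hher : IsHereditarySubalg A) :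
    (∀ i, IsOpen (levelSet A i)) ∧ Nonempty (A ≃⋆ₐ[ℂ] modelAlg (levelSet A)) := by
  obtain ⟨W, hWE, hW₁, hW₂, hW₃⟩ := exists_partialIsometry_field A
  have hW : IsPartialIsometryField (levelSet A) W := ⟨hW₁, fun i => (hW₃ i).1, fun i => (hW₃ i).2⟩
  have hA : ∀ a ∈ A, ∀ t, W t * (W t)ᴴ * a t = a t := by
    intro a ha t
    ext i j
    have h := congrFun (hW₂ t ((a t).mulVec (Pi.single j 1))
      (Submodule.subset_span ⟨a, ha, _, rfl⟩)) i
    rw [mulVec_mulVec] at h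
    simpa using h
  have hA' : ∀ a ∈ A, ∀ t, a t * (W t * (W t)ᴴ) = a t := by
    intro a ha t
    have := congrArg conjTranspose (hA (star a) (star_mem ha) t)
    simpa [conjTranspose_mul, star_eq_conjTranspose] using this
  have hstar : ∀ a ∈ A, ∀ t, W t * (W t)ᴴ * star (a t) = star (a t) := fun a ha t =>
    hA (star a) (star_mem ha) t
  let φ : A →⋆ₙₐ[ℂ] modelAlg (levelSet A) :=
    { toFun := fun a => ⟨⟨fun t => (W t)ᴴ * (a : IntervalAlg (m + 1)) t * W t,
        hW.continuous_compress (hA a a.2) (hstar a a.2)⟩, fun t i j h => hW.compress_eq_zero _ h⟩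
      map_smul' := fun c a => by ext t : 3; simp
      map_zero' := by ext t : 3; simp
      map_add' := fun a b => by ext t : 3; simp [mul_add, add_mul]
      map_mul' := fun a b => by
        refine Subtype.ext (ContinuousMap.ext fun t => ?_)
        change (W t)ᴴ * ((a : IntervalAlg (m + 1)) t * (b : IntervalAlg (m + 1)) t) * W t =
          (W t)ᴴ * (a : IntervalAlg (m + 1)) t * W t *
            ((W t)ᴴ * (b : IntervalAlg (m + 1)) t * W t)
        conv_lhs => rw [← hA' a a.2 t]
        simp only [mul_assoc]
      map_star' := fun a => by
        refine Subtype.ext (ContinuousMap.ext fun t => ?_)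
        change (W t)ᴴ * ((a : IntervalAlg (m + 1)) t)ᴴ * W t =
          ((W t)ᴴ * (a : IntervalAlg (m + 1)) t * W t)ᴴ
        simp only [conjTranspose_mul, conjTranspose_conjTranspose, mul_assoc] }
  refine ⟨fun i => (hW₃ i).1, ⟨StarAlgEquiv.ofBijective φ ⟨fun a b hab => ?_, fun h => ?_⟩⟩⟩
  · ext t : 2
    have h : (W t)ᴴ * (a : IntervalAlg (m + 1)) t * W t =
        (W t)ᴴ * (b : IntervalAlg (m + 1)) t * W t :=
      DFunLike.congr_fun (congrArg Subtype.val hab) t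
    rw [← hA' a a.2 t, ← hA' b b.2 t, ← hA a a.2 t, ← hA b b.2 t]
    have := congrArg (fun x => W t * x * (W t)ᴴ) h
    simpa only [mul_assoc] using this
  -- The preimage of h is W h W*. Its value at each t is a combination of rank one operators on the
  -- fibre, so pointwise interpolation puts it in A.
  · let g : IntervalAlg (m + 1) := ⟨_, hW.continuous_expand h.2⟩
    have hg : g ∈ A := by
      refine mem_of_pointwise_interpolation hclosed g fun t => ?_
      have hb : ∀ i j, ∃ b ∈ scalarStablePart A,
          b t = vecMulVec (fun a => W t a i) (star fun a => W t a j) := fun i j =>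
        exists_vecMulVec hher t (hWE t i) (hWE t j)
      choose b hb hb' using hb
      refine ⟨∑ i, ∑ j, (h : IntervalAlg (m + 1)) t i j • b i j,
        sum_mem fun i _ => sum_mem fun j _ => Submodule.smul_mem _ _ (hb i j), ?_⟩
      ext a c
      change _ = (W t * (h : IntervalAlg (m + 1)) t * (W t)ᴴ) a c
      simp only [ContinuousMap.sum_apply, ContinuousMap.smul_apply, hb', Matrix.sum_apply,
        Matrix.smul_apply, vecMulVec_apply, mul_apply, conjTranspose_apply, Finset.sum_mul,
        smul_eq_mul, Pi.star_apply]
      rw [Finset.sum_comm]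
      refine Finset.sum_congr rfl fun i _ => Finset.sum_congr rfl fun j _ => by ring
    refine ⟨⟨g, hg⟩, ?_⟩
    refine Subtype.ext (ContinuousMap.ext fun t => ?_)
    exact hW.diagonal_mul_mul_diagonal h.2 t

/-- The dimension function of a full subalgebra vanishes nowhere. -/
theorem levelSet_last_of_isFullSubalg {A : NonUnitalStarSubalgebra ℂ (IntervalAlg (m + 1))}
    (hfull : IsFullSubalg A) : levelSet A (Fin.last m) = Set.univ := by
  refine Set.eq_univ_of_forall fun t => ?_
  by_contra ht
  have hd : dimFun A t = 0 := by
    simp only [levelSet, Set.mem_ofPred_eq, Fin.val_last] at ht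
    omega
  have hbot : evalSpace A t = ⊥ := Submodule.finrank_eq_zero.1 hd
  -- If the fibre at t is zero, A lies in the closed ideal of functions vanishing at t, which does
  -- not contain 1.
  let ev : IntervalAlg (m + 1) →+* Matrix (Fin (m + 1)) (Fin (m + 1)) ℂ :=
    { toFun := fun g => g t, map_one' := rfl, map_mul' := fun _ _ => rfl, map_zero' := rfl,
      map_add' := fun _ _ => rfl }
  have hJ : ∀ g, g ∈ TwoSidedIdeal.ker ev ↔ g t = 0 := fun g => TwoSidedIdeal.mem_ker _
  have htop := hfull (TwoSidedIdeal.ker ev) (by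
    have : (TwoSidedIdeal.ker ev : Set (IntervalAlg (m + 1))) = {g | g t = 0} := by
      ext g; exact hJ g
    rw [this]
    exact isClosed_eq (continuous_eval_const t) continuous_const) fun a ha => (hJ a).2 (by
      ext i j
      have : (a t).mulVec (Pi.single j 1) ∈ evalSpace A t := Submodule.subset_span ⟨a, ha, _, rfl⟩
      rw [hbot, Submodule.mem_bot] at this
      simpa using congrFun this i)
  have h1 : (1 : IntervalAlg (m + 1)) ∈ TwoSidedIdeal.ker ev := by rw [htop]; trivial
  have := (hJ 1).1 h1
  simp at this

end ModelIso

/-! ### Components of open sets and collapsing maps of the interval -/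

section Components

open Filter Topology

theorem ordConnected_ball_unitInterval (x : I) (ε : ℝ) : (Metric.ball x ε).OrdConnected := by
  refine ⟨fun a ha b hb y hy => ?_⟩
  simp only [Metric.mem_ball, Subtype.dist_eq, Real.dist_eq, abs_lt] at *
  have h1 : (a : ℝ) ≤ y := hy.1
  have h2 : (y : ℝ) ≤ b := hy.2
  constructor <;> linarith

/-- This makes components of open sets open, so that they are cozero sets. -/
instance locallyConnectedSpace_unitInterval : LocallyConnectedSpace I :=
  locallyConnectedSpace_of_connected_bases (fun x ε => Metric.ball x ε) (fun _ ε => 0 < ε)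
    (fun _ => Metric.nhds_basis_ball)
    (fun x ε _ => (ordConnected_ball_unitInterval x ε).isPreconnected)

/-- A subset of the interval which is saturated for a finite partition into intervals has only
finitely many components. -/
theorem finite_component {U : Set I} {c : Set (Set I)} (hc : c.Finite)
    (hp : Setoid.IsPartition c) (ho : ∀ s ∈ c, s.OrdConnected)
    (hU : ∀ s ∈ c, ∀ x ∈ s, ∀ y ∈ s, x ∈ U → y ∈ U) : Finite (Component U) := by
  have hsub : {C : Set I | ∃ x ∈ U, C = connectedComponentIn U x} ⊆
      ⋃ s ∈ c, {C | ∃ x ∈ s ∩ U, C = connectedComponentIn U x} := by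
    rintro _ ⟨x, hx, rfl⟩
    obtain ⟨s, ⟨hs, hxs⟩, -⟩ := hp.2 x
    exact Set.mem_iUnion₂.2 ⟨s, hs, x, ⟨hxs, hx⟩, rfl⟩
  -- A member of the partition that meets U is a connected subset of U, so it meets only one
  -- component.
  refine ((hc.biUnion fun s hs => Set.Subsingleton.finite ?_).subset hsub).to_subtype
  rintro _ ⟨x, ⟨hxs, hxU⟩, rfl⟩ _ ⟨y, ⟨hys, -⟩, rfl⟩
  exact connectedComponentIn_eq ((ho s hs).isPreconnected.subset_connectedComponentIn hxs
    (fun z hz => hU s hs x hxs z hz hxU) hys)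

/-- An interval has at most two frontier points. -/
theorem finite_frontier_of_ordConnected {C : Set I} (hC : C.OrdConnected) : (frontier C).Finite := by
  refine (Set.toFinite {sInf C, sSup C}).subset fun x hx => ?_
  by_contra hne
  simp only [Set.mem_insert_iff, Set.mem_singleton_iff, not_or] at hne
  have hcl := frontier_subset_closure hx
  have h1 : sInf C ≤ x :=
    closure_minimal (fun y hy => sInf_le hy : C ⊆ Set.Ici (sInf C)) isClosed_Ici hcl
  have h2 : x ≤ sSup C :=
    closure_minimal (fun y hy => le_sSup hy : C ⊆ Set.Iic (sSup C)) isClosed_Iic hcl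
  -- A point strictly between the infimum and the supremum has points of C on both sides, hence is
  -- interior.
  obtain ⟨a, ha, hax⟩ := sInf_lt_iff.1 (lt_of_le_of_ne h1 (Ne.symm hne.1))
  obtain ⟨b, hb, hxb⟩ := lt_sSup_iff.1 (lt_of_le_of_ne h2 hne.2)
  exact hx.2 (mem_interior_iff_mem_nhds.2
    (mem_of_superset (Icc_mem_nhds hax hxb) (hC.out ha hb)))

/-- A map of the interval to itself which collapses a neighbourhood of `p` to `p` and is the
identity away from `p`. -/
theorem exists_collapse_point (p : I) {η : ℝ} (hη : 0 < η) :
    ∃ γ : C(I, I), Monotone γ ∧ (∀ t : I, |(t : ℝ) - p| ≤ η → γ t = p) ∧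
      (∀ t : I, 2 * η ≤ |(t : ℝ) - p| → γ t = t) ∧ ∀ t, |(γ t : ℝ) - t| ≤ η := by
  -- The odd piecewise linear function that is 0 on [-η, η], has slope 2 up to ±2η, and is the
  -- identity beyond. In terms of min and max, monotonicity and continuity are immediate.
  let ψ : ℝ → ℝ := fun x =>
    max (min x 0) (min 0 (2 * x + 2 * η)) + min (max x 0) (max 0 (2 * x - 2 * η))
  have hψm : Monotone ψ := by
    intro x y hxy
    simp only [ψ]
    gcongr
  have hψ : ∀ x, (0 ≤ x → 0 ≤ ψ x ∧ ψ x ≤ x) ∧ (x ≤ 0 → x ≤ ψ x ∧ ψ x ≤ 0) ∧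
      (|x| ≤ η → ψ x = 0) ∧ (2 * η ≤ |x| → ψ x = x) ∧ |ψ x - x| ≤ η := by
    intro x
    simp only [ψ]
    refine ⟨fun h => ?_, fun h => ?_, fun h => ?_, fun h => ?_, ?_⟩
    · simp only [max_def, min_def]; split_ifs <;> constructor <;> linarith
    · simp only [max_def, min_def]; split_ifs <;> constructor <;> linarith
    · obtain ⟨h1, h2⟩ := abs_le.1 h
      simp only [max_def, min_def]; split_ifs <;> linarith
    · rcases le_abs.1 h with h | h <;> simp only [max_def, min_def] <;> split_ifs <;> linarith
    · rw [abs_le]; simp only [max_def, min_def]; split_ifs <;> constructor <;> linarith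
  have hmem : ∀ t : I, (p : ℝ) + ψ (t - p) ∈ Set.Icc (0 : ℝ) 1 := by
    intro t
    have hp := p.2
    have ht := t.2
    obtain ⟨h1, h2, -⟩ := hψ (t - p)
    rcases le_total (0 : ℝ) (t - p) with h | h
    · have := h1 h
      exact ⟨by linarith [hp.1], by linarith [ht.2]⟩
    · have := h2 h
      exact ⟨by linarith [ht.1], by linarith [hp.2]⟩
  refine ⟨⟨fun t => ⟨p + ψ (t - p), hmem t⟩, ?_⟩, fun s t hst => ?_, fun t ht => ?_,
    fun t ht => ?_, fun t => ?_⟩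
  · refine Continuous.subtype_mk ?_ _
    simp only [ψ]
    fun_prop
  · have : (s : ℝ) ≤ t := hst
    exact Subtype.mk_le_mk.2 (by gcongr; exact hψm (by linarith))
  · exact Subtype.ext (by simp [(hψ (t - p)).2.2.1 ht])
  · exact Subtype.ext (by simp [(hψ (t - p)).2.2.2.1 ht])
  · have := (hψ (t - p)).2.2.2.2
    simp only [ContinuousMap.coe_mk]
    rwa [show (p : ℝ) + ψ (t - p) - t = ψ (t - p) - (t - p) by ring]

/-- A map of the interval to itself, close to the identity, which fixes the points of a finite set
and is constant near each of them. -/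
theorem exists_collapse (F : Finset I) {ε : ℝ} (hε : 0 < ε) :
    ∃ γ : C(I, I), Monotone γ ∧ (∀ p ∈ F, γ p = p) ∧ (∀ p ∈ F, ∀ᶠ t in 𝓝 p, γ t = p) ∧
      ∀ t, |(γ t : ℝ) - t| ≤ ε := by
  -- F' is the set of points near which the map is already constant. All of F stays fixed
  -- throughout, so a later collapse does not change the constant values reached earlier.
  suffices H : ∀ F' : Finset I, F' ⊆ F → ∀ ε : ℝ, 0 < ε →
      ∃ γ : C(I, I), Monotone γ ∧ (∀ p ∈ F, γ p = p) ∧ (∀ p ∈ F', ∀ᶠ t in 𝓝 p, γ t = p) ∧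
        ∀ t, |(γ t : ℝ) - t| ≤ ε from H F subset_rfl ε hε
  intro F'
  induction F' using Finset.induction_on with
  | empty =>
    exact fun _ ε hε => ⟨ContinuousMap.id I, monotone_id, by simp, by simp, by simp [hε.le]⟩
  | insert p F' hp ih =>
    intro hF ε hε
    obtain ⟨γ, hm, hfix, hcon, hcl⟩ :=
      ih (fun q hq => hF (Finset.mem_insert_of_mem hq)) (ε / 2) (half_pos hε)
    -- The collapse at p moves only points at distance less than 2η from p, so this η leaves the
    -- rest of F fixed.
    have hsep : ∃ η : ℝ, 0 < η ∧ η ≤ ε / 2 ∧ ∀ q ∈ F, q ≠ p → 2 * η ≤ |(q : ℝ) - p| := by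
      have hev : ∀ᶠ η in 𝓝[>] (0 : ℝ), ∀ q ∈ F, q ≠ p → 2 * η ≤ |(q : ℝ) - p| := by
        rw [Filter.eventually_all_finset]
        intro q _
        by_cases hqp : q = p
        · simp [hqp]
        · have h0 : 0 < |(q : ℝ) - p| := abs_pos.2 (sub_ne_zero.2 fun h => hqp (Subtype.ext h))
          filter_upwards [Ioo_mem_nhdsGT (show (0 : ℝ) < |(q : ℝ) - p| / 2 by positivity)]
            with η hη _
          linarith [hη.2]
      obtain ⟨η, h1, h2⟩ := (hev.and (Ioo_mem_nhdsGT (half_pos hε))).exists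
      exact ⟨η, h2.1, h2.2.le, h1⟩
    obtain ⟨η, hη, hηε, hsep⟩ := hsep
    obtain ⟨τ, hτm, hτp, hτid, hτcl⟩ := exists_collapse_point p hη
    have hτfix : ∀ q ∈ F, τ q = q := fun q hq => by
      by_cases hqp : q = p
      · rw [hqp]; exact hτp p (by simp [hη.le])
      · exact hτid q (hsep q hq hqp)
    refine ⟨τ.comp γ, hτm.comp hm, fun q hq => ?_, fun q hq => ?_, fun t => ?_⟩
    · rw [ContinuousMap.comp_apply, hfix q hq, hτfix q hq]
    · rcases Finset.mem_insert.1 hq with rfl | hq'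
      · have : ∀ᶠ t in 𝓝 q, |(γ t : ℝ) - q| < η := by
          have h : Continuous fun t => |(γ t : ℝ) - q| := by fun_prop
          refine (h.tendsto q).eventually_lt_const ?_
          simp [hfix q (hF hq), hη]
        filter_upwards [this] with t ht
        exact hτp _ ht.le
      · filter_upwards [hcon q hq'] with t ht
        rw [ContinuousMap.comp_apply, ht, hτfix q (hF hq)]
    · rw [ContinuousMap.comp_apply]
      calc |(τ (γ t) : ℝ) - t| ≤ |(τ (γ t) : ℝ) - γ t| + |(γ t : ℝ) - t| := abs_sub_le _ _ _
        _ ≤ ε := by linarith [hτcl (γ t), hcl t]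

/-- If `γ` is monotone, fixes the frontier of the open set `C` and is constant near each frontier
point, then `γ` pushes `C` away from its frontier. -/
theorem exists_pos_lower_bound {C : Set I} (f : C(I, ℝ)) (hf₀ : ∀ t, 0 ≤ f t)
    (hf : ∀ t, f t ≠ 0 ↔ t ∈ C) (γ : C(I, I)) (hm : Monotone γ)
    (hfix : ∀ p ∈ frontier C, γ p = p) (hcon : ∀ p ∈ frontier C, ∀ᶠ t in 𝓝 p, γ t = p) :
    ∃ L : ℝ, 0 < L ∧ ∀ t, f (γ t) ≠ 0 → L ≤ f t := by
  have hopen : IsOpen C := by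
    have : C = {t | f t ≠ 0} := by ext t; exact (hf t).symm
    rw [this]
    exact isOpen_ne_fun f.continuous continuous_const
  have hfr : ∀ p ∈ frontier C, p ∉ C := fun p hp hpC => hp.2 (by rwa [hopen.interior_eq])
  -- On the way from t ∉ C to γ t ∈ C there would be a frontier point p. As p is fixed, monotonicity
  -- keeps γ t on the same side of p as t, so γ t = p, which is not in C.
  have hstay : ∀ t, t ∉ C → γ t ∉ C := by
    intro t ht hγ
    have hnot : ¬ (closure C ∩ Set.uIcc t (γ t) ⊆ C) := by
      intro hsub
      exact ht (isPreconnected_uIcc.subset_of_closure_inter_subset hopen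
        ⟨γ t, Set.right_mem_uIcc, hγ⟩ hsub Set.left_mem_uIcc)
    obtain ⟨p, ⟨hpc, hpt⟩, hpC⟩ := Set.not_subset.1 hnot
    have hpf : p ∈ frontier C := ⟨hpc, by rwa [hopen.interior_eq]⟩
    have hp := hfix p hpf
    rcases Set.mem_uIcc.1 hpt with h | h
    · exact hpC ((le_antisymm h.2 (hp ▸ hm h.1)) ▸ hγ)
    · exact hpC ((le_antisymm (hp ▸ hm h.2) h.1) ▸ hγ)
  -- A limit point on the frontier is excluded because γ is constant near it, with value outside C;
  -- one outside the closure of C is excluded by `hstay`. Hence f has a positive minimum on this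
  -- compact set.
  have hK : closure {t | γ t ∈ C} ⊆ C := by
    intro t ht
    by_contra htC
    by_cases htf : t ∈ frontier C
    · obtain ⟨s, hs, hsC⟩ := ((mem_closure_iff_frequently.1 ht).and_eventually (hcon t htf)).exists
      exact htC (hsC ▸ hs)
    · have : t ∈ (closure C)ᶜ := fun h => htf ⟨h, by rwa [hopen.interior_eq]⟩
      obtain ⟨s, hs, hsC⟩ := ((mem_closure_iff_frequently.1 ht).and_eventually
        (isClosed_closure.isOpen_compl.mem_nhds this)).exists
      exact hstay s (fun h => hsC (subset_closure h)) hs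
  rcases (closure {t | γ t ∈ C}).eq_empty_or_nonempty with he | hne
  · refine ⟨1, one_pos, fun t ht => ?_⟩
    have : t ∈ closure {t | γ t ∈ C} := subset_closure ((hf _).1 ht)
    rw [he] at this
    exact this.elim
  · obtain ⟨x, hx, hmin⟩ := isClosed_closure.isCompact.exists_isMinOn hne f.continuous.continuousOn
    refine ⟨f x, lt_of_le_of_ne (hf₀ x) (Ne.symm ((hf x).2 (hK hx))), fun t ht => ?_⟩
    exact hmin (subset_closure ((hf _).1 ht))

/-- An open subset of the interval is the cozero set of a continuous function with values in
`[0,1]`. -/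
theorem exists_cozero_function {C : Set I} (hC : IsOpen C) :
    ∃ f : C(I, ℝ), ∀ t, 0 ≤ f t ∧ f t ≤ 1 ∧ (f t ≠ 0 ↔ t ∈ C) := by
  by_cases hne : Cᶜ.Nonempty
  · refine ⟨⟨fun t => min (Metric.infDist t Cᶜ) 1,
      (Metric.continuous_infDist_pt _).min continuous_const⟩, fun t => ?_⟩
    have h0 : 0 ≤ Metric.infDist t Cᶜ := Metric.infDist_nonneg
    refine ⟨le_min h0 zero_le_one, min_le_right _ _, ?_⟩
    have h := Metric.infDist_pos_iff_notMem_closure (x := t) hne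
    rw [hC.isClosed_compl.closure_eq, Set.notMem_compl_iff] at h
    rw [h, ContinuousMap.coe_mk]
    constructor
    · intro hm
      exact lt_of_le_of_ne h0 fun h' => hm (by rw [← h']; simp)
    · exact fun hp => (lt_min hp one_pos).ne'
  · rw [Set.not_nonempty_iff_eq_empty, Set.compl_empty_iff] at hne
    exact ⟨1, fun t => by simp [hne]⟩

end Components

/-! ### Cells: the components together with the whole interval -/

section Cells

variable {m : ℕ}

/-- A family of nonnegative functions, labelled by `1, …, n`, such that the cozero sets of the
functions with label `i` form a partition of `U i`. -/
structure IsCellFamily {N : Type*} (U : Fin (m + 1) → Set I) (κ : N → Fin (m + 1))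
    (F : N → C(I, ℝ)) : Prop where
  nonneg : ∀ r t, 0 ≤ F r t
  mem_iff : ∀ i t, t ∈ U i ↔ ∃ r, κ r = i ∧ F r t ≠ 0
  unique : ∀ r r' t, κ r = κ r' → F r t ≠ 0 → F r' t ≠ 0 → r = r'

variable {A : NonUnitalStarSubalgebra ℂ (IntervalAlg (m + 1))}

/-- The labels of the generators `P` and `X s`. -/
def cellLabel (A : NonUnitalStarSubalgebra ℂ (IntervalAlg (m + 1))) :
    Option (CompIndex A) → Fin (m + 1)
  | none => Fin.last m
  | some s => s.1.castSucc

/-- The family of functions `f s`, together with the constant function `1`. -/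
def cellFun {S : Type*} (f : S → C(I, ℝ)) : Option S → C(I, ℝ)
  | none => 1
  | some s => f s

/-- The cell `none` is the whole interval, which is the last level set by `hlast`. For smaller
indices the cells are the components, which cover the level set and are pairwise disjoint. -/
theorem IsComponentFamily.isCellFamily {f : CompIndex A → C(I, ℝ)} (hf : IsComponentFamily A f)
    (hlast : levelSet A (Fin.last m) = Set.univ) :
    IsCellFamily (levelSet A) (cellLabel A) (cellFun f) where
  nonneg r t := by
    cases r with
    | none => exact zero_le_one
    | some s => exact (hf s t).1
  mem_iff i t := by
    induction i using Fin.lastCases with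
    | last =>
      rw [hlast]
      simp only [Set.mem_univ, true_iff]
      exact ⟨none, rfl, one_ne_zero⟩
    | cast i =>
      constructor
      · intro ht
        refine ⟨some ⟨i, _, t, ht, rfl⟩, rfl, ?_⟩
        exact (hf _ t).2.2.2 (mem_connectedComponentIn ht)
      · rintro ⟨_ | ⟨j, C, x, hx, rfl⟩, hi, hr⟩
        · exact absurd hi (Fin.castSucc_lt_last i).ne'
        · obtain rfl : j = i := Fin.castSucc_injective _ hi
          exact connectedComponentIn_subset _ _ ((hf _ t).2.2.1 hr)
  unique r r' t hκ hr hr' := by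
    cases r with
    | none =>
      cases r' with
      | none => rfl
      | some s' => exact absurd hκ (Fin.castSucc_lt_last _).ne'
    | some s =>
      cases r' with
      | none => exact absurd hκ (Fin.castSucc_lt_last _).ne
      | some s' =>
        obtain ⟨i, C, x, hx, rfl⟩ := s
        obtain ⟨j, C', y, hy, rfl⟩ := s'
        obtain rfl : i = j := Fin.castSucc_injective _ hκ
        have h1 := (hf _ t).2.2.1 hr
        have h2 := (hf _ t).2.2.1 hr'
        have h3 : connectedComponentIn (levelSet A i.castSucc) x =
            connectedComponentIn (levelSet A i.castSucc) y :=
          (connectedComponentIn_eq h1).trans (connectedComponentIn_eq h2).symm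
        simp only [h3]

theorem finite_compIndex (hstep : IsStepSubalg A) : Finite (CompIndex A) := by
  obtain ⟨c, hc, hp, h⟩ := hstep
  have : ∀ i : Fin m, Finite (Component (levelSet A i.castSucc)) := fun i =>
    finite_component hc hp (fun s hs => (h s hs).1) fun s hs x hx y hy hxU => by
      have := (h s hs).2 x hx y hy
      simp only [levelSet, Set.mem_ofPred_eq] at hxU ⊢
      rwa [← this]
  infer_instance

theorem exists_isComponentFamily (hopen : ∀ i, IsOpen (levelSet A i)) :
    ∃ f : CompIndex A → C(I, ℝ), IsComponentFamily A f := by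
  have : ∀ s : CompIndex A, ∃ f : C(I, ℝ), ∀ t, 0 ≤ f t ∧ f t ≤ 1 ∧ (f t ≠ 0 ↔ t ∈ s.2.1) := by
    rintro ⟨i, C, x, hx, rfl⟩
    exact exists_cozero_function (hopen _).connectedComponentIn
  choose f hf using this
  exact ⟨f, fun s t => ⟨(hf s t).1, (hf s t).2.1.trans one_le_two, (hf s t).2.2⟩⟩

/-- The frontiers of the components are finite. -/
theorem finite_frontier_compIndex (s : CompIndex A) : (frontier s.2.1).Finite := by
  obtain ⟨i, C, x, hx, rfl⟩ := s
  exact finite_frontier_of_ordConnected isPreconnected_connectedComponentIn.ordConnected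

end Cells

/-! ### Functional calculus in corners -/

section FunctionalCalculus

variable {B : Type*} [NonUnitalCStarAlgebra B]

/-- A real function as a complex function. -/
def toComplexFun (g : C(I, ℝ)) : C(I, ℂ) := ⟨fun t => (g t : ℂ), by fun_prop⟩

@[simp] theorem toComplexFun_apply (g : C(I, ℝ)) (t : I) : toComplexFun g t = (g t : ℂ) := rfl

theorem toComplexFun_mul (g h : C(I, ℝ)) :
    toComplexFun (g * h) = toComplexFun g * toComplexFun h := by ext; simp

theorem isSelfAdjoint_toComplexFun (g : C(I, ℝ)) : IsSelfAdjoint (toComplexFun g) := by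
  ext t; simp

/-- The inclusion of the unit interval into the real line. -/
def intervalCoe : C(I, ℝ) := ⟨fun t => (t : ℝ), continuous_subtype_val⟩

theorem continuous_nonUnitalStarAlgHom {A' B' : Type*} [NonUnitalCStarAlgebra A']
    [NonUnitalCStarAlgebra B'] (ψ : A' →⋆ₙₐ[ℂ] B') : Continuous ψ :=
  AddMonoidHomClass.continuous_of_bound ψ 1 fun a => by
    simpa using NonUnitalStarAlgHom.norm_apply_le ψ a

/-- Evaluation at a point is a homomorphism, so it commutes with functional calculus, and for a real
scalar the calculus is evaluation of h. -/
theorem cfcₙ_toComplexFun (h : C(ℝ, ℝ)₀) (g : C(I, ℝ)) :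
    cfcₙ (h : ℝ → ℝ) (toComplexFun g) = toComplexFun ((h : C(ℝ, ℝ)).comp g) := by
  ext t
  let ev : C(I, ℂ) →⋆ₙₐ[ℂ] ℂ :=
    { toFun := fun f => f t, map_smul' := fun _ _ => rfl, map_zero' := rfl,
      map_add' := fun _ _ => rfl, map_mul' := fun _ _ => rfl, map_star' := fun _ => rfl }
  have h1 : ev (cfcₙ (h : ℝ → ℝ) (toComplexFun g)) = cfcₙ (h : ℝ → ℝ) (ev (toComplexFun g)) :=
    NonUnitalStarAlgHom.map_cfcₙ ev h _ (by fun_prop) (by simp)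
      (continuous_nonUnitalStarAlgHom ev) (isSelfAdjoint_toComplexFun g)
      ((isSelfAdjoint_toComplexFun g).map ev)
  have h2 : ev (toComplexFun g) = algebraMap ℝ ℂ (g t) := rfl
  rw [h2, cfcₙ_eq_cfc (a := algebraMap ℝ ℂ (g t)) (hf0 := by simp), cfc_algebraMap] at h1
  exact h1

theorem map_cfcₙ_toComplexFun (ρ : C(I, ℂ) →⋆ₙₐ[ℂ] B) (h : C(ℝ, ℝ)₀) (g : C(I, ℝ)) :
    cfcₙ (h : ℝ → ℝ) (ρ (toComplexFun g)) = ρ (toComplexFun ((h : C(ℝ, ℝ)).comp g)) := by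
  rw [← cfcₙ_toComplexFun]
  exact (NonUnitalStarAlgHom.map_cfcₙ ρ h _ (by fun_prop) (by simp)
      (continuous_nonUnitalStarAlgHom ρ) (isSelfAdjoint_toComplexFun g)
      ((isSelfAdjoint_toComplexFun g).map ρ)).symm

/-- This moves relations along homomorphisms; along an injective one, which is isometric, they can
also be pulled back. -/
theorem CStarExpr.map_eval {G : Type*} {A' : Type*} [NonUnitalCStarAlgebra A']
    (ψ : A' →⋆ₙₐ[ℂ] B) (b : G → A') (x : CStarExpr G) :
    ψ (x.eval b) = x.eval fun g => ψ (b g) := by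
  induction x with
  | gen g => rfl
  | add x y hx hy => simp only [CStarExpr.eval, map_add, hx, hy]
  | mul x y hx hy => simp only [CStarExpr.eval, map_mul, hx, hy]
  | smul c x hx => simp only [CStarExpr.eval, map_smul, hx]
  | adj x hx => simp only [CStarExpr.eval, map_star, hx]
  | fc h x hx =>
    simp only [CStarExpr.eval]
    rw [← hx, ← map_realPart ψ]
    exact NonUnitalStarAlgHom.map_cfcₙ ψ h _ (by fun_prop) (by simp)
      (continuous_nonUnitalStarAlgHom ψ) (ℜ (x.eval b)).2 ((ℜ (x.eval b)).2.map ψ)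

/-- The corner `P B P` of a projection. -/
def cornerSubalgebra (P : B) (hP : IsSelfAdjoint P) : NonUnitalStarSubalgebra ℂ B where
  carrier := {b | P * b = b ∧ b * P = b}
  add_mem' {a b} ha hb := ⟨by rw [mul_add, ha.1, hb.1], by rw [add_mul, ha.2, hb.2]⟩
  zero_mem' := ⟨mul_zero _, zero_mul _⟩
  mul_mem' {a b} ha hb := ⟨by rw [← mul_assoc, ha.1], by rw [mul_assoc, hb.2]⟩
  smul_mem' c a ha := ⟨by rw [mul_smul_comm, ha.1], by rw [smul_mul_assoc, ha.2]⟩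
  star_mem' {a} ha := ⟨by
    rw [← hP.star_eq, ← star_mul, ha.2], by rw [← hP.star_eq, ← star_mul, ha.1]⟩

theorem isClosed_cornerSubalgebra (P : B) (hP : IsSelfAdjoint P) :
    IsClosed (cornerSubalgebra P hP : Set B) :=
  (isClosed_eq (continuous_const_mul P) continuous_id).inter
    (isClosed_eq (continuous_mul_const P) continuous_id)

/-- A closed subalgebra is closed under complex functional calculus. -/
theorem cfcₙ_complex_mem (N : NonUnitalStarSubalgebra ℂ B) (hN : IsClosed (N : Set B)) {T : B}
    (hT : IsSelfAdjoint T) (hTN : T ∈ N) (f : ℂ → ℂ) (hf : Continuous f) (hf₀ : f 0 = 0) :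
    cfcₙ f T ∈ N := by
  have := hN
  have h := NonUnitalStarAlgHom.map_cfcₙ (NonUnitalStarSubalgebraClass.subtype N) f ⟨T, hTN⟩
    hf.continuousOn hf₀ continuous_subtype_val
    (IsSelfAdjoint.isStarNormal (x := (⟨T, hTN⟩ : N)) (Subtype.ext hT)) hT.isStarNormal
  rw [show T = NonUnitalStarSubalgebraClass.subtype N ⟨T, hTN⟩ from rfl, ← h]
  exact Subtype.property _

/-- A closed subalgebra is closed under real functional calculus. -/
theorem cfcₙ_real_mem (N : NonUnitalStarSubalgebra ℂ B) (hN : IsClosed (N : Set B)) {T : B}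
    (hT : IsSelfAdjoint T) (hTN : T ∈ N) (f : C(ℝ, ℝ)₀) : cfcₙ (f : ℝ → ℝ) T ∈ N := by
  rw [cfcₙ_real_eq_complex (f : ℝ → ℝ) hT]
  exact cfcₙ_complex_mem N hN hT hTN _ (by fun_prop) (by simp)

/-- A function on the unit interval, minus its value at `0`, as a function of the real part of a
complex number. -/
def recentredRe (h : C(I, ℂ)) (z : ℂ) : ℂ := h (Set.projIcc 0 1 zero_le_one z.re) - h 0

@[fun_prop]
theorem continuous_recentredRe (h : C(I, ℂ)) : Continuous (recentredRe h) :=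
  (h.continuous.comp (continuous_projIcc.comp Complex.continuous_re)).sub continuous_const

@[simp]
theorem recentredRe_zero (h : C(I, ℂ)) : recentredRe h 0 = 0 := by
  simp [recentredRe, Set.projIcc_left]

/-- The homomorphism `h ↦ (h - h(0))(T) + h(0) P` into the corner of the projection `P`. -/
def cornerHom (P T : B) (hP : IsSelfAdjoint P) (hPP : P * P = P) (hT : IsSelfAdjoint T)
    (hPT : P * T = T) (hTP : T * P = T) : C(I, ℂ) →⋆ₙₐ[ℂ] B where
  toFun h := cfcₙ (recentredRe h) T + h 0 • P
  map_smul' c h := by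
    rw [show recentredRe (c • h) = fun z => c * recentredRe h z by
      funext z; simp [recentredRe, mul_sub], cfcₙ_const_mul c (recentredRe h) T
        (by fun_prop) (by simp)]
    simp [smul_add, smul_smul]
  map_zero' := by
    rw [show recentredRe (0 : C(I, ℂ)) = fun _ => 0 by funext z; simp [recentredRe]]
    simp
  map_add' h k := by
    rw [show recentredRe (h + k) = fun z => recentredRe h z + recentredRe k z by
      funext z; simp only [recentredRe, ContinuousMap.add_apply]; ring,
      cfcₙ_add (recentredRe h) (recentredRe k) (a := T)]
    simp only [ContinuousMap.add_apply, add_smul]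
    abel
  map_mul' h k := by
    -- P acts as a unit on these elements, so the cross terms of the product come out as they
    -- should.
    have hmem : ∀ h, cfcₙ (recentredRe h) T ∈ cornerSubalgebra P hP := fun h =>
      cfcₙ_complex_mem _ (isClosed_cornerSubalgebra P hP) hT ⟨hPT, hTP⟩ _ (by fun_prop) (by simp)
    have e : recentredRe (h * k) = fun z => recentredRe h z * recentredRe k z +
        (k 0 * recentredRe h z + h 0 * recentredRe k z) := by
      funext z; simp only [recentredRe, ContinuousMap.mul_apply]; ring
    rw [e, cfcₙ_add (fun z => recentredRe h z * recentredRe k z)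
        (fun z => k 0 * recentredRe h z + h 0 * recentredRe k z) (a := T),
      cfcₙ_add (fun z => k 0 * recentredRe h z) (fun z => h 0 * recentredRe k z) (a := T),
      cfcₙ_mul (recentredRe h) (recentredRe k) T, cfcₙ_const_mul _ (recentredRe h) T,
      cfcₙ_const_mul _ (recentredRe k) T]
    simp only [add_mul, mul_add, smul_mul_assoc, mul_smul_comm, (hmem h).2, (hmem k).1, hPP,
      ContinuousMap.mul_apply, mul_smul, smul_add]
    rw [smul_comm (h 0) (k 0) P]
    abel
  map_star' h := by
    rw [show recentredRe (star h) = fun z => star (recentredRe h z) by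
      funext z; simp [recentredRe], cfcₙ_star (recentredRe h)]
    simp [hP.star_eq]

section CornerHom

variable {P T : B} (hP : IsSelfAdjoint P) (hPP : P * P = P) (hT : IsSelfAdjoint T)
  (hPT : P * T = T) (hTP : T * P = T)

theorem cornerHom_one : cornerHom P T hP hPP hT hPT hTP 1 = P := by
  change cfcₙ (recentredRe 1) T + (1 : C(I, ℂ)) 0 • P = P
  rw [show recentredRe (1 : C(I, ℂ)) = fun _ => 0 by funext z; simp [recentredRe]]
  simp

theorem cornerHom_toComplexFun (h : C(I, ℝ)) :
    cornerHom P T hP hPP hT hPT hTP (toComplexFun h) =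
      cfcₙ (recentred h : ℝ → ℝ) T + ((h 0 : ℝ) : ℂ) • P := by
  change cfcₙ (recentredRe (toComplexFun h)) T + _ = _
  rw [cfcₙ_real_eq_complex (recentred h : ℝ → ℝ) hT]
  congr 2
  funext z
  simp [recentredRe, recentred]

/-- The recentred inclusion of [0,1], extended by constants, is the clamp function, and `hcl` says
that clamping does not change T. -/
theorem cornerHom_intervalCoe (hcl : cfcₙ (clampFun : ℝ → ℝ) T = T) :
    cornerHom P T hP hPP hT hPT hTP (toComplexFun intervalCoe) = T := by
  rw [cornerHom_toComplexFun]
  have h0 : intervalCoe 0 = 0 := rfl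
  rw [h0, Complex.ofReal_zero, zero_smul, add_zero]
  conv_rhs => rw [← hcl]
  congr 1
  funext x
  simp only [recentred, intervalCoe, clampFun, ContinuousMapZero.coe_mk, ContinuousMap.coe_mk]
  rw [Set.coe_projIcc]
  simp [max_comm, min_comm, max_min_distrib_left]

end CornerHom

end FunctionalCalculus

/-! ### Exact and approximate representations of the relations -/

section ExactRepresentations

variable {B : Type u} [NonUnitalCStarAlgebra B] {S : Type} {f : S → C(I, ℝ)}

/-- The family of elements `P`, `T`, `X s`, labelled by the generators. -/
def genFamily (P T : B) (X : S → B) : StepGen S → B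
  | .P => P
  | .T => T
  | .X s => X s

/-- A homomorphism `ρ` from `C[0,1]`, together with orthogonal partial isometry-like elements over
it, represents the relations. -/
theorem exactRep_of_hom (ρ : C(I, ℂ) →⋆ₙₐ[ℂ] B) (γ : C(I, I)) (X : S → B)
    (hf : ∀ s t, 0 ≤ f s t ∧ f s t ≤ 2)
    (hX : ∀ s, ρ 1 * X s = X s) (hX' : ∀ s, X s * ρ 1 = 0)
    (hXX : ∀ s, X s * star (X s) = ρ (toComplexFun ((f s * f s).comp γ)))
    (hXX' : ∀ s s', s ≠ s' → X s * star (X s') = 0) :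
    ExactRep (stepRelations f) (genFamily (ρ 1) (ρ (toComplexFun (intervalCoe.comp γ))) X) := by
  have hnorm : ∀ g : C(I, ℂ), ∀ C : ℝ, 0 ≤ C → (∀ t, ‖g t‖ ≤ C) → ‖ρ g‖ ≤ C := fun g C hC h =>
    (NonUnitalStarAlgHom.norm_apply_le ρ g).trans ((ContinuousMap.norm_le _ hC).2 h)
  have hre : ∀ g : C(I, ℝ), (ℜ (ρ (toComplexFun g)) : B) = ρ (toComplexFun g) := fun g =>
    ((isSelfAdjoint_toComplexFun g).map ρ).coe_realPart
  have zero_of_eq : ∀ x y : CStarExpr (StepGen S), ∀ b : StepGen S → B, x.eval b = y.eval b →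
      ‖(CStarRelation.equal x y).expr.eval b‖ ≤ (CStarRelation.equal x y).bound + 0 := by
    intro x y b h
    have : (CStarRelation.equal x y).expr.eval b = x.eval b + (-1 : ℂ) • y.eval b := rfl
    rw [this, h]
    simp [CStarRelation.equal]
  intro r hr
  simp only [stepRelations, Set.mem_union, Set.mem_insert_iff, Set.mem_singleton_iff,
    Set.mem_ofPred_eq] at hr
  rcases hr with ((((((hr | hr) | hr) | hr) | hr) | hr) | hr) | hr
  · rcases hr with rfl | rfl | rfl
    · refine zero_of_eq _ _ _ ?_
      change ρ 1 = star (ρ 1)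
      rw [← map_star, star_one]
    · refine zero_of_eq _ _ _ ?_
      change ρ 1 = ρ 1 * ρ 1
      rw [← map_mul, one_mul]
    · change ‖ρ _‖ ≤ (1 : ℝ) + 0
      rw [add_zero]
      refine hnorm _ _ zero_le_one fun t => ?_
      simp only [toComplexFun_apply, intervalCoe, ContinuousMap.comp_apply, ContinuousMap.coe_mk,
        Complex.norm_real]
      rw [Real.norm_of_nonneg (γ t).2.1]
      exact (γ t).2.2
  · obtain ⟨s, rfl⟩ := hr
    change ‖X s‖ ≤ (2 : ℝ) + 0
    rw [add_zero]
    have h : ‖X s‖ * ‖X s‖ ≤ 2 * 2 := by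
      rw [← CStarRing.norm_self_mul_star, hXX]
      refine hnorm _ _ (by norm_num) fun t => ?_
      have h := hf s (γ t)
      simp only [toComplexFun_apply, ContinuousMap.comp_apply, ContinuousMap.mul_apply,
        Complex.norm_real]
      rw [Real.norm_of_nonneg (mul_self_nonneg _)]
      exact mul_le_mul h.2 h.2 h.1 (by norm_num)
    exact abs_le_of_sq_le_sq' (by nlinarith) (by norm_num) |>.2
  · obtain ⟨s, s', rfl⟩ := hr
    change ‖X s * X s'‖ ≤ (0 : ℝ) + 0
    -- X X' = X (P X') = (X P) X' = 0, so this relation follows from the other ones.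
    rw [← hX s', ← mul_assoc, hX', zero_mul, norm_zero, add_zero]
  · obtain ⟨s, s', hs, rfl⟩ := hr
    change ‖X s * star (X s')‖ ≤ (0 : ℝ) + 0
    rw [hXX' s s' hs, norm_zero, add_zero]
  · obtain ⟨s, rfl⟩ := hr
    exact zero_of_eq _ _ _ (hX s)
  · obtain ⟨s, rfl⟩ := hr
    change ‖X s * ρ 1‖ ≤ (0 : ℝ) + 0
    rw [hX', norm_zero, add_zero]
  · rcases hr with rfl | rfl | rfl
    · refine zero_of_eq _ _ _ ?_
      change ρ 1 * ρ _ = ρ _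
      rw [← map_mul, one_mul]
    · refine zero_of_eq _ _ _ ?_
      change ρ _ * ρ 1 = ρ _
      rw [← map_mul, mul_one]
    · refine zero_of_eq _ _ _ ?_
      change ρ _ = cfcₙ (clampFun : ℝ → ℝ) (ℜ (ρ _) : B)
      rw [hre, map_cfcₙ_toComplexFun]
      congr 2
      ext t
      have h := (γ t).2
      simp [clampFun, intervalCoe, h.1, h.2]
  · obtain ⟨s, rfl⟩ := hr
    refine zero_of_eq _ _ _ ?_
    change X s * star (X s) = cfcₙ (recentred (f s * f s) : ℝ → ℝ) (ℜ (ρ _) : B) + _ • ρ 1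
    rw [hre, map_cfcₙ_toComplexFun, hXX, ← map_smul, ← map_add]
    congr 1
    ext t
    simp [recentred, intervalCoe]

/-- The estimates which make up an approximate representation. -/
theorem ApproxRep.estimates {ε : ℝ} {b : StepGen S → B} (hb : ApproxRep (stepRelations f) ε b) :
    (‖b .P - star (b .P)‖ ≤ ε ∧ ‖b .P - b .P * b .P‖ ≤ ε ∧ ‖b .T‖ ≤ 1 + ε) ∧
      (∀ s, ‖b (.X s)‖ ≤ 2 + ε) ∧
      (∀ s s', s ≠ s' → ‖b (.X s) * star (b (.X s'))‖ ≤ ε) ∧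
      (∀ s, ‖b .P * b (.X s) - b (.X s)‖ ≤ ε) ∧ (∀ s, ‖b (.X s) * b .P‖ ≤ ε) ∧
      (‖b .P * b .T - b .T‖ ≤ ε ∧ ‖b .T * b .P - b .T‖ ≤ ε ∧
        ‖b .T - cfcₙ (clampFun : ℝ → ℝ) (ℜ (b .T) : B)‖ ≤ ε) ∧
      ∀ s, ‖b (.X s) * star (b (.X s)) - (cfcₙ (recentred (f s * f s) : ℝ → ℝ) (ℜ (b .T) : B) +
        (((f s * f s) 0 : ℝ) : ℂ) • b .P)‖ ≤ ε := by
  have eq_of : ∀ x y : CStarExpr (StepGen S), CStarRelation.equal x y ∈ stepRelations f →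
      ‖x.eval b - y.eval b‖ ≤ ε := by
    intro x y hxy
    have h := hb _ hxy
    have e : (CStarRelation.equal x y).expr.eval b = x.eval b + (-1 : ℂ) • y.eval b := rfl
    rw [e] at h
    simpa [CStarRelation.equal, sub_eq_add_neg] using h
  have zero_of : ∀ x : CStarExpr (StepGen S), CStarRelation.isZero x ∈ stepRelations f →
      ‖x.eval b‖ ≤ ε := by
    intro x hx
    simpa [CStarRelation.isZero] using hb _ hx
  refine ⟨⟨?_, ?_, ?_⟩, fun s => ?_, fun s s' hs => ?_, fun s => ?_, fun s => ?_,
    ⟨?_, ?_, ?_⟩, fun s => ?_⟩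
  · exact eq_of (.gen .P) (star (.gen .P))
      (.inl (.inl (.inl (.inl (.inl (.inl (.inl (.inl rfl))))))))
  · exact eq_of (.gen .P) (.gen .P * .gen .P)
      (.inl (.inl (.inl (.inl (.inl (.inl (.inl (.inr (.inl rfl)))))))))
  · exact hb (.normLE (.gen .T) 1)
      (.inl (.inl (.inl (.inl (.inl (.inl (.inl (.inr (.inr rfl)))))))))
  · exact hb (.normLE (.gen (.X s)) 2) (.inl (.inl (.inl (.inl (.inl (.inl (.inr ⟨s, rfl⟩)))))))
  · exact zero_of (.gen (.X s) * star (.gen (.X s')))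
      (.inl (.inl (.inl (.inl (.inr ⟨s, s', hs, rfl⟩)))))
  · exact eq_of (.gen .P * .gen (.X s)) (.gen (.X s)) (.inl (.inl (.inl (.inr ⟨s, rfl⟩))))
  · exact zero_of (.gen (.X s) * .gen .P) (.inl (.inl (.inr ⟨s, rfl⟩)))
  · exact eq_of (.gen .P * .gen .T) (.gen .T) (.inl (.inr (.inl rfl)))
  · exact eq_of (.gen .T * .gen .P) (.gen .T) (.inl (.inr (.inr (.inl rfl))))
  · exact eq_of (.gen .T) (.fc clampFun (.gen .T)) (.inl (.inr (.inr (.inr rfl))))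
  · exact eq_of (.gen (.X s) * star (.gen (.X s))) (cornerFC (f s * f s)) (.inr ⟨s, rfl⟩)

/-- The equations which make up an exact representation. -/
theorem ExactRep.equations {b : StepGen S → B} (hb : ExactRep (stepRelations f) b) :
    IsSelfAdjoint (b .P) ∧ b .P * b .P = b .P ∧ IsSelfAdjoint (b .T) ∧ b .P * b .T = b .T ∧
      b .T * b .P = b .T ∧ cfcₙ (clampFun : ℝ → ℝ) (b .T) = b .T ∧
      (∀ s, b .P * b (.X s) = b (.X s)) ∧ (∀ s, b (.X s) * b .P = 0) ∧
      (∀ s s', s ≠ s' → b (.X s) * star (b (.X s')) = 0) ∧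
      ∀ s, b (.X s) * star (b (.X s)) = cfcₙ (recentred (f s * f s) : ℝ → ℝ) (b .T) +
        (((f s * f s) 0 : ℝ) : ℂ) • b .P := by
  obtain ⟨⟨h1, h2, -⟩, -, h3, h4, h5, ⟨h6, h7, h8⟩, h9⟩ := ApproxRep.estimates hb
  simp only [norm_le_zero_iff, sub_eq_zero] at h1 h2 h3 h4 h5 h6 h7 h8 h9
  -- Self-adjointness of T is contained in T = κ(ℜ T).
  have hT : IsSelfAdjoint (b .T) := by rw [h8]; exact cfcₙ_predicate _ _
  rw [hT.coe_realPart] at h8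
  simp only [hT.coe_realPart] at h9
  exact ⟨h1.symm, h2.symm, hT, h6, h7, h8.symm, h4, h5, h3, h9⟩

end ExactRepresentations

/-! ### Approximate inverses and approximate units in C[0,1] -/

section ApproximateUnits

open Filter Topology

/-- The function `F / (F² + 1/(k+1))`, an approximate inverse of `F`. -/
def cutInv (F : C(I, ℝ)) (k : ℕ) : C(I, ℝ) :=
  ⟨fun t => F t / (F t ^ 2 + 1 / ((k : ℝ) + 1)), by
    refine Continuous.div (by fun_prop) (by fun_prop) fun t => ?_
    positivity⟩

/-- The function `F² / (F² + 1/(k+1))`. -/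
def cutUnit (F : C(I, ℝ)) (k : ℕ) : C(I, ℝ) := F * cutInv F k

theorem cutUnit_apply (F : C(I, ℝ)) (k : ℕ) (t : I) :
    cutUnit F k t = 1 - (1 / ((k : ℝ) + 1)) / (F t ^ 2 + 1 / ((k : ℝ) + 1)) := by
  have : F t ^ 2 + 1 / ((k : ℝ) + 1) ≠ 0 := by positivity
  simp only [cutUnit, cutInv, ContinuousMap.mul_apply, ContinuousMap.coe_mk]
  rw [eq_sub_iff_add_eq, ← mul_div_assoc, ← add_div, ← pow_two, div_self this]

theorem cutUnit_mem_Icc (F : C(I, ℝ)) (k : ℕ) (t : I) : cutUnit F k t ∈ Set.Icc (0 : ℝ) 1 := by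
  have h1 : 0 ≤ (1 / ((k : ℝ) + 1)) / (F t ^ 2 + 1 / ((k : ℝ) + 1)) := by positivity
  have h2 : (1 / ((k : ℝ) + 1)) / (F t ^ 2 + 1 / ((k : ℝ) + 1)) ≤ 1 :=
    div_le_one_of_le₀ (by nlinarith [sq_nonneg (F t)]) (by positivity)
  rw [cutUnit_apply]
  constructor <;> linarith

/-- The functions `F² / (F² + 1/(k+1))` are an approximate unit for the functions which vanish
where `F` does. -/
theorem tendsto_cutUnit_mul (F : C(I, ℝ)) (h : C(I, ℂ)) (hF : ∀ t, F t = 0 → h t = 0) :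
    Tendsto (fun k => toComplexFun (cutUnit F k) * h) atTop (𝓝 h) := by
  rw [Metric.tendsto_nhds]
  intro ε hε
  have hK : IsCompact {t | ε / 2 ≤ ‖h t‖} :=
    (isClosed_le continuous_const (by fun_prop)).isCompact
  -- F has no zeros on the compact set where |h| ≥ ε/2, so F² is bounded below there and the factor
  -- tends to 1 uniformly. Elsewhere h is small and the factor lies in [0,1].
  have hc : ∃ c : ℝ, 0 < c ∧ ∀ t, ε / 2 ≤ ‖h t‖ → c ≤ F t ^ 2 := by
    rcases {t | ε / 2 ≤ ‖h t‖}.eq_empty_or_nonempty with he | hne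
    · refine ⟨1, one_pos, fun t ht => ?_⟩
      have : t ∈ {t | ε / 2 ≤ ‖h t‖} := ht
      rw [he] at this
      exact this.elim
    · obtain ⟨x, hx, hmin⟩ := hK.exists_isMinOn hne
        (show ContinuousOn (fun t => F t ^ 2) _ by fun_prop)
      refine ⟨F x ^ 2, ?_, fun t ht => hmin ht⟩
      have hx' : ε / 2 ≤ ‖h x‖ := hx
      have : F x ≠ 0 := fun h0 => by
        rw [hF x h0, norm_zero] at hx'; linarith
      positivity
  obtain ⟨c, hc, hcF⟩ := hc
  have hlim : Tendsto (fun k : ℕ => ‖h‖ * (1 / ((k : ℝ) + 1) / c)) atTop (𝓝 0) := by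
    have := (tendsto_one_div_add_atTop_nhds_zero_nat (𝕜 := ℝ)).div_const c |>.const_mul ‖h‖
    simpa using this
  filter_upwards [hlim.eventually_lt_const (half_pos hε)] with k hk
  rw [dist_eq_norm]
  refine lt_of_le_of_lt ((ContinuousMap.norm_le _ (C := ε / 2) (by positivity)).2 fun t => ?_)
    (by linarith)
  have e : (toComplexFun (cutUnit F k) * h - h) t = ((cutUnit F k t - 1 : ℝ) : ℂ) * h t := by
    simp [sub_mul]
  have hu := cutUnit_mem_Icc F k t
  rw [e, norm_mul, Complex.norm_real, Real.norm_eq_abs, abs_sub_comm, abs_of_nonneg (by linarith [hu.2])]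
  by_cases ht : ε / 2 ≤ ‖h t‖
  · refine le_trans ?_ hk.le
    rw [cutUnit_apply, sub_sub_cancel, mul_comm]
    have hpos : (0 : ℝ) ≤ 1 / ((k : ℝ) + 1) := by positivity
    have := hcF t ht
    gcongr
    · exact h.norm_coe_le_norm t
    · linarith
  · push Not at ht
    calc _ ≤ 1 * ‖h t‖ := by gcongr; linarith [hu.1]
      _ ≤ ε / 2 := by linarith

end ApproximateUnits

/-! ### Matrix entries cut along cells -/

section CellEntries

open Filter Topology

variable {m : ℕ} {N : Type*} {U : Fin (m + 1) → Set I} {κ : N → Fin (m + 1)} {F : N → C(I, ℝ)}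

/-- The restriction of a matrix entry of an element of the model algebra to the intersection of two
cells. -/
def cellEntry (hF : IsCellFamily U κ F) (g : modelAlg U) (r r' : N) : C(I, ℂ) where
  toFun := {t | F r t ≠ 0 ∧ F r' t ≠ 0}.indicator fun t => (g : IntervalAlg (m + 1)) t (κ r) (κ r')
  continuous_toFun := by
    have hg : Continuous fun t => (g : IntervalAlg (m + 1)) t (κ r) (κ r') := by fun_prop
    have hne : ∀ q t₀, F q t₀ ≠ 0 → ∀ᶠ t in 𝓝 t₀, F q t ≠ 0 := fun q t₀ h =>
      (isOpen_ne_fun (F q).continuous continuous_const).mem_nhds h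
    refine continuous_iff_continuousAt.2 fun t₀ => ?_
    -- Continuity where the cell q ∈ {r, r'} ends. If t₀ is still in U (κ q), it lies in another
    -- cell with the same label, which is open and disjoint from q, so the cut entry is 0 near t₀.
    -- Otherwise the entry of g itself vanishes at t₀.
    have hout : ∀ q : N, (∀ t, t ∈ {t | F r t ≠ 0 ∧ F r' t ≠ 0} → F q t ≠ 0) →
        (t₀ ∉ U (κ q) → (g : IntervalAlg (m + 1)) t₀ (κ r) (κ r') = 0) → F q t₀ = 0 →
        ContinuousAt ({t | F r t ≠ 0 ∧ F r' t ≠ 0}.indicator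
          fun t => (g : IntervalAlg (m + 1)) t (κ r) (κ r')) t₀ := by
      intro q hsub hzero hq
      have hnot : t₀ ∉ {t | F r t ≠ 0 ∧ F r' t ≠ 0} := fun h => hsub _ h hq
      unfold ContinuousAt
      rw [Set.indicator_of_notMem hnot]
      by_cases hU : t₀ ∈ U (κ q)
      · obtain ⟨p, hp, hpt⟩ := (hF.mem_iff _ _).1 hU
        refine tendsto_const_nhds.congr' ?_
        filter_upwards [hne p t₀ hpt] with t ht
        refine (Set.indicator_of_notMem (fun h => ?_) _).symm
        have := hF.unique p q t hp ht (hsub t h)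
        exact hpt (this ▸ hq)
      · have h0 := hg.tendsto t₀
        rw [hzero hU] at h0
        refine squeeze_zero_norm (fun t => ?_) (tendsto_zero_iff_norm_tendsto_zero.1 h0)
        exact norm_indicator_le_norm_self _ _
    by_cases hr : F r t₀ = 0
    · exact hout r (fun t h => h.1) (fun h => g.2 t₀ _ _ (.inl h)) hr
    · by_cases hr' : F r' t₀ = 0
      · exact hout r' (fun t h => h.2) (fun h => g.2 t₀ _ _ (.inr h)) hr'
      · refine hg.continuousAt.congr ?_
        filter_upwards [hne r t₀ hr, hne r' t₀ hr'] with t h h'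
        exact (Set.indicator_of_mem (show t ∈ {t | F r t ≠ 0 ∧ F r' t ≠ 0} from ⟨h, h'⟩)
          (fun t => (g : IntervalAlg (m + 1)) t (κ r) (κ r'))).symm

variable (hF : IsCellFamily U κ F)

theorem cellEntry_of_ne (g : modelAlg U) {r r' : N} {t : I} (h : F r t ≠ 0) (h' : F r' t ≠ 0) :
    cellEntry hF g r r' t = (g : IntervalAlg (m + 1)) t (κ r) (κ r') :=
  Set.indicator_of_mem (show t ∈ {t | F r t ≠ 0 ∧ F r' t ≠ 0} from ⟨h, h'⟩) 
    (fun t => (g : IntervalAlg (m + 1)) t (κ r) (κ r'))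

theorem cellEntry_of_left_eq (g : modelAlg U) {r : N} (r' : N) {t : I} (h : F r t = 0) :
    cellEntry hF g r r' t = 0 :=
  Set.indicator_of_notMem (fun h' : t ∈ {t | F r t ≠ 0 ∧ F r' t ≠ 0} => h'.1 h) 
    (fun t => (g : IntervalAlg (m + 1)) t (κ r) (κ r'))

theorem cellEntry_of_right_eq (g : modelAlg U) (r : N) {r' : N} {t : I} (h : F r' t = 0) :
    cellEntry hF g r r' t = 0 :=
  Set.indicator_of_notMem (fun h' : t ∈ {t | F r t ≠ 0 ∧ F r' t ≠ 0} => h'.2 h) 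
    (fun t => (g : IntervalAlg (m + 1)) t (κ r) (κ r'))

theorem cellEntry_add (g h : modelAlg U) (r r' : N) :
    cellEntry hF (g + h) r r' = cellEntry hF g r r' + cellEntry hF h r r' := by
  ext t
  by_cases hr : F r t = 0
  · simp [cellEntry_of_left_eq hF _ _ hr]
  by_cases hr' : F r' t = 0
  · simp [cellEntry_of_right_eq hF _ _ hr']
  simp [cellEntry_of_ne hF _ hr hr']

theorem cellEntry_of_eq_smul (c : ℂ) {g g' : modelAlg U}
    (h : (g' : IntervalAlg (m + 1)) = c • (g : IntervalAlg (m + 1))) (r r' : N) :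
    cellEntry hF g' r r' = c • cellEntry hF g r r' := by
  ext t
  by_cases hr : F r t = 0
  · simp [cellEntry_of_left_eq hF _ _ hr]
  by_cases hr' : F r' t = 0
  · simp [cellEntry_of_right_eq hF _ _ hr']
  simp [cellEntry_of_ne hF _ hr hr', h]

theorem cellEntry_star (g : modelAlg U) (r r' : N) :
    cellEntry hF (star g) r r' = star (cellEntry hF g r' r) := by
  ext t
  by_cases hr : F r t = 0
  · simp [cellEntry_of_left_eq hF _ _ hr, cellEntry_of_right_eq hF _ _ hr]
  by_cases hr' : F r' t = 0
  · simp [cellEntry_of_right_eq hF _ _ hr', cellEntry_of_left_eq hF _ _ hr']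
  simp [cellEntry_of_ne hF _ hr hr', cellEntry_of_ne hF _ hr' hr, Matrix.star_apply]

-- At a point of U i exactly one cell with label i is active. This converts sums over matrix indices
-- into sums over cells.
include hF in
open Classical in
theorem sum_cells [Fintype N] (t : I) (a : Fin (m + 1) → ℂ) (ha : ∀ i, t ∉ U i → a i = 0) :
    ∑ r, (if F r t ≠ 0 then a (κ r) else 0) = ∑ i, a i := by
  rw [← Finset.sum_fiberwise Finset.univ κ]
  refine Finset.sum_congr rfl fun i _ => ?_
  by_cases hi : t ∈ U i
  · obtain ⟨r, hr, hrt⟩ := (hF.mem_iff _ _).1 hi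
    rw [Finset.sum_eq_single_of_mem r (by simp [hr]), if_pos hrt, hr]
    intro q hq hqr
    rw [if_neg]
    intro hqt
    exact hqr (hF.unique q r t (by rw [hr]; simpa using hq) hqt hrt)
  · rw [ha i hi]
    refine Finset.sum_eq_zero fun r hr => ?_
    have : κ r = i := by simpa using hr
    rw [this, ha i hi, ite_self]

/-- The cut entries multiply like matrices indexed by cells, by `sum_cells`. -/
theorem cellEntry_mul [Fintype N] (g h : modelAlg U) (r r' : N) :
    cellEntry hF (g * h) r r' = ∑ q, cellEntry hF g r q * cellEntry hF h q r' := by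
  classical
  ext t
  simp only [ContinuousMap.sum_apply, ContinuousMap.mul_apply]
  by_cases hr : F r t = 0
  · simp [cellEntry_of_left_eq hF _ _ hr]
  by_cases hr' : F r' t = 0
  · simp [cellEntry_of_right_eq hF _ _ hr']
  rw [cellEntry_of_ne hF _ hr hr']
  change ((g : IntervalAlg (m + 1)) t * (h : IntervalAlg (m + 1)) t) _ _ = _
  rw [Matrix.mul_apply, ← sum_cells hF t _ fun i hi => by rw [g.2 t _ _ (.inr hi), zero_mul]]
  refine Finset.sum_congr rfl fun q _ => ?_
  split_ifs with hq
  · rw [cellEntry_of_ne hF _ hr hq, cellEntry_of_ne hF _ hq hr']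
  · push Not at hq
    rw [cellEntry_of_right_eq hF _ _ hq, zero_mul]

end CellEntries

/-! ### Homomorphisms from the model algebra -/

section Existence

open Filter Topology

variable {m : ℕ} {N : Type*} {U : Fin (m + 1) → Set I} {κ : N → Fin (m + 1)} {F : N → C(I, ℝ)}
  {B : Type*} [NonUnitalCStarAlgebra B]

/-- Elements of a C*-algebra over a homomorphism `ρ` from `C[0,1]` which behave like the functions
`F r ⊗ e_{n,r}`. -/
structure IsCellRep (F : N → C(I, ℝ)) (ρ : C(I, ℂ) →⋆ₙₐ[ℂ] B) (Y : N → B) : Prop where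
  one_mul : ∀ r, ρ 1 * Y r = Y r
  mul_star_self : ∀ r, Y r * star (Y r) = ρ (toComplexFun (F r * F r))
  mul_star_of_ne : ∀ r r', r ≠ r' → Y r * star (Y r') = 0

/-- An approximation of the polar part of `Y r`. -/
def polarApprox (F : N → C(I, ℝ)) (ρ : C(I, ℂ) →⋆ₙₐ[ℂ] B) (Y : N → B) (r : N) (k : ℕ) : B :=
  ρ (toComplexFun (cutInv (F r) k)) * Y r

namespace IsCellRep

variable {ρ : C(I, ℂ) →⋆ₙₐ[ℂ] B} {Y : N → B} (hY : IsCellRep F ρ Y)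

include hY

/-- By the C*-identity, since (ρ(g)Y)(ρ(g)Y)* = ρ(|gF|²). It turns estimates on Y into sup norm
estimates of functions. -/
theorem norm_mul_le (g : C(I, ℂ)) (r : N) : ‖ρ g * Y r‖ ≤ ‖g * toComplexFun (F r)‖ := by
  refine abs_le_of_sq_le_sq' ?_ (norm_nonneg _) |>.2
  rw [pow_two, pow_two, ← CStarRing.norm_self_mul_star, ← CStarRing.norm_self_mul_star]
  have : ρ g * Y r * star (ρ g * Y r) =
      ρ (g * toComplexFun (F r) * star (g * toComplexFun (F r))) := by
    rw [star_mul, mul_assoc, ← mul_assoc (Y r), hY.mul_star_self, ← map_star, ← map_mul, ← map_mul]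
    congr 1
    ext t
    simp only [ContinuousMap.mul_apply, ContinuousMap.star_apply, toComplexFun_apply, star_mul',
      RCLike.star_def, Complex.conj_ofReal, Complex.ofReal_mul]
    ring
  rw [this]
  exact NonUnitalStarAlgHom.norm_apply_le ρ _

theorem norm_polarApprox_le_one (r : N) (k : ℕ) : ‖polarApprox F ρ Y r k‖ ≤ 1 := by
  refine (hY.norm_mul_le _ r).trans ((ContinuousMap.norm_le _ zero_le_one).2 fun t => ?_)
  have h := cutUnit_mem_Icc (F r) k t
  have e : (toComplexFun (cutInv (F r) k) * toComplexFun (F r)) t = (cutUnit (F r) k t : ℂ) := by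
    simp [cutUnit, mul_comm]
  rw [e, Complex.norm_real, Real.norm_of_nonneg h.1]
  exact h.2

/-- The approximate polar parts need not converge; multiplied by an h that vanishes where F does,
they are Cauchy because the cut-off functions times h are. -/
theorem norm_mul_polarApprox_sub_le (h : C(I, ℂ)) (r : N) (k l : ℕ) :
    ‖ρ h * polarApprox F ρ Y r k - ρ h * polarApprox F ρ Y r l‖ ≤
      ‖toComplexFun (cutUnit (F r) k) * h - toComplexFun (cutUnit (F r) l) * h‖ := by
  have e : ρ h * polarApprox F ρ Y r k - ρ h * polarApprox F ρ Y r l =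
      ρ (h * (toComplexFun (cutInv (F r) k) - toComplexFun (cutInv (F r) l))) * Y r := by
    simp only [polarApprox, map_mul, map_sub, mul_sub, sub_mul, mul_assoc]
  rw [e]
  refine (hY.norm_mul_le _ r).trans (le_of_eq ?_)
  congr 1
  ext t
  simp only [cutUnit, ContinuousMap.mul_apply, ContinuousMap.sub_apply, toComplexFun_apply,
    Complex.ofReal_mul]
  ring

theorem polarApprox_mul_star (r : N) (k : ℕ) :
    polarApprox F ρ Y r k * star (polarApprox F ρ Y r k) =
      ρ (toComplexFun (cutUnit (F r) k) * toComplexFun (cutUnit (F r) k)) := by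
  simp only [polarApprox, star_mul]
  rw [mul_assoc, ← mul_assoc (Y r), hY.mul_star_self, ← map_star, ← map_mul, ← map_mul]
  congr 1
  ext t
  simp only [cutUnit, ContinuousMap.mul_apply, ContinuousMap.star_apply, toComplexFun_apply,
    RCLike.star_def, Complex.conj_ofReal, Complex.ofReal_mul]
  ring

theorem polarApprox_mul_star_of_ne {r r' : N} (h : r ≠ r') (k l : ℕ) :
    polarApprox F ρ Y r k * star (polarApprox F ρ Y r' l) = 0 := by
  simp only [polarApprox, star_mul]
  rw [mul_assoc, ← mul_assoc (Y r), hY.mul_star_of_ne r r' h, zero_mul, mul_zero]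

omit hY in
/-- The approximations to the image of `h ⊗ e_{r,r'}`. -/
def entryApprox (F : N → C(I, ℝ)) (ρ : C(I, ℂ) →⋆ₙₐ[ℂ] B) (Y : N → B) (r r' : N) (h : C(I, ℂ))
    (k : ℕ) : B :=
  star (polarApprox F ρ Y r k) * ρ h * polarApprox F ρ Y r' k

theorem norm_entryApprox_le (r r' : N) (h : C(I, ℂ)) (k : ℕ) :
    ‖entryApprox F ρ Y r r' h k‖ ≤ ‖h‖ := by
  have h₁ : ‖star (polarApprox F ρ Y r k)‖ ≤ 1 := by
    rw [norm_star]
    exact hY.norm_polarApprox_le_one r k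
  refine (norm_mul_le_of_le (norm_mul_le_of_le h₁ (NonUnitalStarAlgHom.norm_apply_le ρ h))
    (hY.norm_polarApprox_le_one r' k)).trans (by rw [_root_.one_mul, mul_one])

theorem cauchySeq_entryApprox {r r' : N} {h : C(I, ℂ)} (hr : ∀ t, F r t = 0 → h t = 0)
    (hr' : ∀ t, F r' t = 0 → h t = 0) : CauchySeq (entryApprox F ρ Y r r' h) := by
  have c1 := (tendsto_cutUnit_mul (F r') h hr').cauchySeq
  have c2 := (tendsto_cutUnit_mul (F r) (star h) fun t ht => by
    rw [ContinuousMap.star_apply, hr t ht, star_zero]).cauchySeq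
  rw [Metric.cauchySeq_iff] at c1 c2 ⊢
  intro ε hε
  obtain ⟨n₁, h₁⟩ := c1 (ε / 2) (half_pos hε)
  obtain ⟨n₂, h₂⟩ := c2 (ε / 2) (half_pos hε)
  refine ⟨max n₁ n₂, fun k hk l hl => ?_⟩
  have a1 := h₁ k (le_of_max_le_left hk) l (le_of_max_le_left hl)
  have a2 := h₂ k (le_of_max_le_right hk) l (le_of_max_le_right hl)
  rw [dist_eq_norm] at a1 a2 ⊢
  -- In each summand only one polar part varies, and it stands next to h.
  have e : entryApprox F ρ Y r r' h k - entryApprox F ρ Y r r' h l =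
      star (polarApprox F ρ Y r k) *
        (ρ h * polarApprox F ρ Y r' k - ρ h * polarApprox F ρ Y r' l) +
      star (ρ (star h) * polarApprox F ρ Y r k - ρ (star h) * polarApprox F ρ Y r l) *
        polarApprox F ρ Y r' l := by
    simp only [entryApprox, star_sub, star_mul, map_star, star_star, mul_sub, sub_mul, mul_assoc]
    abel
  rw [e]
  refine (norm_add_le _ _).trans_lt ?_
  have b1 := norm_mul_le_of_le (norm_star (polarApprox F ρ Y r k) ▸ hY.norm_polarApprox_le_one r k)
    (hY.norm_mul_polarApprox_sub_le h r' k l)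
  have b2 := norm_mul_le_of_le ((norm_star (ρ (star h) * polarApprox F ρ Y r k -
    ρ (star h) * polarApprox F ρ Y r l)).le.trans
      (hY.norm_mul_polarApprox_sub_le (star h) r k l)) (hY.norm_polarApprox_le_one r' l)
  linarith

omit hY in
/-- The image of `h ⊗ e_{r,r'}`. -/
def entryMap (F : N → C(I, ℝ)) (ρ : C(I, ℂ) →⋆ₙₐ[ℂ] B) (Y : N → B) (r r' : N)
    (h : C(I, ℂ)) : B :=
  have : Nonempty B := ⟨0⟩
  limUnder atTop (entryApprox F ρ Y r r' h)

theorem tendsto_entryApprox {r r' : N} {h : C(I, ℂ)} (hr : ∀ t, F r t = 0 → h t = 0)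
    (hr' : ∀ t, F r' t = 0 → h t = 0) :
    Tendsto (entryApprox F ρ Y r r' h) atTop (𝓝 (entryMap F ρ Y r r' h)) :=
  (hY.cauchySeq_entryApprox hr hr').tendsto_limUnder

theorem entryMap_add {r r' : N} {h h' : C(I, ℂ)} (hr : ∀ t, F r t = 0 → h t = 0)
    (hr' : ∀ t, F r' t = 0 → h t = 0) (hr₁ : ∀ t, F r t = 0 → h' t = 0)
    (hr₁' : ∀ t, F r' t = 0 → h' t = 0) :
    entryMap F ρ Y r r' (h + h') = entryMap F ρ Y r r' h + entryMap F ρ Y r r' h' := by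
  refine tendsto_nhds_unique (hY.tendsto_entryApprox (fun t ht => ?_) fun t ht => ?_)
    (((hY.tendsto_entryApprox hr hr').add (hY.tendsto_entryApprox hr₁ hr₁')).congr fun k => ?_)
  · simp [hr t ht, hr₁ t ht]
  · simp [hr' t ht, hr₁' t ht]
  · simp only [entryApprox, map_add, mul_add, add_mul]

theorem entryMap_zero (r r' : N) : entryMap F ρ Y r r' 0 = 0 := by
  refine tendsto_nhds_unique (hY.tendsto_entryApprox (by simp) (by simp)) ?_
  refine tendsto_const_nhds.congr fun k => ?_
  simp only [entryApprox, map_zero, mul_zero, zero_mul]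

theorem entryMap_smul (c : ℂ) {r r' : N} {h : C(I, ℂ)} (hr : ∀ t, F r t = 0 → h t = 0)
    (hr' : ∀ t, F r' t = 0 → h t = 0) :
    entryMap F ρ Y r r' (c • h) = c • entryMap F ρ Y r r' h := by
  refine tendsto_nhds_unique (hY.tendsto_entryApprox (fun t ht => ?_) fun t ht => ?_)
    (((hY.tendsto_entryApprox hr hr').const_smul c).congr fun k => ?_)
  · simp [hr t ht]
  · simp [hr' t ht]
  · simp only [entryApprox, map_smul, mul_smul_comm, smul_mul_assoc]

theorem entryMap_star {r r' : N} {h : C(I, ℂ)} (hr : ∀ t, F r t = 0 → h t = 0)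
    (hr' : ∀ t, F r' t = 0 → h t = 0) :
    entryMap F ρ Y r' r (star h) = star (entryMap F ρ Y r r' h) := by
  refine tendsto_nhds_unique (hY.tendsto_entryApprox (fun t ht => ?_) fun t ht => ?_)
    (((hY.tendsto_entryApprox hr hr').star).congr fun k => ?_)
  · simp [hr' t ht]
  · simp [hr t ht]
  · simp only [entryApprox, star_mul, star_star, map_star, mul_assoc]

theorem entryMap_mul_of_ne {r r' q q' : N} {h h' : C(I, ℂ)} (hr : ∀ t, F r t = 0 → h t = 0)
    (hr' : ∀ t, F r' t = 0 → h t = 0) (hq : ∀ t, F q t = 0 → h' t = 0)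
    (hq' : ∀ t, F q' t = 0 → h' t = 0) (hne : r' ≠ q) :
    entryMap F ρ Y r r' h * entryMap F ρ Y q q' h' = 0 := by
  refine tendsto_nhds_unique
    ((hY.tendsto_entryApprox hr hr').mul (hY.tendsto_entryApprox hq hq')) ?_
  refine tendsto_const_nhds.congr fun k => ?_
  have := hY.polarApprox_mul_star_of_ne hne k k
  simp only [entryApprox, mul_assoc]
  rw [← mul_assoc (polarApprox F ρ Y r' k), this, zero_mul, mul_zero, mul_zero]

/-- The inner product of polar parts is ρ(u²) with u the k-th cut-off function of F q. Hence the
product of approximants differs from the approximant of hh' by that of (uh)(uh') - hh', which tends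
to 0 in norm. -/
theorem entryMap_mul {r q r' : N} {h h' : C(I, ℂ)} (hr : ∀ t, F r t = 0 → h t = 0)
    (hq : ∀ t, F q t = 0 → h t = 0) (hq' : ∀ t, F q t = 0 → h' t = 0)
    (hr' : ∀ t, F r' t = 0 → h' t = 0) :
    entryMap F ρ Y r q h * entryMap F ρ Y q r' h' = entryMap F ρ Y r r' (h * h') := by
  have hprod := (hY.tendsto_entryApprox hr hq).mul (hY.tendsto_entryApprox hq' hr')
  have hlim := hY.tendsto_entryApprox (r := r) (r' := r') (h := h * h')
    (fun t ht => by simp [hr t ht]) fun t ht => by simp [hr' t ht]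
  refine tendsto_nhds_unique hprod ?_
  have hu := ((tendsto_cutUnit_mul (F q) h hq).mul (tendsto_cutUnit_mul (F q) h' hq')).sub_const
    (h * h')
  rw [sub_self] at hu
  have hdiff : Tendsto (fun k => entryApprox F ρ Y r q h k * entryApprox F ρ Y q r' h' k -
      entryApprox F ρ Y r r' (h * h') k) atTop (𝓝 0) := by
    refine squeeze_zero_norm (fun k => ?_) (tendsto_zero_iff_norm_tendsto_zero.1 hu)
    refine le_trans (le_of_eq ?_) (hY.norm_entryApprox_le r r' _ k)
    congr 1
    have e := hY.polarApprox_mul_star q k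
    simp only [entryApprox, mul_assoc]
    rw [← mul_assoc (polarApprox F ρ Y q k), e]
    simp only [map_sub, map_mul, mul_sub, sub_mul, mul_assoc]
    congr 2
    rw [← mul_assoc (ρ (toComplexFun (cutUnit (F q) k))) (ρ h), ← map_mul ρ _ h, mul_comm _ h,
      map_mul]
    simp only [← mul_assoc]
  have := hdiff.add hlim
  simpa using this

theorem tendsto_cutUnit_mul_self (r : N) :
    Tendsto (fun k => ρ (toComplexFun (cutUnit (F r) k)) * Y r) atTop (𝓝 (Y r)) := by
  have h := (tendsto_cutUnit_mul (F r) (toComplexFun (F r)) fun t ht => by simp [ht]).sub_const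
    (toComplexFun (F r))
  rw [sub_self] at h
  rw [tendsto_iff_norm_sub_tendsto_zero]
  refine squeeze_zero (fun _ => norm_nonneg _) (fun k => ?_)
    (tendsto_zero_iff_norm_tendsto_zero.1 h)
  have := hY.norm_mul_le (toComplexFun (cutUnit (F r) k) - 1) r
  rwa [map_sub, sub_mul, sub_mul, hY.one_mul, _root_.one_mul] at this

/-- Multiplying an approximate inverse by F gives a cut-off function, which Y absorbs in the limit.
This is what evaluates the homomorphism on the generators. -/
theorem entryMap_mul_mul (r r' : N) (h : C(I, ℂ)) :
    entryMap F ρ Y r r' (toComplexFun (F r) * h * toComplexFun (F r')) =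
      star (Y r) * ρ h * Y r' := by
  refine tendsto_nhds_unique (hY.tendsto_entryApprox (fun t ht => by simp [ht])
    fun t ht => by simp [ht]) ?_
  refine ((((hY.tendsto_cutUnit_mul_self r).star).mul_const (ρ h)).mul
    (hY.tendsto_cutUnit_mul_self r')).congr fun k => ?_
  simp only [entryApprox, polarApprox, star_mul, ← map_star,
    (isSelfAdjoint_toComplexFun _).star_eq, mul_assoc]
  congr 1
  simp only [← mul_assoc, ← map_mul]
  congr 2
  simp only [cutUnit, toComplexFun_mul]
  ring

/-- A family of elements which behave like the functions `F r ⊗ e_{n,r}` determines a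
homomorphism from the model algebra. -/
theorem exists_hom [Fintype N] (hF : IsCellFamily U κ F) :
    ∃ ψ : modelAlg U →⋆ₙₐ[ℂ] B, ∀ g,
      ψ g = ∑ r, ∑ r', entryMap F ρ Y r r' (cellEntry hF g r r') := by
  have hl : ∀ g r r' t, F r t = 0 → cellEntry hF g r r' t = 0 :=
    fun g r r' t => cellEntry_of_left_eq hF g r'
  have hr : ∀ g r r' t, F r' t = 0 → cellEntry hF g r r' t = 0 :=
    fun g r r' t => cellEntry_of_right_eq hF g r
  -- Stated through an equation for g' so that c = 0 also yields the value at 0.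
  have hsmul : ∀ (c : ℂ) (g g' : modelAlg U),
      (g' : IntervalAlg (m + 1)) = c • (g : IntervalAlg (m + 1)) →
      ∑ r, ∑ r', entryMap F ρ Y r r' (cellEntry hF g' r r') =
        c • ∑ r, ∑ r', entryMap F ρ Y r r' (cellEntry hF g r r') := by
    intro c g g' h
    rw [Finset.smul_sum]
    refine Finset.sum_congr rfl fun r _ => ?_
    rw [Finset.smul_sum]
    refine Finset.sum_congr rfl fun r' _ => ?_
    rw [cellEntry_of_eq_smul hF c h, hY.entryMap_smul c (hl _ _ _) (hr _ _ _)]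
  have hmul : ∀ g h : modelAlg U, ∑ r, ∑ r', entryMap F ρ Y r r' (cellEntry hF (g * h) r r') =
      (∑ r, ∑ r', entryMap F ρ Y r r' (cellEntry hF g r r')) *
        ∑ r, ∑ r', entryMap F ρ Y r r' (cellEntry hF h r r') := by
    intro g h
    classical
    have hsum : ∀ (r r' : N) (s : Finset N), entryMap F ρ Y r r'
        (∑ q ∈ s, cellEntry hF g r q * cellEntry hF h q r') =
        ∑ q ∈ s, entryMap F ρ Y r r' (cellEntry hF g r q * cellEntry hF h q r') := by
      intro r r' s
      induction s using Finset.induction_on with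
      | empty =>
        rw [Finset.sum_empty, Finset.sum_empty, hY.entryMap_zero]
      | insert a s has ih =>
        rw [Finset.sum_insert has, Finset.sum_insert has, hY.entryMap_add, ih]
        · intro t ht; simp [hl g r a t ht]
        · intro t ht; simp [hr h a r' t ht]
        · intro t ht
          rw [ContinuousMap.sum_apply]
          exact Finset.sum_eq_zero fun q _ => by simp [hl g r q t ht]
        · intro t ht
          rw [ContinuousMap.sum_apply]
          exact Finset.sum_eq_zero fun q _ => by simp [hr h q r' t ht]
    rw [Finset.sum_mul]
    refine Finset.sum_congr rfl fun r _ => ?_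
    rw [Finset.sum_mul]
    -- Only terms whose inner cells agree survive, by orthogonality of the rows.
    have e : ∀ q, entryMap F ρ Y r q (cellEntry hF g r q) *
        ∑ q', ∑ r', entryMap F ρ Y q' r' (cellEntry hF h q' r') =
        ∑ r', entryMap F ρ Y r r' (cellEntry hF g r q * cellEntry hF h q r') := by
      intro q
      rw [Finset.mul_sum, Finset.sum_eq_single_of_mem q (Finset.mem_univ q), Finset.mul_sum]
      · exact Finset.sum_congr rfl fun r' _ =>
          hY.entryMap_mul (hl _ _ _) (hr _ _ _) (hl _ _ _) (hr _ _ _)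
      · intro q' _ hq'
        rw [Finset.mul_sum]
        exact Finset.sum_eq_zero fun r' _ =>
          hY.entryMap_mul_of_ne (hl _ _ _) (hr _ _ _) (hl _ _ _) (hr _ _ _) hq'.symm
    rw [Finset.sum_congr rfl fun q _ => e q, Finset.sum_comm]
    refine Finset.sum_congr rfl fun r' _ => ?_
    rw [cellEntry_mul, hsum]
  refine ⟨
    { toFun := fun g => ∑ r, ∑ r', entryMap F ρ Y r r' (cellEntry hF g r r')
      map_smul' := fun c g => hsmul c g _ rfl
      map_zero' := by
        rw [hsmul 0 0 0 (zero_smul ℂ (0 : IntervalAlg (m + 1))).symm, zero_smul]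
      map_add' := fun g h => ?_
      map_mul' := fun g h => hmul g h
      map_star' := fun g => ?_ }, fun g => rfl⟩
  · simp only [← Finset.sum_add_distrib]
    refine Finset.sum_congr rfl fun r _ => Finset.sum_congr rfl fun r' _ => ?_
    rw [cellEntry_add, hY.entryMap_add (hl _ _ _) (hr _ _ _) (hl _ _ _) (hr _ _ _)]
  · simp only [star_sum]
    rw [Finset.sum_comm]
    refine Finset.sum_congr rfl fun r _ => Finset.sum_congr rfl fun r' _ => ?_
    rw [cellEntry_star, hY.entryMap_star (hl _ _ _) (hr _ _ _)]

end IsCellRep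

end Existence

/-! ### Universality of the concrete generators -/

section Universality

open Filter Topology

variable {m : ℕ} {S : Type} {U : Fin (m + 1) → Set I} {κ : Option S → Fin (m + 1)}
  {f : S → C(I, ℝ)} {B : Type u} [NonUnitalCStarAlgebra B]

/-- The function `h ⊗ e_{i,j}`. -/
def entryFun (i j : Fin (m + 1)) (h : C(I, ℂ)) : IntervalAlg (m + 1) :=
  (⟨fun z => Matrix.single i j z, by
    refine continuous_matrix fun a b => ?_
    simp only [Matrix.single_apply]
    split_ifs <;> fun_prop⟩ : C(ℂ, Matrix (Fin (m + 1)) (Fin (m + 1)) ℂ)).comp h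

@[simp]
theorem entryFun_apply (i j : Fin (m + 1)) (h : C(I, ℂ)) (t : I) :
    entryFun i j h t = Matrix.single i j (h t) := rfl

theorem continuous_entryFun (i j : Fin (m + 1)) : Continuous (entryFun i j) :=
  ContinuousMap.continuous_postcomp _

theorem lastRow_eq_entryFun (h : C(I, ℝ)) (i : Fin (m + 1)) :
    lastRow h i = entryFun (Fin.last m) i (toComplexFun h) := rfl

theorem entryFun_mul_star (i j k l : Fin (m + 1)) (h h' : C(I, ℂ)) :
    entryFun i j h * star (entryFun k l h') = if j = l then entryFun i k (h * star h') else 0 := by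
  refine ContinuousMap.ext fun t => ?_
  change Matrix.single i j (h t) * star (Matrix.single k l (h' t)) = _
  rw [Matrix.star_eq_conjTranspose, Matrix.conjTranspose_single]
  split_ifs with hjl
  · subst hjl
    rw [Matrix.single_mul_single_same]
    rfl
  · rw [Matrix.single_mul_single_of_ne _ _ _ _ hjl]
    rfl

theorem star_entryFun_mul_mul (i j k l : Fin (m + 1)) (h h' h'' : C(I, ℂ)) :
    star (entryFun k i h) * entryFun k l h' * entryFun l j h'' =
      entryFun i j (star h * h' * h'') := by
  refine ContinuousMap.ext fun t => ?_
  change star (Matrix.single k i (h t)) * Matrix.single k l (h' t) * Matrix.single l j (h'' t) = _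
  rw [Matrix.star_eq_conjTranspose, Matrix.conjTranspose_single, Matrix.single_mul_single_same,
    Matrix.single_mul_single_same]
  rfl

/-- The embedding `h ↦ h ⊗ e_{i,i}`. -/
def diagHom (i : Fin (m + 1)) : C(I, ℂ) →⋆ₙₐ[ℂ] IntervalAlg (m + 1) where
  toFun := entryFun i i
  map_smul' c h := ContinuousMap.ext fun t => by
    change Matrix.single i i (c * h t) = c • Matrix.single i i (h t)
    rw [Matrix.smul_single, smul_eq_mul]
  map_zero' := ContinuousMap.ext fun t => Matrix.single_zero i i
  map_add' h h' := ContinuousMap.ext fun t => Matrix.single_add i i (h t) (h' t)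
  map_mul' h h' := ContinuousMap.ext fun t => by
    change _ = Matrix.single i i (h t) * Matrix.single i i (h' t)
    rw [Matrix.single_mul_single_same]
    rfl
  map_star' h := ContinuousMap.ext fun t => (Matrix.conjTranspose_single i i (h t)).symm

/-- The functions `f s ⊗ e_{n,i}` represent the relations. -/
theorem exactRep_lastRow (hF : IsCellFamily U κ (cellFun f)) (hκ : ∀ s, κ (some s) ≠ Fin.last m)
    (hf : ∀ s t, f s t ≤ 2) :
    ExactRep (stepRelations f) (genFamily (lastRow 1 (Fin.last m) : IntervalAlg (m + 1))
      (lastRow intervalCoe (Fin.last m)) fun s => lastRow (f s) (κ (some s))) := by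
  refine exactRep_of_hom (diagHom (Fin.last m)) (ContinuousMap.id I)
    (fun s => lastRow (f s) (κ (some s))) (fun s t => ⟨hF.nonneg (some s) t, hf s t⟩)
    (fun s => ?_) (fun s => ?_) (fun s => ?_) fun s s' hs => ?_
  · refine ContinuousMap.ext fun t => ?_
    change Matrix.single (Fin.last m) (Fin.last m) (1 : ℂ) *
      Matrix.single (Fin.last m) (κ (some s)) ((f s t : ℝ) : ℂ) = _
    rw [Matrix.single_mul_single_same, one_mul]
    rfl
  · refine ContinuousMap.ext fun t => ?_
    change Matrix.single (Fin.last m) (κ (some s)) ((f s t : ℝ) : ℂ) *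
      Matrix.single (Fin.last m) (Fin.last m) (1 : ℂ) = _
    rw [Matrix.single_mul_single_of_ne _ _ _ _ (hκ s)]
    rfl
  · rw [lastRow_eq_entryFun, entryFun_mul_star, if_pos rfl,
      (isSelfAdjoint_toComplexFun _).star_eq, ← toComplexFun_mul]
    rfl
  · rw [lastRow_eq_entryFun, lastRow_eq_entryFun, entryFun_mul_star]
    split_ifs with h
    · rw [(isSelfAdjoint_toComplexFun _).star_eq, ← toComplexFun_mul]
      refine ContinuousMap.ext fun t => ?_
      have : f s t * f s' t = 0 := by
        by_contra hne
        exact hs (Option.some.inj (hF.unique (some s) (some s') t h (left_ne_zero_of_mul hne)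
          (right_ne_zero_of_mul hne)))
      simp [this]
    · rfl

/-- An exact representation gives elements which behave like the functions `F r ⊗ e_{n,r}`. -/
theorem ExactRep.exists_isCellRep {b : StepGen S → B} (hb : ExactRep (stepRelations f) b) :
    ∃ ρ : C(I, ℂ) →⋆ₙₐ[ℂ] B, ρ 1 = b .P ∧ ρ (toComplexFun intervalCoe) = b .T ∧
      IsCellRep (cellFun f) ρ fun r => r.elim (b .P) fun s => b (.X s) := by
  obtain ⟨h1, h2, h3, h4, h5, h6, h7, h8, h9, h10⟩ := hb.equations
  refine ⟨cornerHom (b .P) (b .T) h1 h2 h3 h4 h5, cornerHom_one .., cornerHom_intervalCoe _ _ _ _ _ h6,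
    fun r => ?_, fun r => ?_, fun r r' hr => ?_⟩
  · rw [cornerHom_one]
    cases r with
    | none => exact h2
    | some s => exact h7 s
  · cases r with
    | none =>
      have : toComplexFun (cellFun f none * cellFun f none) = 1 := by ext; simp [cellFun]
      rw [this, cornerHom_one]
      change b .P * star (b .P) = b .P
      rw [h1.star_eq, h2]
    | some s =>
      rw [cornerHom_toComplexFun]
      exact h10 s
  · cases r with
    | none =>
      cases r' with
      | none => exact absurd rfl hr
      | some s =>
        change b .P * star (b (.X s)) = 0
        rw [← h1.star_eq, ← star_mul, h8, star_zero]
    | some s =>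
      cases r' with
      | none =>
        change b (.X s) * star (b .P) = 0
        rw [h1.star_eq, h8]
      | some s' => exact h9 s s' fun h => hr (h ▸ rfl)

/-- Other cells with the label of s do not meet the support of h, so a function concentrated in one
matrix position and on one cell has a single nonzero cut entry. -/
theorem cellEntry_of_eq_entryFun (hF : IsCellFamily U κ (cellFun f)) (hκ : κ none = Fin.last m)
    (g : modelAlg U) (h : C(I, ℂ)) (s : Option S)
    (hg : (g : IntervalAlg (m + 1)) = entryFun (Fin.last m) (κ s) h)
    (hh : ∀ t, cellFun f s t = 0 → h t = 0) :
    cellEntry hF g none s = h ∧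
      ∀ r r', r ≠ none ∨ r' ≠ s → cellEntry hF g r r' = 0 := by
  constructor
  · ext t
    by_cases hs : cellFun f s t = 0
    · rw [cellEntry_of_right_eq hF g none hs, hh t hs]
    · rw [cellEntry_of_ne hF g (one_ne_zero : (1 : ℝ) ≠ 0) hs, hg, hκ]
      simp
  · intro r r' hr
    ext t
    by_cases h1 : cellFun f r t = 0
    · simp [cellEntry_of_left_eq hF g r' h1]
    by_cases h2 : cellFun f r' t = 0
    · simp [cellEntry_of_right_eq hF g r h2]
    rw [cellEntry_of_ne hF g h1 h2, hg, entryFun_apply, Matrix.single_apply, ContinuousMap.zero_apply]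
    split_ifs with he
    · refine hh t (by_contra fun hs => ?_)
      rcases hr with hr | hr
      · exact hr (hF.unique r none t (he.1.symm.trans hκ.symm) h1 one_ne_zero)
      · exact hr (hF.unique r' s t he.2.symm h2 hs)
    · rfl

/-- Every exact representation is the image of the concrete one. -/
theorem ExactRep.exists_hom [Finite S] (hF : IsCellFamily U κ (cellFun f))
    (hκ : κ none = Fin.last m) {b : StepGen S → B} (hb : ExactRep (stepRelations f) b) :
    ∃ ψ : modelAlg U →⋆ₙₐ[ℂ] B, ∀ x (g : modelAlg U),
      (g : IntervalAlg (m + 1)) = genFamily (lastRow 1 (Fin.last m))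
        (lastRow intervalCoe (Fin.last m)) (fun s => lastRow (f s) (κ (some s))) x →
      ψ g = b x := by
  have := Fintype.ofFinite S
  obtain ⟨h1, h2, h3, h4, h5, -, h7, -⟩ := hb.equations
  obtain ⟨ρ, hρ1, hρT, hY⟩ := hb.exists_isCellRep
  obtain ⟨ψ, hψ⟩ := hY.exists_hom hF
  -- One computation for all generators: h = 1 or h = t with the cell `none` for P and T, and h = 1
  -- with the cell s for X s.
  have key : ∀ (g : modelAlg U) (h : C(I, ℂ)) (s : Option S),
      (g : IntervalAlg (m + 1)) = entryFun (Fin.last m) (κ s) (h * toComplexFun (cellFun f s)) →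
      ψ g = b .P * ρ h * s.elim (b .P) fun s => b (.X s) := by
    intro g h s hg
    obtain ⟨e1, e2⟩ := cellEntry_of_eq_entryFun hF hκ g _ s hg fun t ht => by simp [ht]
    rw [hψ, Finset.sum_eq_single_of_mem none (Finset.mem_univ _),
      Finset.sum_eq_single_of_mem s (Finset.mem_univ _), e1]
    · have := hY.entryMap_mul_mul none s h
      rw [show toComplexFun (cellFun f none) = 1 by ext; simp [cellFun], one_mul] at this
      rw [this]
      change star (b .P) * _ * _ = _
      rw [h1.star_eq]
    · intro r' _ hr'
      rw [e2 none r' (.inr hr'), hY.entryMap_zero]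
    · intro r _ hr
      exact Finset.sum_eq_zero fun r' _ => by rw [e2 r r' (.inl hr), hY.entryMap_zero]
  have hone : toComplexFun (cellFun f none) = 1 := by ext; simp [cellFun]
  refine ⟨ψ, fun x g hg => ?_⟩
  cases x with
  | P =>
    rw [key g 1 none (by
      rw [hg, one_mul, hκ]; rfl), hρ1]
    change b .P * b .P * b .P = _
    rw [h2, h2]
  | T =>
    rw [key g (toComplexFun intervalCoe) none (by
      rw [hg, hone, mul_one, hκ]; rfl), hρT]
    change b .P * b .T * b .P = _
    rw [h4, h5]
  | X s =>
    rw [key g 1 (some s) (by rw [hg, one_mul]; rfl), hρ1, h2]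
    exact h7 s

/-- A closed subalgebra which contains `1` and `t` is everything. -/
theorem eq_top_of_one_mem_of_intervalCoe_mem (N : NonUnitalStarSubalgebra ℂ C(I, ℂ))
    (hN : IsClosed (N : Set C(I, ℂ))) (h1 : 1 ∈ N) (hT : toComplexFun intervalCoe ∈ N)
    (h : C(I, ℂ)) : h ∈ N := by
  let N' : StarSubalgebra ℂ C(I, ℂ) :=
    { N with
      one_mem' := h1
      algebraMap_mem' := fun c => by
        rw [Algebra.algebraMap_eq_smul_one]
        exact N.smul_mem' c h1 }
  have hsep : N'.SeparatesPoints := fun x y hxy =>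
    ⟨_, ⟨toComplexFun intervalCoe, hT, rfl⟩, fun he => hxy (Subtype.ext (Complex.ofReal_injective he))⟩
  have h2 := ContinuousMap.starSubalgebra_topologicalClosure_eq_top_of_separatesPoints N' hsep
  have h3 : h ∈ N'.topologicalClosure := h2 ▸ StarSubalgebra.mem_top
  have h4 : h ∈ closure (N : Set C(I, ℂ)) := h3
  rwa [hN.closure_eq] at h4

/-- The model algebra is generated by the concrete generators. -/
theorem mem_of_generators_mem [Finite S] (hF : IsCellFamily U κ (cellFun f))
    (hκ : κ none = Fin.last m) (K : NonUnitalStarSubalgebra ℂ (IntervalAlg (m + 1)))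
    (hK : IsClosed (K : Set (IntervalAlg (m + 1))))
    (hgen : ∀ x, genFamily (lastRow 1 (Fin.last m))
        (lastRow intervalCoe (Fin.last m)) (fun s => lastRow (f s) (κ (some s))) x ∈ K)
    (g : modelAlg U) : (g : IntervalAlg (m + 1)) ∈ K := by
  have := Fintype.ofFinite S
  -- Stone–Weierstrass in the last diagonal corner, from P and T.
  have hdiag : ∀ h, entryFun (Fin.last m) (Fin.last m) h ∈ K := by
    refine eq_top_of_one_mem_of_intervalCoe_mem (K.comap (diagHom (Fin.last m)))
      (hK.preimage (continuous_entryFun _ _)) ?_ (hgen .T)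
    have h := hgen .P
    change lastRow 1 _ ∈ K at h
    rw [lastRow_eq_entryFun, show toComplexFun 1 = 1 by ext; simp] at h
    exact h
  have hrow : ∀ r, entryFun (Fin.last m) (κ r) (toComplexFun (cellFun f r)) ∈ K := by
    intro r
    cases r with
    | none => rw [hκ]; exact hgen .P
    | some s => exact hgen (.X s)
  have hprod : ∀ r r' h, entryFun (κ r) (κ r')
      (toComplexFun (cellFun f r) * h * toComplexFun (cellFun f r')) ∈ K := by
    intro r r' h
    have := mul_mem (mul_mem (star_mem (hrow r)) (hdiag h)) (hrow r')
    rwa [star_entryFun_mul_mul, (isSelfAdjoint_toComplexFun _).star_eq] at this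
  -- An entry is the iterated limit of its products with cut-off functions of both cells. Each
  -- cut-off function contains a factor F, so the products have the form treated in `hprod`.
  have hentry : ∀ r r', entryFun (κ r) (κ r') (cellEntry hF g r r') ∈ K := by
    intro r r'
    refine hK.mem_of_tendsto ((continuous_entryFun _ _).continuousAt.tendsto.comp
      (tendsto_cutUnit_mul _ _ fun t => cellEntry_of_left_eq hF g r')) (.of_forall fun k => ?_)
    refine hK.mem_of_tendsto ((continuous_entryFun _ _).continuousAt.tendsto.comp
      ((tendsto_cutUnit_mul _ _ fun t => cellEntry_of_right_eq hF g r).const_mul _))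
      (.of_forall fun l => ?_)
    have := hprod r r' (toComplexFun (cutInv (cellFun f r) k) * cellEntry hF g r r' *
      toComplexFun (cutInv (cellFun f r') l))
    change entryFun _ _ _ ∈ K
    convert this using 2
    simp only [cutUnit, toComplexFun_mul]
    ring
  have hsum : (g : IntervalAlg (m + 1)) =
      ∑ r, ∑ r', entryFun (κ r) (κ r') (cellEntry hF g r r') := by
    refine ContinuousMap.ext fun t => ?_
    ext i j
    rw [ContinuousMap.sum_apply, Matrix.sum_apply]
    have e : ∀ r r', entryFun (κ r) (κ r') (cellEntry hF g r r') t i j =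
        if cellFun f r t ≠ 0 then (if cellFun f r' t ≠ 0 then
          (if κ r = i then if κ r' = j then (g : IntervalAlg (m + 1)) t i j else 0 else 0)
          else 0) else 0 := by
      intro r r'
      rw [entryFun_apply, Matrix.single_apply]
      by_cases h1 : cellFun f r t = 0
      · simp [cellEntry_of_left_eq hF g r' h1, h1]
      by_cases h2 : cellFun f r' t = 0
      · simp [cellEntry_of_right_eq hF g r h2, h2]
      rw [cellEntry_of_ne hF g h1 h2, if_pos h1, if_pos h2]
      by_cases h3 : κ r = i
      · by_cases h4 : κ r' = j
        · simp [h3, h4]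
        · simp [h4]
      · simp [h3]
    have e2 : ∀ r, (∑ r', entryFun (κ r) (κ r') (cellEntry hF g r r')) t i j =
        if cellFun f r t ≠ 0 then
          (if κ r = i then (g : IntervalAlg (m + 1)) t i j else 0) else 0 := by
      intro r
      rw [ContinuousMap.sum_apply, Matrix.sum_apply]
      simp only [e]
      split_ifs with h1 h2
      · rw [sum_cells hF t (fun j' => if j' = j then (g : IntervalAlg (m + 1)) t i j else 0)]
        · simp
        · intro j' hj'
          split_ifs with hj
          · exact g.2 t i j (.inr (hj ▸ hj'))
          · rfl
      · simp
      · simp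
    simp only [e2]
    rw [sum_cells hF t (fun i' => if i' = i then (g : IntervalAlg (m + 1)) t i j else 0)]
    · simp
    · intro i' hi'
      split_ifs with hi
      · exact g.2 t i j (.inl (hi ▸ hi'))
      · rfl
  rw [hsum]
  exact sum_mem fun r _ => sum_mem fun r' _ => hentry r r'

end Universality

/-! ### The universal property of A -/

section UniversalProperty

theorem finite_stepGen {S : Type} [Finite S] : Finite (StepGen S) := by
  refine Finite.of_surjective (fun x : Option (Option S) => match x with
    | none => StepGen.P
    | some none => StepGen.T
    | some (some s) => StepGen.X s) fun x => ?_
  cases x with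
  | P => exact ⟨none, rfl⟩
  | T => exact ⟨some none, rfl⟩
  | X s => exact ⟨some (some s), rfl⟩

theorem finite_stepRelations {S : Type} [Finite S] (f : S → C(I, ℝ)) :
    (stepRelations f).Finite := by
  have h1 : ∀ F : S → CStarRelation (StepGen S), {r | ∃ s, r = F s}.Finite := fun F =>
    (Set.finite_range F).subset fun r ⟨s, hs⟩ => ⟨s, hs.symm⟩
  have h2 : ∀ F : S → S → CStarRelation (StepGen S), {r | ∃ s s', r = F s s'}.Finite := fun F =>
    (Set.finite_range fun p : S × S => F p.1 p.2).subset fun r ⟨s, s', hs⟩ => ⟨(s, s'), hs.symm⟩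
  refine (((((((Set.Finite.union ?_ (h1 _)).union (h2 _)).union ?_).union (h1 _)).union
    (h1 _)).union ?_).union (h1 _))
  · simp
  · exact (h2 fun s s' => .isZero (.gen (.X s) * star (.gen (.X s')))).subset
      fun r ⟨s, s', _, hs⟩ => ⟨s, s', hs⟩
  · simp

theorem isClosed_equalizer {A' B' : Type*} [NonUnitalCStarAlgebra A'] [NonUnitalCStarAlgebra B']
    (ψ ψ' : A' →⋆ₙₐ[ℂ] B') :
    IsClosed (NonUnitalStarAlgHom.equalizer ψ ψ' : Set A') :=
  isClosed_eq (continuous_nonUnitalStarAlgHom ψ) (continuous_nonUnitalStarAlgHom ψ')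

theorem isClosed_map_of_injective {A' B' : Type*} [NonUnitalCStarAlgebra A']
    [NonUnitalCStarAlgebra B'] (j : A' →⋆ₙₐ[ℂ] B') (hj : Function.Injective j)
    {E : NonUnitalStarSubalgebra ℂ A'} (hE : IsClosed (E : Set A')) :
    IsClosed (E.map j : Set B') :=
  (NonUnitalStarAlgHom.isometry j hj).isClosedEmbedding.isClosedMap _ hE

variable {m : ℕ}

/-- Homomorphisms from a C*-algebra embedded in the model algebra are determined by the values on
elements which embed as the concrete generators. -/
theorem hom_ext_of_generators {S : Type} [Finite S] {U : Fin (m + 1) → Set I}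
    {κ : Option S → Fin (m + 1)} {f : S → C(I, ℝ)} {A' B' : Type*} [NonUnitalCStarAlgebra A']
    [NonUnitalCStarAlgebra B'] (hF : IsCellFamily U κ (cellFun f)) (hκ : κ none = Fin.last m)
    (j : A' →⋆ₙₐ[ℂ] IntervalAlg (m + 1)) (hj : Function.Injective j)
    (hmem : ∀ c, j c ∈ modelAlg U) {a : StepGen S → A'}
    (ha : ∀ x, j (a x) = genFamily (lastRow 1 (Fin.last m)) (lastRow intervalCoe (Fin.last m))
      (fun s => lastRow (f s) (κ (some s))) x)
    {ψ ψ' : A' →⋆ₙₐ[ℂ] B'} (heq : ∀ x, ψ (a x) = ψ' (a x)) : ψ = ψ' := by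
  -- The image of the equalizer is a closed subalgebra containing the generators, hence all of the
  -- model algebra; injectivity of j carries this back.
  have hgen : ∀ x, genFamily (lastRow 1 (Fin.last m)) (lastRow intervalCoe (Fin.last m))
      (fun s => lastRow (f s) (κ (some s))) x ∈ (NonUnitalStarAlgHom.equalizer ψ ψ').map j :=
    fun x => ⟨a x, heq x, ha x⟩
  ext c
  obtain ⟨c', hc', he⟩ := mem_of_generators_mem hF hκ _
    (isClosed_map_of_injective j hj (isClosed_equalizer ψ ψ')) hgen ⟨j c, hmem c⟩
  have : c' = c := hj he
  exact this ▸ hc'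

variable {A : NonUnitalStarSubalgebra ℂ (IntervalAlg (m + 1))}

theorem concreteGen_eq_genFamily (f : CompIndex A → C(I, ℝ)) :
    concreteGen f = genFamily (lastRow 1 (Fin.last m)) (lastRow intervalCoe (Fin.last m))
      fun s => lastRow (f s) (cellLabel A (some s)) := by
  funext x
  cases x <;> rfl

theorem concreteGen_mem_modelAlg {f : CompIndex A → C(I, ℝ)} (hf : IsComponentFamily A f)
    (hlast : levelSet A (Fin.last m) = Set.univ) (x : StepGen (CompIndex A)) :
    concreteGen f x ∈ modelAlg (levelSet A) := by
  have key : ∀ (h : C(I, ℝ)) (i : Fin (m + 1)), (∀ t, t ∉ levelSet A i → h t = 0) →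
      lastRow h i ∈ modelAlg (levelSet A) := by
    intro h i hh t k l hkl
    change Matrix.single (Fin.last m) i ((h t : ℝ) : ℂ) k l = 0
    rw [Matrix.single_apply]
    split_ifs with he
    · rcases hkl with hk | hl
      · rw [← he.1, hlast] at hk
        exact absurd (Set.mem_univ t) hk
      · rw [hh t (he.2 ▸ hl), Complex.ofReal_zero]
    · rfl
  have hun : ∀ t, t ∉ levelSet A (Fin.last m) → False := fun t ht => by
    rw [hlast] at ht
    exact ht (Set.mem_univ t)
  cases x with
  | P => exact key _ _ fun t ht => (hun t ht).elim
  | T => exact key _ _ fun t ht => (hun t ht).elim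
  | X s =>
    exact key _ _ fun t ht => by_contra fun hne =>
      ht (((hf.isCellFamily hlast).mem_iff _ t).2 ⟨some s, rfl, hne⟩)

/-- The inclusion of `A`, identified with the model algebra, into the interval algebra. -/
def modelInclusion (φ : A ≃⋆ₐ[ℂ] modelAlg (levelSet A)) : A →⋆ₙₐ[ℂ] IntervalAlg (m + 1) :=
  (NonUnitalStarSubalgebraClass.subtype (modelAlg (levelSet A))).comp
    (φ : A →⋆ₙₐ[ℂ] modelAlg (levelSet A))

/-- A special continuous-trace algebra is the universal C*-algebra on the step relations. -/
theorem isUniversalCStar_stepRelations [hclosed : IsClosed (A : Set (IntervalAlg (m + 1)))]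
    [Finite (CompIndex A)] (hlast : levelSet A (Fin.last m) = Set.univ)
    (φ : A ≃⋆ₐ[ℂ] modelAlg (levelSet A)) {f : CompIndex A → C(I, ℝ)} (hf : IsComponentFamily A f)
    {a : StepGen (CompIndex A) → A}
    (ha : ∀ g, (φ (a g) : IntervalAlg (m + 1)) = concreteGen f g) :
    IsUniversalCStar.{u} (stepRelations f) a := by
  have hF := hf.isCellFamily hlast
  have hj : Function.Injective (modelInclusion φ) := Subtype.val_injective.comp φ.injective
  refine ⟨fun r hr => ?_, fun B _ b hb => ?_⟩
  · have h := exactRep_lastRow hF (fun s => (Fin.castSucc_lt_last s.1).ne) (fun s t => (hf s t).2.1)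
      r hr
    rw [← concreteGen_eq_genFamily, ← funext ha] at h
    have e := CStarExpr.map_eval (modelInclusion φ) a r.expr
    rw [← NonUnitalStarAlgHom.norm_map (modelInclusion φ) hj, e]
    exact h
  · obtain ⟨ψ, hψ⟩ := hb.exists_hom hF rfl
    refine ⟨ψ.comp (φ : A →⋆ₙₐ[ℂ] modelAlg (levelSet A)), fun x => ?_, fun ψ' hψ' => ?_⟩
    · refine hψ x (φ (a x)) ?_
      rw [ha, concreteGen_eq_genFamily]
    · set ψ₀ := ψ.comp (φ : A →⋆ₙₐ[ℂ] modelAlg (levelSet A)) with hψ₀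
      have heq : ∀ x, ψ' (a x) = ψ₀ (a x) := by
        intro x
        rw [hψ' x]
        refine (hψ x (φ (a x)) ?_).symm
        rw [ha, concreteGen_eq_genFamily]
      have ha' : ∀ x, modelInclusion φ (a x) = genFamily (lastRow 1 (Fin.last m))
          (lastRow intervalCoe (Fin.last m)) (fun s => lastRow (f s) (cellLabel A (some s))) x :=
        fun x => (ha x).trans (congrFun (concreteGen_eq_genFamily f) x)
      have hmem : ∀ c, modelInclusion φ c ∈ modelAlg (levelSet A) := fun c => (φ c).2
      refine hom_ext_of_generators (A' := A) hF rfl (modelInclusion φ) ?_ ?_ (a := a) ?_ ?_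
      · exact hj
      · exact hmem
      · exact ha'
      · exact heq

end UniversalProperty

/-! ### Uniform continuity of functional calculus; nearby projections -/

section UniformContinuity

variable {B : Type*} [NonUnitalCStarAlgebra B]

theorem abs_le_of_mem_quasispectrum {a : B} (ha : IsSelfAdjoint a) {x : ℝ}
    (hx : x ∈ quasispectrum ℝ a) : |x| ≤ ‖a‖ := by
  have h := norm_apply_le_norm_cfcₙ (id : ℝ → ℝ) a hx
  rwa [cfcₙ_id ℝ a, id, Real.norm_eq_abs] at h

/-- Induction on the identity aᵏ⁺¹ - bᵏ⁺¹ = a(aᵏ - bᵏ) + (a - b)bᵏ, for which the norm bound is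
carried along. The constant is chosen before the algebra; this uniformity is needed for sequences of
varying algebras. -/
theorem cfcₙ_pow_lipschitz (R : ℝ) (n : ℕ) : ∃ C : ℝ, ∀ (B : Type u) [NonUnitalCStarAlgebra B]
    (a b : B), IsSelfAdjoint a → IsSelfAdjoint b → ‖a‖ ≤ R → ‖b‖ ≤ R →
    ‖cfcₙ (fun x : ℝ => x ^ (n + 1)) a - cfcₙ (fun x : ℝ => x ^ (n + 1)) b‖ ≤ C * ‖a - b‖ ∧
      ‖cfcₙ (fun x : ℝ => x ^ (n + 1)) b‖ ≤ R ^ (n + 1) := by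
  induction n with
  | zero =>
    refine ⟨1, fun B _ a b ha hb ha' hb' => ?_⟩
    simp only [zero_add, pow_one]
    rw [show (fun x : ℝ => x) = id from rfl, cfcₙ_id ℝ a, cfcₙ_id ℝ b, one_mul]
    exact ⟨le_rfl, hb'⟩
  | succ n ih =>
    obtain ⟨C, hC⟩ := ih
    refine ⟨R * |C| + R ^ (n + 1), fun B _ a b ha hb ha' hb' => ?_⟩
    have hR := (norm_nonneg _).trans ha'
    have e : ∀ c : B, IsSelfAdjoint c → cfcₙ (fun x : ℝ => x ^ (n + 1 + 1)) c =
        c * cfcₙ (fun x : ℝ => x ^ (n + 1)) c := by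
      intro c hc
      rw [show (fun x : ℝ => x ^ (n + 1 + 1)) = fun x => id x * x ^ (n + 1) by
        funext x; simp only [id, pow_succ]; ring,
        cfcₙ_mul id (fun x : ℝ => x ^ (n + 1)) c, cfcₙ_id ℝ c]
    obtain ⟨h1, h2⟩ := hC B a b ha hb ha' hb'
    rw [e a ha, e b hb]
    constructor
    · have e2 : a * cfcₙ (fun x : ℝ => x ^ (n + 1)) a - b * cfcₙ (fun x : ℝ => x ^ (n + 1)) b =
          a * (cfcₙ (fun x : ℝ => x ^ (n + 1)) a - cfcₙ (fun x : ℝ => x ^ (n + 1)) b) +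
          (a - b) * cfcₙ (fun x : ℝ => x ^ (n + 1)) b := by
        rw [mul_sub, sub_mul]; abel
      rw [e2]
      have h3 : C * ‖a - b‖ ≤ |C| * ‖a - b‖ := by gcongr; exact le_abs_self C
      calc _ ≤ ‖a‖ * ‖cfcₙ (fun x : ℝ => x ^ (n + 1)) a - cfcₙ (fun x : ℝ => x ^ (n + 1)) b‖ +
          ‖a - b‖ * ‖cfcₙ (fun x : ℝ => x ^ (n + 1)) b‖ :=
            (norm_add_le _ _).trans (add_le_add (norm_mul_le _ _) (norm_mul_le _ _))
        _ ≤ R * (|C| * ‖a - b‖) + ‖a - b‖ * R ^ (n + 1) := by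
            gcongr
            exact h1.trans h3
        _ = _ := by ring
    · rw [pow_succ']
      exact norm_mul_le_of_le hb' h2

theorem cfcₙ_polynomial_lipschitz (R : ℝ) (q : Polynomial ℝ) : ∃ C : ℝ,
    ∀ (B : Type u) [NonUnitalCStarAlgebra B] (a b : B), IsSelfAdjoint a → IsSelfAdjoint b →
    ‖a‖ ≤ R → ‖b‖ ≤ R →
    ‖cfcₙ (fun x : ℝ => x * q.eval x) a - cfcₙ (fun x : ℝ => x * q.eval x) b‖ ≤ C * ‖a - b‖ := by
  induction q using Polynomial.induction_on' with
  | add p q hp hq =>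
    obtain ⟨C, hC⟩ := hp
    obtain ⟨D, hD⟩ := hq
    refine ⟨C + D, fun B _ a b ha hb ha' hb' => ?_⟩
    have e : ∀ c : B, cfcₙ (fun x : ℝ => x * (p + q).eval x) c =
        cfcₙ (fun x : ℝ => x * p.eval x) c + cfcₙ (fun x : ℝ => x * q.eval x) c := by
      intro c
      rw [← cfcₙ_add (fun x : ℝ => x * p.eval x) (fun x : ℝ => x * q.eval x) (a := c)]
      simp only [Polynomial.eval_add, mul_add]
    rw [e, e, add_sub_add_comm, add_mul]
    exact norm_add_le_of_le (hC B a b ha hb ha' hb') (hD B a b ha hb ha' hb')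
  | monomial n c =>
    obtain ⟨C, hC⟩ := cfcₙ_pow_lipschitz.{u} R n
    refine ⟨|c| * C, fun B _ a b ha hb ha' hb' => ?_⟩
    have e : ∀ d : B, cfcₙ (fun x : ℝ => x * (Polynomial.monomial n c).eval x) d =
        c • cfcₙ (fun x : ℝ => x ^ (n + 1)) d := by
      intro d
      rw [← cfcₙ_smul c (fun x : ℝ => x ^ (n + 1)) d]
      congr 1
      funext x
      simp only [Polynomial.eval_monomial, smul_eq_mul]
      ring
    rw [e, e, ← smul_sub, norm_smul, mul_assoc, Real.norm_eq_abs]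
    gcongr
    exact (hC B a b ha hb ha' hb').1

/-- Continuous functional calculus is uniformly continuous on bounded sets of self-adjoint elements,
uniformly over all C*-algebras. -/
theorem exists_cfcₙ_uniform (h : C(ℝ, ℝ)₀) (R : ℝ) {δ : ℝ} (hδ : 0 < δ) : ∃ η > 0,
    ∀ (B : Type u) [NonUnitalCStarAlgebra B] (a b : B), IsSelfAdjoint a → IsSelfAdjoint b →
    ‖a‖ ≤ R → ‖b‖ ≤ R → ‖a - b‖ ≤ η → ‖cfcₙ (h : ℝ → ℝ) a - cfcₙ (h : ℝ → ℝ) b‖ ≤ δ := by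
  obtain ⟨p, hp⟩ := exists_polynomial_near_of_continuousOn (-|R|) |R| h
    (h : C(ℝ, ℝ)).continuous.continuousOn (δ / 6) (by positivity)
  -- X q is p without its constant term, as the non-unital calculus requires. Since h(0) = 0,
  -- dropping p(0) costs at most another δ/6.
  set q := p.divX with hq
  have hpq : ∀ x : ℝ, |x| ≤ |R| → |h x - x * q.eval x| ≤ δ / 3 := by
    intro x hx
    have h1 := hp x (abs_le.1 hx)
    have h2 := hp 0 (by simp)
    have e : p.eval x = x * q.eval x + p.eval 0 := by
      conv_lhs => rw [← p.divX_mul_X_add]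
      simp [hq, mul_comm, Polynomial.coeff_zero_eq_eval_zero]
    rw [map_zero h] at h2
    rw [abs_lt] at h1 h2
    rw [abs_le]
    constructor <;> linarith [h1.1, h1.2, h2.1, h2.2]
  obtain ⟨C, hC⟩ := cfcₙ_polynomial_lipschitz.{u} R q
  refine ⟨δ / 3 / (|C| + 1), by positivity, fun B _ a b ha hb ha' hb' hab => ?_⟩
  have happ : ∀ c : B, IsSelfAdjoint c → ‖c‖ ≤ R →
      ‖cfcₙ (h : ℝ → ℝ) c - cfcₙ (fun x : ℝ => x * q.eval x) c‖ ≤ δ / 3 := by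
    intro c hc hc'
    rw [← cfcₙ_sub (h : ℝ → ℝ) (fun x : ℝ => x * q.eval x) (a := c)]
    refine norm_cfcₙ_le fun x hx => ?_
    exact hpq x ((abs_le_of_mem_quasispectrum hc hx).trans (hc'.trans (le_abs_self R)))
  have h1 := happ a ha ha'
  have h2 := happ b hb hb'
  have h3 := hC B a b ha hb ha' hb'
  have h4 : C * ‖a - b‖ ≤ δ / 3 := by
    calc C * ‖a - b‖ ≤ (|C| + 1) * (δ / 3 / (|C| + 1)) := by
          gcongr
          linarith [le_abs_self C]
      _ = δ / 3 := by field_simp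
  rw [norm_sub_rev] at h2
  calc _ = ‖(cfcₙ (h : ℝ → ℝ) a - cfcₙ (fun x : ℝ => x * q.eval x) a) +
        (cfcₙ (fun x : ℝ => x * q.eval x) a - cfcₙ (fun x : ℝ => x * q.eval x) b) +
        (cfcₙ (fun x : ℝ => x * q.eval x) b - cfcₙ (h : ℝ → ℝ) b)‖ := by
          congr 1; abel
    _ ≤ δ / 3 + δ / 3 + δ / 3 := norm_add₃_le.trans
        (add_le_add (add_le_add h1 (h3.trans h4)) h2)
    _ = δ := by ring

/-- The function which is `0` up to `1/4`, `1` from `3/4` on, and linear in between. -/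
def cutFun : C(ℝ, ℝ)₀ :=
  ⟨⟨fun x => min (max (2 * x - 1 / 2) 0) 1, by fun_prop⟩, by simp⟩

/-- An almost idempotent self-adjoint element is near a projection. -/
theorem exists_projection_near {a : B} (ha : IsSelfAdjoint a) :
    ∃ p : B, IsSelfAdjoint p ∧ p * p = p ∧ ‖p - a‖ ≤ 7 * ‖a * a - a‖ := by
  -- Below 3/16 the spectrum avoids [1/4, 3/4], where x - x² ≥ 3/16, and the cut function is 0 or 1
  -- on it. Otherwise the projection 0 will do: ‖a‖² ≤ d + ‖a‖ with d ≥ 3/16 forces ‖a‖ ≤ 7d. Only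
  -- this second case needs a constant as large as 7.
  by_cases h : ‖a * a - a‖ < 3 / 16
  · have e : cfcₙ (fun x : ℝ => x * x - x) a = a * a - a := by
      rw [cfcₙ_sub (fun x : ℝ => x * x) (fun x : ℝ => x) (a := a), cfcₙ_mul (fun x : ℝ => x)
        (fun x : ℝ => x) a, show (fun x : ℝ => x) = id from rfl, cfcₙ_id ℝ a]
    have hx : ∀ x ∈ quasispectrum ℝ a, |x * x - x| ≤ ‖a * a - a‖ := fun x hx => by
      have h := norm_apply_le_norm_cfcₙ (fun x : ℝ => x * x - x) a hx
      rwa [e, Real.norm_eq_abs] at h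
    have hcut : ∀ x ∈ quasispectrum ℝ a,
        (x ≤ 1 / 4 ∧ cutFun x = 0) ∨ (3 / 4 ≤ x ∧ cutFun x = 1) := by
      intro x hxa
      have h1 := (hx x hxa).trans_lt h
      rw [abs_lt] at h1
      change (x ≤ 1 / 4 ∧ min (max (2 * x - 1 / 2) 0) 1 = 0) ∨
        (3 / 4 ≤ x ∧ min (max (2 * x - 1 / 2) 0) 1 = 1)
      rcases le_or_gt x (1 / 4) with h2 | h2
      · left
        refine ⟨h2, ?_⟩
        rw [max_eq_right (by linarith), min_eq_left zero_le_one]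
      · right
        have h3 : 3 / 4 ≤ x := by nlinarith
        refine ⟨h3, ?_⟩
        rw [max_eq_left (by linarith), min_eq_right (by linarith)]
    refine ⟨cfcₙ (cutFun : ℝ → ℝ) a, cfcₙ_predicate _ _, ?_, ?_⟩
    · rw [← cfcₙ_mul (cutFun : ℝ → ℝ) (cutFun : ℝ → ℝ) a]
      refine cfcₙ_congr fun x hxa => ?_
      rcases hcut x hxa with h1 | h1 <;> simp [h1.2]
    · have e2 : cfcₙ (cutFun : ℝ → ℝ) a - a = cfcₙ (fun x : ℝ => cutFun x - x) a := by
        rw [cfcₙ_sub (cutFun : ℝ → ℝ) (fun x : ℝ => x) (a := a),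
          show (fun x : ℝ => x) = id from rfl, cfcₙ_id ℝ a]
      rw [e2]
      refine norm_cfcₙ_le fun x hxa => ?_
      refine le_trans ?_ (mul_le_mul_of_nonneg_left (hx x hxa) (by norm_num : (0 : ℝ) ≤ 7))
      have h0 := (hx x hxa).trans_lt h
      rw [abs_lt] at h0
      rw [Real.norm_eq_abs, ← abs_of_pos (by norm_num : (0 : ℝ) < 7), ← abs_mul]
      apply sq_le_sq.1
      rcases hcut x hxa with h1 | h1
      · rw [h1.2]
        nlinarith [sq_nonneg x, mul_nonneg (sq_nonneg x) (by linarith [h1.1] : 0 ≤ 1 / 4 - x),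
          mul_nonneg (sq_nonneg x) (sq_nonneg (x - 1 / 4))]
      · rw [h1.2]
        nlinarith [sq_nonneg (x - 1), mul_nonneg (sq_nonneg (x - 1))
          (by linarith [h1.1] : 0 ≤ x - 3 / 4),
          mul_nonneg (sq_nonneg (x - 1)) (sq_nonneg (x - 3 / 4))]
  · refine ⟨0, IsSelfAdjoint.zero B, mul_zero 0, ?_⟩
    push Not at h
    rw [zero_sub, norm_neg]
    have h1 : ‖a‖ * ‖a‖ ≤ ‖a * a - a‖ + ‖a‖ := by
      rw [← CStarRing.norm_star_mul_self, ha.star_eq]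
      calc ‖a * a‖ = ‖(a * a - a) + a‖ := by rw [sub_add_cancel]
        _ ≤ _ := norm_add_le _ _
    nlinarith [norm_nonneg a]

end UniformContinuity

/-! ### Correcting P, T and X asymptotically -/

section Asymptotic

open Filter Topology

variable {B : ℕ → Type u} [∀ k, NonUnitalCStarAlgebra (B k)]

/-- Two sequences of elements of C*-algebras whose difference tends to zero. -/
def AsympEq (x y : ∀ k, B k) : Prop := Tendsto (fun k => ‖x k - y k‖) atTop (𝓝 0)

/-- Bounded sequences of elements of C*-algebras. -/
def AsympBdd (x : ∀ k, B k) : Prop := ∃ C, ∀ k, ‖x k‖ ≤ C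

theorem AsympEq.of_le {x y : ∀ k, B k} {ε : ℕ → ℝ} (hε : Tendsto ε atTop (𝓝 0))
    (h : ∀ k, ‖x k - y k‖ ≤ ε k) : AsympEq x y :=
  squeeze_zero (fun _ => norm_nonneg _) h hε

theorem AsympEq.refl (x : ∀ k, B k) : AsympEq x x := by simp [AsympEq]

theorem AsympEq.symm {x y : ∀ k, B k} (h : AsympEq x y) : AsympEq y x := by
  simpa only [AsympEq, norm_sub_rev] using h

theorem AsympEq.trans {x y z : ∀ k, B k} (h : AsympEq x y) (h' : AsympEq y z) : AsympEq x z :=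
  AsympEq.of_le (by simpa using Tendsto.add h h') fun k => norm_sub_le_norm_sub_add_norm_sub ..

theorem AsympEq.add {x y x' y' : ∀ k, B k} (h : AsympEq x x') (h' : AsympEq y y') :
    AsympEq (fun k => x k + y k) fun k => x' k + y' k :=
  AsympEq.of_le (by simpa using Tendsto.add h h') fun k => by
    rw [add_sub_add_comm]
    exact norm_add_le _ _

theorem AsympEq.sub {x y x' y' : ∀ k, B k} (h : AsympEq x x') (h' : AsympEq y y') :
    AsympEq (fun k => x k - y k) fun k => x' k - y' k :=
  AsympEq.of_le (by simpa using Tendsto.add h h') fun k => by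
    rw [sub_sub_sub_comm]
    exact norm_sub_le _ _

theorem AsympEq.star {x x' : ∀ k, B k} (h : AsympEq x x') :
    AsympEq (fun k => star (x k)) fun k => star (x' k) := by
  simpa only [AsympEq, ← star_sub, norm_star] using h

theorem AsympEq.const_smul (c : ℂ) {x x' : ∀ k, B k} (h : AsympEq x x') :
    AsympEq (fun k => c • x k) fun k => c • x' k := by
  simpa only [AsympEq, ← smul_sub, norm_smul, mul_zero] using Tendsto.const_mul ‖c‖ h

theorem AsympEq.mul {x y x' y' : ∀ k, B k} (h : AsympEq x x') (h' : AsympEq y y')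
    (hx : AsympBdd x) (hy : AsympBdd y') : AsympEq (fun k => x k * y k) fun k => x' k * y' k := by
  obtain ⟨C, hC⟩ := hx
  obtain ⟨D, hD⟩ := hy
  refine AsympEq.of_le (ε := fun k => C * ‖y k - y' k‖ + ‖x k - x' k‖ * D)
    (by simpa using (Tendsto.const_mul C h').add (Tendsto.mul_const D h)) fun k => ?_
  have e : x k * y k - x' k * y' k = x k * (y k - y' k) + (x k - x' k) * y' k := by
    rw [mul_sub, sub_mul]; abel
  rw [e]
  exact (norm_add_le _ _).trans (add_le_add (norm_mul_le_of_le (hC k) le_rfl)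
    (norm_mul_le_of_le le_rfl (hD k)))

theorem AsympBdd.congr {x y : ∀ k, B k} (hy : AsympBdd y) (h : AsympEq x y) : AsympBdd x := by
  obtain ⟨C, hC⟩ := hy
  obtain ⟨D, hD⟩ := Tendsto.bddAbove_range h
  refine ⟨D + C, fun k => ?_⟩
  calc ‖x k‖ = ‖(x k - y k) + y k‖ := by rw [sub_add_cancel]
    _ ≤ _ := norm_add_le_of_le (hD ⟨k, rfl⟩) (hC k)

theorem AsympBdd.mul {x y : ∀ k, B k} (hx : AsympBdd x) (hy : AsympBdd y) :
    AsympBdd fun k => x k * y k := by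
  obtain ⟨C, hC⟩ := hx
  obtain ⟨D, hD⟩ := hy
  exact ⟨C * D, fun k => norm_mul_le_of_le (hC k) (hD k)⟩

theorem AsympBdd.star {x : ∀ k, B k} (hx : AsympBdd x) : AsympBdd fun k => star (x k) := by
  simpa only [AsympBdd, norm_star] using hx

/-- The algebra changes with k, so continuity in a single algebra would not suffice:
`exists_cfcₙ_uniform` gives one modulus for all. -/
theorem AsympEq.cfcₙ (h : C(ℝ, ℝ)₀) {x y : ∀ k, B k} (hxy : AsympEq x y)
    (hx : ∀ k, IsSelfAdjoint (x k)) (hy : ∀ k, IsSelfAdjoint (y k)) (hy' : AsympBdd y) :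
    AsympEq (fun k => _root_.cfcₙ (h : ℝ → ℝ) (x k)) fun k => _root_.cfcₙ (h : ℝ → ℝ) (y k) := by
  obtain ⟨C, hC⟩ := hy'.congr hxy
  obtain ⟨D, hD⟩ := hy'
  refine Metric.tendsto_nhds.2 fun δ hδ => ?_
  obtain ⟨η, hη, H⟩ := exists_cfcₙ_uniform.{u} h (max C D) (half_pos hδ)
  filter_upwards [(Metric.tendsto_nhds.1 hxy) η hη] with k hk
  rw [Real.dist_0_eq_abs, abs_norm] at hk ⊢
  exact (H (B k) (x k) (y k) (hx k) (hy k) ((hC k).trans (le_max_left _ _))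
    ((hD k).trans (le_max_right _ _)) hk.le).trans_lt (half_lt_self hδ)

theorem asympEq_realPart {x : ∀ k, B k} (h : AsympEq x fun k => star (x k)) :
    AsympEq (fun k => (ℜ (x k) : B k)) x := by
  refine AsympEq.of_le h fun k => ?_
  have e : (ℜ (x k) : B k) - x k = (-(2⁻¹ : ℝ)) • (x k - star (x k)) := by
    rw [realPart_apply_coe]
    module
  rw [e, norm_smul]
  have := norm_nonneg (x k - star (x k))
  norm_num
  linarith

/-- From approximate representations of the relations to a homomorphism from `C[0,1]` and elements
which are approximately orthogonal over it. -/
theorem exists_asymptotic_hom {S : Type} {f : S → C(I, ℝ)} {b : ∀ k, StepGen S → B k} {ε : ℕ → ℝ}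
    (hε : Tendsto ε atTop (𝓝 0)) (hε₁ : ∀ k, ε k ≤ 1)
    (hb : ∀ k, ApproxRep (stepRelations f) (ε k) (b k)) :
    ∃ (ρ : ∀ k, C(I, ℂ) →⋆ₙₐ[ℂ] B k) (Y : S → ∀ k, B k),
      (∀ s k, ρ k 1 * Y s k = Y s k) ∧ (∀ s k, Y s k * ρ k 1 = 0) ∧
      AsympEq (fun k => ρ k 1) (fun k => b k .P) ∧
      AsympEq (fun k => ρ k (toComplexFun intervalCoe)) (fun k => b k .T) ∧
      (∀ s, AsympEq (Y s) fun k => b k (.X s)) ∧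
      (∀ s, AsympEq (fun k => Y s k * star (Y s k)) fun k => ρ k (toComplexFun (f s * f s))) ∧
      ∀ s s', s ≠ s' → AsympEq (fun k => Y s k * star (Y s' k)) fun _ => 0 := by
  have est := fun k => (hb k).estimates
  set P : ∀ k, B k := fun k => b k .P
  set T : ∀ k, B k := fun k => b k .T
  set X : S → ∀ k, B k := fun s k => b k (.X s)
  have hPs : AsympEq P fun k => star (P k) := .of_le hε fun k => (est k).1.1
  have hPP : AsympEq P fun k => P k * P k := .of_le hε fun k => (est k).1.2.1
  have hPX : ∀ s, AsympEq (fun k => P k * X s k) (X s) := fun s =>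
    .of_le hε fun k => (est k).2.2.2.1 s
  have hXP : ∀ s, AsympEq (fun k => X s k * P k) fun _ => 0 := fun s =>
    .of_le hε fun k => by rw [sub_zero]; exact (est k).2.2.2.2.1 s
  have hXX : ∀ s s', s ≠ s' → AsympEq (fun k => X s k * star (X s' k)) fun _ => 0 :=
    fun s s' h => .of_le hε fun k => by rw [sub_zero]; exact (est k).2.2.1 s s' h
  have hPT : AsympEq (fun k => P k * T k) T := .of_le hε fun k => (est k).2.2.2.2.2.1.1
  have hTP : AsympEq (fun k => T k * P k) T := .of_le hε fun k => (est k).2.2.2.2.2.1.2.1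
  have hTc : AsympEq T fun k => cfcₙ (clampFun : ℝ → ℝ) (ℜ (T k) : B k) :=
    .of_le hε fun k => (est k).2.2.2.2.2.1.2.2
  have hXf : ∀ s, AsympEq (fun k => X s k * star (X s k)) fun k =>
      cfcₙ (recentred (f s * f s) : ℝ → ℝ) (ℜ (T k) : B k) +
        (((f s * f s) 0 : ℝ) : ℂ) • P k := fun s => .of_le hε fun k => (est k).2.2.2.2.2.2 s
  have bT : AsympBdd T := ⟨2, fun k => (est k).1.2.2.trans (by linarith [hε₁ k])⟩
  have bX : ∀ s, AsympBdd (X s) := fun s => ⟨3, fun k => ((est k).2.1 s).trans (by linarith [hε₁ k])⟩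
  -- The relations do not bound P directly; P*P ≈ P² ≈ P with errors at most ‖P‖ and 1 gives ‖P‖² ≤
  -- 2‖P‖ + 1.
  have bP : AsympBdd P := by
    refine ⟨3, fun k => ?_⟩
    have h1 : ‖P k‖ * ‖P k‖ ≤ 1 * ‖P k‖ + 1 + ‖P k‖ := by
      rw [← CStarRing.norm_star_mul_self]
      have e : star (P k) * P k = -((P k - star (P k)) * P k) + -(P k - P k * P k) + P k := by
        rw [sub_mul]; abel
      rw [e]
      refine norm_add₃_le.trans ?_
      rw [norm_neg, norm_neg]
      gcongr
      · exact norm_mul_le_of_le ((est k).1.1.trans (hε₁ k)) le_rfl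
      · exact (est k).1.2.1.trans (hε₁ k)
    nlinarith [norm_nonneg (P k)]
  -- the projection
  have hP0 := asympEq_realPart hPs
  have bP0 := bP.congr hP0
  choose Q hQs hQQ hQn using fun k => exists_projection_near (ℜ (P k)).2
  have hQ : AsympEq Q P := by
    refine AsympEq.trans ?_ hP0
    have h := ((hP0.mul hP0 bP0 bP).trans (hPP.symm.trans hP0.symm))
    exact .of_le (by simpa using Tendsto.const_mul 7 h) hQn
  have bQ := bP.congr hQ
  -- the contraction in the corner
  have hTs : AsympEq T fun k => star (T k) := by
    refine hTc.trans ?_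
    have h := hTc.symm.star
    refine AsympEq.trans ?_ h
    have e : ∀ k, star (cfcₙ (clampFun : ℝ → ℝ) (ℜ (T k) : B k)) =
        cfcₙ (clampFun : ℝ → ℝ) (ℜ (T k) : B k) := fun k =>
      IsSelfAdjoint.star_eq (cfcₙ_predicate _ _)
    simp only [e]
    exact .refl _
  have hT0 := asympEq_realPart hTs
  have bT0 := bT.congr hT0
  have hT1 : AsympEq (fun k => Q k * (ℜ (T k) : B k) * Q k) T :=
    (((hQ.mul hT0 bQ bT).trans hPT).mul hQ (bQ.mul bT0) bP).trans hTP
  have sT1 : ∀ k, IsSelfAdjoint (Q k * (ℜ (T k) : B k) * Q k) := fun k => by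
    have h := (ℜ (T k)).2.star_eq
    change star _ = _
    simp only [star_mul, (hQs k).star_eq, mul_assoc]
    rw [show star (ℜ (T k) : B k) = ℜ (T k) from h]
  -- Compress to the corner of Q, then clamp. As the clamp function vanishes at 0, the result stays
  -- in the corner.
  set T2 : ∀ k, B k := fun k => cfcₙ (clampFun : ℝ → ℝ) (Q k * (ℜ (T k) : B k) * Q k)
  have hT2 : AsympEq T2 T :=
    ((hT1.trans hT0.symm).cfcₙ clampFun sT1 (fun k => (ℜ (T k)).2) bT0).trans hTc.symm
  have sT2 : ∀ k, IsSelfAdjoint (T2 k) := fun k => cfcₙ_predicate _ _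
  have mT2 : ∀ k, T2 k ∈ cornerSubalgebra (Q k) (hQs k) := fun k =>
    cfcₙ_real_mem _ (isClosed_cornerSubalgebra _ _) (sT1 k)
      ⟨by rw [← mul_assoc, ← mul_assoc, hQQ], by rw [mul_assoc, hQQ]⟩ _
  have cT2 : ∀ k, cfcₙ (clampFun : ℝ → ℝ) (T2 k) = T2 k := fun k => by
    change cfcₙ (clampFun : ℝ → ℝ) (cfcₙ (clampFun : ℝ → ℝ) _) = cfcₙ (clampFun : ℝ → ℝ) _
    rw [← cfcₙ_comp (clampFun : ℝ → ℝ) (clampFun : ℝ → ℝ) _]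
    congr 1
    funext x
    change min (max (min (max x 0) 1) 0) 1 = min (max x 0) 1
    rw [max_eq_left (le_min (le_max_right _ _) zero_le_one), min_eq_left (min_le_right _ _)]
  -- The new X is Q X (1 - Q), written without a unit.
  refine ⟨fun k => cornerHom (Q k) (T2 k) (hQs k) (hQQ k) (sT2 k) (mT2 k).1 (mT2 k).2,
    fun s k => Q k * X s k - Q k * X s k * Q k, fun s k => ?_, fun s k => ?_, ?_, ?_, ?_⟩
  · rw [cornerHom_one, mul_sub]
    simp only [← mul_assoc, hQQ]
  · rw [cornerHom_one, sub_mul, mul_assoc _ (Q k), hQQ, sub_self]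
  · simpa only [cornerHom_one] using hQ
  · simpa only [cornerHom_intervalCoe _ _ _ _ _ (cT2 _)] using hT2
  have hY : ∀ s, AsympEq (fun k => Q k * X s k - Q k * X s k * Q k) (X s) := by
    intro s
    have h1 := (hQ.mul (.refl (X s)) bQ (bX s)).trans (hPX s)
    have h2 := (h1.mul hQ (bQ.mul (bX s)) bP).trans (hXP s)
    simpa only [sub_zero] using h1.sub h2
  have bY := fun s => (bX s).congr (hY s)
  have hYY : ∀ s s', AsympEq (fun k => (Q k * X s k - Q k * X s k * Q k) *
      star (Q k * X s' k - Q k * X s' k * Q k)) fun k => X s k * star (X s' k) := fun s s' =>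
    (hY s).mul (hY s').star (bY s) (bX s').star
  refine ⟨hY, fun s => ?_, fun s s' h => (hYY s s').trans (hXX s s' h)⟩
  refine ((hYY s s).trans (hXf s)).trans ?_
  simp only [cornerHom_toComplexFun]
  exact ((hT0.trans hT2.symm).cfcₙ _ (fun k => (ℜ (T k)).2) sT2 (bT.congr hT2)).add
    (hQ.symm.const_smul _)

end Asymptotic

/-! ### Polar decomposition by approximation -/

section Polar

open Filter Topology

/-- The function `√(max t 0)`. -/
def sqrtFun : C(ℝ, ℝ)₀ := ⟨⟨Real.sqrt, Real.continuous_sqrt⟩, Real.sqrt_zero⟩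

/-- The function `t / (t² + 1/(k+1))`. -/
def quotFun (k : ℕ) : C(ℝ, ℝ)₀ :=
  ⟨⟨fun t => t / (t ^ 2 + 1 / ((k : ℝ) + 1)), by
    refine Continuous.div (by fun_prop) (by fun_prop) fun t => ?_
    positivity⟩, by simp⟩

variable {M : Type u} [NonUnitalCStarAlgebra M]

/-- For b = |x| this lets norms of x y be computed with |x|, although x need not have a polar
decomposition in M. -/
theorem norm_mul_eq_of_star_mul_self_eq {x b : M} (h : star x * x = star b * b) (y : M) :
    ‖x * y‖ = ‖b * y‖ := by
  rw [← sq_eq_sq₀ (norm_nonneg _) (norm_nonneg _), sq, sq, ← CStarRing.norm_star_mul_self,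
    ← CStarRing.norm_star_mul_self, star_mul, star_mul, mul_assoc, mul_assoc, ← mul_assoc (star x),
    ← mul_assoc (star b), h]

theorem norm_mul_sub_eq_of_star_mul_self_eq {x b : M} (h : star x * x = star b * b) (y : M) :
    ‖x * y - x‖ = ‖b * y - b‖ := by
  rw [← sq_eq_sq₀ (norm_nonneg _) (norm_nonneg _), sq, sq, ← CStarRing.norm_star_mul_self,
    ← CStarRing.norm_star_mul_self]
  have e : ∀ z : M, star (z * y - z) * (z * y - z) =
      star y * (star z * z) * y - star y * (star z * z) - (star z * z) * y + star z * z := by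
    intro z
    simp only [star_sub, star_mul, sub_mul, mul_sub, mul_assoc]
    abel
  rw [e, e, h]

variable [PartialOrder M] [StarOrderedRing M]

theorem norm_mul_le_of_mul_self_le {c b : M} (hc : IsSelfAdjoint c) (hb : IsSelfAdjoint b)
    (h : c * c ≤ b * b) (y : M) : ‖y * c‖ ≤ ‖y * b‖ := by
  refine abs_le_of_sq_le_sq' ?_ (norm_nonneg _) |>.2
  rw [sq, sq, ← CStarRing.norm_self_mul_star, ← CStarRing.norm_self_mul_star]
  refine CStarAlgebra.norm_le_norm_of_nonneg_of_le (mul_star_self_nonneg _) ?_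
  have h1 := star_right_conjugate_le_conjugate h y
  simpa only [star_mul, hc.star_eq, hb.star_eq, mul_assoc] using h1

/-- This is `norm_mul_le_of_mul_self_le` for y - 1, but without a unit: if b² - c² = e*e, the
difference of the two squares is (e y* - e)*(e y* - e) ≥ 0. -/
theorem norm_mul_sub_le_of_mul_self_le {c b : M} (hc : IsSelfAdjoint c) (hb : IsSelfAdjoint b)
    (h : c * c ≤ b * b) (y : M) : ‖y * c - c‖ ≤ ‖y * b - b‖ := by
  refine abs_le_of_sq_le_sq' ?_ (norm_nonneg _) |>.2
  rw [sq, sq, ← CStarRing.norm_self_mul_star, ← CStarRing.norm_self_mul_star]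
  refine CStarAlgebra.norm_le_norm_of_nonneg_of_le (mul_star_self_nonneg _) ?_
  obtain ⟨e, he⟩ := CStarAlgebra.nonneg_iff_eq_star_mul_self.1 (sub_nonneg.2 h)
  rw [← sub_nonneg]
  have e1 : ∀ z : M, IsSelfAdjoint z → (y * z - z) * star (y * z - z) =
      y * (z * z) * star y - y * (z * z) - (z * z) * star y + z * z := by
    intro z hz
    simp only [star_sub, star_mul, sub_mul, mul_sub, mul_assoc, hz.star_eq]
    abel
  have e2 : (y * b - b) * star (y * b - b) - (y * c - c) * star (y * c - c) =
      star (e * star y - e) * (e * star y - e) := by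
    rw [e1 b hb, e1 c hc]
    have e3 : star (e * star y - e) * (e * star y - e) =
        y * (star e * e) * star y - y * (star e * e) - (star e * e) * star y + star e * e := by
      simp only [star_sub, star_mul, sub_mul, mul_sub, mul_assoc, star_star]
      abel
    rw [e3, ← he]
    simp only [sub_mul, mul_sub]
    abel
  rw [e2]
  exact star_mul_self_nonneg _

/-- If `c² ≤ x⋆ x` then `c² = z⋆ z` for some `z` in the closed right ideal of `x` which is near
to `x` when `c` is near to `|x|`. -/
theorem exists_star_mul_self_eq {x c : M} (hc : IsSelfAdjoint c) (h : c * c ≤ star x * x) :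
    ∃ z ∈ closure (Set.range fun y => x * y), star z * z = c * c ∧
      ‖z - x‖ ≤ ‖c - cfcₙ (sqrtFun : ℝ → ℝ) (star x * x)‖ := by
  set b := cfcₙ (sqrtFun : ℝ → ℝ) (star x * x) with hbdef
  have hb : IsSelfAdjoint b := cfcₙ_predicate _ _
  have hbb : b * b = star x * x := by
    rw [hbdef, ← cfcₙ_mul (sqrtFun : ℝ → ℝ) (sqrtFun : ℝ → ℝ) (star x * x)]
    conv_rhs => rw [← cfcₙ_id ℝ (star x * x)]
    refine cfcₙ_congr fun t ht => ?_
    exact Real.mul_self_sqrt (quasispectrum_nonneg_of_nonneg _ (star_mul_self_nonneg x) t ht)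
  have hxb : star x * x = star b * b := by rw [hb.star_eq, hbb]
  rw [← hbb] at h
  -- Approximate inverses of b = |x|: b w is a contraction, and b w b is within √(1/(k+1)) of b.
  set w : ℕ → M := fun k => cfcₙ (quotFun k : ℝ → ℝ) b
  have hw : ∀ k, IsSelfAdjoint (w k) := fun k => cfcₙ_predicate _ _
  have hid : cfcₙ (fun t : ℝ => t) b = b := cfcₙ_id ℝ b
  have hbw : ∀ k, b * w k = cfcₙ (fun t : ℝ => t * quotFun k t) b := fun k => by
    rw [cfcₙ_mul (fun t : ℝ => t) (quotFun k : ℝ → ℝ) b (hf0 := rfl) (hg0 := map_zero _), hid]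
  have hbwb : ∀ k, b * w k * b - b = cfcₙ (fun t : ℝ => t * quotFun k t * t - t) b := fun k => by
    rw [cfcₙ_sub (fun t : ℝ => t * quotFun k t * t) (fun t : ℝ => t) (a := b)
        (hf0 := mul_zero _) (hg0 := rfl),
      cfcₙ_mul (fun t : ℝ => t * quotFun k t) (fun t : ℝ => t) b
        (hf0 := zero_mul _) (hg0 := rfl), ← hbw, hid]
  have hbw1 : ∀ k, ‖b * w k‖ ≤ 1 := fun k => by
    rw [hbw]
    refine norm_cfcₙ_le fun t _ => ?_
    change ‖t * (t / (t ^ 2 + 1 / ((k : ℝ) + 1)))‖ ≤ 1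
    rw [← mul_div_assoc, ← sq, Real.norm_of_nonneg (by positivity)]
    refine div_le_one_of_le₀ ?_ (by positivity)
    have : 0 ≤ 1 / ((k : ℝ) + 1) := by positivity
    linarith
  have hlim : Tendsto (fun k => ‖b * w k * b - b‖) atTop (𝓝 0) := by
    have hs : Tendsto (fun k : ℕ => √(1 / ((k : ℝ) + 1))) atTop (𝓝 0) := by
      have := (Real.continuous_sqrt.tendsto 0).comp (tendsto_one_div_add_atTop_nhds_zero_nat (𝕜 := ℝ))
      rwa [Real.sqrt_zero] at this
    refine squeeze_zero (fun _ => norm_nonneg _) (fun k => ?_) hs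
    rw [hbwb]
    refine norm_cfcₙ_le fun t _ => ?_
    change ‖t * (t / (t ^ 2 + 1 / ((k : ℝ) + 1))) * t - t‖ ≤ _
    have hη : 0 < 1 / ((k : ℝ) + 1) := by positivity
    generalize 1 / ((k : ℝ) + 1) = η at hη
    have hpos : 0 < t ^ 2 + η := by positivity
    have e : t * (t / (t ^ 2 + η)) * t - t = -(t * η) / (t ^ 2 + η) := by field_simp; ring
    rw [e, norm_div, norm_neg, norm_mul, Real.norm_of_nonneg hη.le, Real.norm_of_nonneg hpos.le,
      div_le_iff₀ hpos, Real.norm_eq_abs]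
    have h1 := Real.sq_sqrt hη.le
    have h2 := Real.sqrt_nonneg η
    have h3 := abs_nonneg t
    rw [← sq_abs t]
    nlinarith [sq_nonneg (|t| - √η), mul_nonneg h2 h3, mul_nonneg h2 (sq_nonneg (|t| - √η)),
      mul_nonneg h2 (sq_nonneg |t|)]
  -- With x = v|x| formally, x w tends to v and z to vc. This explains both claims: (vc)*(vc) = c²
  -- and vc - x = v(c - |x|).
  set z : ℕ → M := fun k => x * (w k * c) with hz
  have hbwc : Tendsto (fun k => b * w k * c) atTop (𝓝 c) := by
    rw [tendsto_iff_norm_sub_tendsto_zero]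
    exact squeeze_zero (fun _ => norm_nonneg _)
      (fun k => norm_mul_sub_le_of_mul_self_le hc hb h _) hlim
  -- The norm of x(w_k - w_l)c equals that of b(w_k - w_l)c, which is at most that of b(w_k - w_l)b
  -- because c² ≤ b².
  have hcauchy : CauchySeq z := by
    have h1 : CauchySeq fun k => b * w k * b :=
      (tendsto_iff_norm_sub_tendsto_zero.2 hlim).cauchySeq
    rw [Metric.cauchySeq_iff] at h1 ⊢
    intro δ hδ
    obtain ⟨n, hn⟩ := h1 δ hδ
    refine ⟨n, fun k hk l hl => lt_of_le_of_lt ?_ (hn k hk l hl)⟩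
    rw [dist_eq_norm, dist_eq_norm, hz]
    dsimp only
    rw [← mul_sub, ← sub_mul, norm_mul_eq_of_star_mul_self_eq hxb, ← mul_assoc]
    refine (norm_mul_le_of_mul_self_le hc hb h _).trans (le_of_eq ?_)
    rw [mul_sub, sub_mul]
  obtain ⟨z₀, hz₀⟩ := cauchySeq_tendsto_of_complete hcauchy
  refine ⟨z₀, mem_closure_of_tendsto hz₀ (.of_forall fun k => ⟨_, rfl⟩), ?_, ?_⟩
  · refine tendsto_nhds_unique (hz₀.star.mul hz₀) ?_
    have h1 := hbwc.star.mul hbwc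
    rw [hc.star_eq] at h1
    refine h1.congr fun k => ?_
    simp only [hz, star_mul, mul_assoc]
    rw [← mul_assoc (star x), hxb]
    simp only [mul_assoc]
  · have h1 : Tendsto (fun k => x * (w k * b)) atTop (𝓝 x) := by
      rw [tendsto_iff_norm_sub_tendsto_zero]
      refine hlim.congr fun k => ?_
      rw [norm_mul_sub_eq_of_star_mul_self_eq hxb, mul_assoc]
    refine le_of_tendsto (hz₀.sub h1).norm (.of_forall fun k => ?_)
    rw [hz]
    dsimp only
    rw [← mul_sub, ← mul_sub, ← mul_assoc]
    refine (norm_mul_le_of_le ?_ le_rfl).trans (one_mul _).le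
    rw [norm_mul_eq_of_star_mul_self_eq hxb]
    exact hbw1 k

end Polar

/-! ### Correcting x*x to a given diagonal function -/

section DiagonalFunctions

variable {N : Type} [Fintype N] {M : Type u} [NonUnitalCStarAlgebra M]
  (Θ : (N → C(I, ℂ)) →⋆ₙₐ[ℂ] M)

/-- The image of a family of real functions. -/
def diagFun (g : N → C(I, ℝ)) : M := Θ fun r => toComplexFun (g r)

theorem diagFun_mul (g h : N → C(I, ℝ)) : diagFun Θ (g * h) = diagFun Θ g * diagFun Θ h := by
  rw [diagFun, diagFun, diagFun, ← map_mul]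
  congr 1
  funext r
  exact toComplexFun_mul _ _

theorem diagFun_sub (g h : N → C(I, ℝ)) : diagFun Θ (g - h) = diagFun Θ g - diagFun Θ h := by
  rw [diagFun, diagFun, diagFun, ← map_sub]
  congr 1
  funext r
  ext t
  simp

theorem diagFun_smul (c : ℝ) (g : N → C(I, ℝ)) : diagFun Θ (c • g) = c • diagFun Θ g := by
  rw [diagFun, diagFun, ← Complex.coe_smul, ← map_smul]
  congr 1
  funext r
  ext t
  simp

theorem isSelfAdjoint_diagFun (g : N → C(I, ℝ)) : IsSelfAdjoint (diagFun Θ g) := by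
  change star (Θ _) = Θ _
  rw [← map_star]
  congr 1
  funext r
  exact (isSelfAdjoint_toComplexFun (g r)).star_eq

theorem norm_diagFun_le {g : N → C(I, ℝ)} {K : ℝ} (hg : ∀ r t, |g r t| ≤ K) (hK : 0 ≤ K) :
    ‖diagFun Θ g‖ ≤ K := by
  refine (NonUnitalStarAlgHom.norm_apply_le Θ _).trans ((pi_norm_le_iff_of_nonneg hK).2 fun r =>
    (ContinuousMap.norm_le _ hK).2 fun t => ?_)
  rw [toComplexFun_apply, Complex.norm_real]
  exact hg r t

variable [PartialOrder M] [StarOrderedRing M]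

theorem diagFun_nonneg {g : N → C(I, ℝ)} (hg : ∀ r t, 0 ≤ g r t) : 0 ≤ diagFun Θ g := by
  have h : g = (fun r => ⟨fun t => √(g r t), by fun_prop⟩) *
      fun r => ⟨fun t => √(g r t), by fun_prop⟩ := by
    funext r
    ext t
    exact (Real.mul_self_sqrt (hg r t)).symm
  rw [h, diagFun_mul]
  nth_rw 1 [← (isSelfAdjoint_diagFun Θ _).star_eq]
  exact star_mul_self_nonneg _

theorem cfcₙ_sqrtFun_diagFun_mul_self {g : N → C(I, ℝ)} (hg : ∀ r t, 0 ≤ g r t) :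
    cfcₙ (sqrtFun : ℝ → ℝ) (diagFun Θ g * diagFun Θ g) = diagFun Θ g := by
  have h := diagFun_nonneg Θ hg
  have h1 : 0 ≤ diagFun Θ g * diagFun Θ g := by
    nth_rw 1 [← (isSelfAdjoint_diagFun Θ g).star_eq]
    exact star_mul_self_nonneg _
  exact (CFC.sqrt_eq_real_sqrt _ h1).symm.trans (CFC.sqrt_mul_self _ h)

/-- Approximately orthogonal rows can be replaced by exactly orthogonal ones. -/
theorem exists_star_mul_self_eq_diagFun {x : M} {f r c : N → C(I, ℝ)}
    {ε K κ η δ R : ℝ} (hK : 0 ≤ K) (hκ : 0 ≤ κ)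
    (hUC : ∀ a b : M, IsSelfAdjoint a → IsSelfAdjoint b → ‖a‖ ≤ R → ‖b‖ ≤ R →
      ‖a - b‖ ≤ η → ‖cfcₙ (sqrtFun : ℝ → ℝ) a - cfcₙ (sqrtFun : ℝ → ℝ) b‖ ≤ δ)
    (hx : ‖star x * x - diagFun Θ (f * f)‖ ≤ ε)
    (hc : ∀ s t, 0 ≤ c s t ∧ c s t ≤ 2) (hr : ∀ s t, |r s t| ≤ K)
    (hcf : ∀ s t, c s t ^ 2 ≤ r s t ^ 2 * (f s t ^ 2 - ε))
    (hrf : ∀ s t, |(r s t * f s t) ^ 2 - c s t ^ 2| ≤ κ)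
    (hη : K ^ 2 * ε + κ ≤ η)
    (hR : 4 + η ≤ R) :
    ∃ z ∈ closure (Set.range fun y => x * diagFun Θ r * y),
      star z * z = diagFun Θ c * diagFun Θ c ∧ ‖z - x * diagFun Θ r‖ ≤ δ := by
  set E := star x * x - diagFun Θ (f * f) with hE
  have sE : IsSelfAdjoint E :=
    (IsSelfAdjoint.star_mul_self x).sub (isSelfAdjoint_diagFun Θ _)
  have sr := isSelfAdjoint_diagFun Θ r
  have hxx : star (x * diagFun Θ r) * (x * diagFun Θ r) =
      diagFun Θ r * E * diagFun Θ r + diagFun Θ (r * (f * f) * r) := by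
    rw [hE, diagFun_mul Θ _ r, diagFun_mul Θ r, star_mul, sr.star_eq]
    simp only [mul_sub, sub_mul, mul_assoc]
    abel
  have hε : 0 ≤ ε := (norm_nonneg _).trans hx
  -- The error contributes r E r ≥ -‖E‖r² ≥ -εr², and c² ≤ r²(f² - ε) leaves exactly this room.
  have hcc : diagFun Θ c * diagFun Θ c ≤ star (x * diagFun Θ r) * (x * diagFun Θ r) := by
    have h1 := CStarAlgebra.star_left_conjugate_le_norm_smul (a := diagFun Θ r) (b := -E) sE.neg
    rw [sr.star_eq, ← diagFun_mul, norm_neg, ← diagFun_smul] at h1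
    have h2 : 0 ≤ diagFun Θ (r * (f * f) * r - c * c - ‖E‖ • (r * r)) := by
      refine diagFun_nonneg Θ fun s t => ?_
      have h3 := hcf s t
      have h4 : ‖E‖ * r s t ^ 2 ≤ ε * r s t ^ 2 := by gcongr
      change 0 ≤ r s t * (f s t * f s t) * r s t - c s t * c s t - ‖E‖ * (r s t * r s t)
      nlinarith
    rw [diagFun_sub, diagFun_sub, diagFun_mul Θ c c, sub_sub, sub_nonneg] at h2
    rw [hxx]
    have h5 : -(diagFun Θ r * E * diagFun Θ r) ≤ diagFun Θ (‖E‖ • (r * r)) := by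
      simpa only [mul_neg, neg_mul] using h1
    calc diagFun Θ c * diagFun Θ c ≤ diagFun Θ (r * (f * f) * r) - diagFun Θ (‖E‖ • (r * r)) :=
          le_sub_iff_add_le.2 h2
      _ ≤ diagFun Θ (r * (f * f) * r) - -(diagFun Θ r * E * diagFun Θ r) := sub_le_sub_left h5 _
      _ = _ := by abel
  obtain ⟨z, hz, hzz, hzx⟩ := exists_star_mul_self_eq (isSelfAdjoint_diagFun Θ c) hcc
  refine ⟨z, hz, hzz, hzx.trans ?_⟩
  have hnc : ‖diagFun Θ c * diagFun Θ c‖ ≤ 4 := by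
    rw [← diagFun_mul]
    refine norm_diagFun_le Θ (fun s t => ?_) (by norm_num : (0 : ℝ) ≤ 4)
    obtain ⟨h1, h2⟩ := hc s t
    change |c s t * c s t| ≤ 4
    rw [abs_of_nonneg (mul_nonneg h1 h1)]
    nlinarith
  have hdiff : ‖diagFun Θ c * diagFun Θ c - star (x * diagFun Θ r) * (x * diagFun Θ r)‖ ≤ η := by
    refine le_trans ?_ hη
    have h1 : ‖diagFun Θ r‖ ≤ K := norm_diagFun_le Θ hr hK
    have h2 : ‖diagFun Θ (c * c - r * (f * f) * r)‖ ≤ κ := by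
      refine norm_diagFun_le Θ (fun s t => ?_) hκ
      have h3 := hrf s t
      change |c s t * c s t - r s t * (f s t * f s t) * r s t| ≤ κ
      rw [abs_sub_comm] at h3
      convert h3 using 2
      ring
    have e : diagFun Θ c * diagFun Θ c - star (x * diagFun Θ r) * (x * diagFun Θ r) =
        -(diagFun Θ r * E * diagFun Θ r) + diagFun Θ (c * c - r * (f * f) * r) := by
      rw [hxx, diagFun_sub, diagFun_mul Θ c c]
      abel
    rw [e]
    refine norm_add_le_of_le ?_ h2
    rw [norm_neg]
    calc ‖diagFun Θ r * E * diagFun Θ r‖ ≤ K * ε * K :=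
          norm_mul_le_of_le (norm_mul_le_of_le h1 hx) h1
      _ = _ := by ring
  have hnx : ‖star (x * diagFun Θ r) * (x * diagFun Θ r)‖ ≤ R := by
    have : star (x * diagFun Θ r) * (x * diagFun Θ r) = diagFun Θ c * diagFun Θ c -
        (diagFun Θ c * diagFun Θ c - star (x * diagFun Θ r) * (x * diagFun Θ r)) := by abel
    rw [this]
    exact (norm_sub_le_of_le hnc hdiff).trans hR
  -- As c ≥ 0, it is the square root of c², so uniform continuity of the square root compares it
  -- with |xr|.
  rw [← cfcₙ_sqrtFun_diagFun_mul_self Θ fun s t => (hc s t).1]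
  refine hUC _ _ ?_ (IsSelfAdjoint.star_mul_self _) (hnc.trans ?_) hnx hdiff
  · rw [← diagFun_mul]
    exact isSelfAdjoint_diagFun Θ _
  · have : 0 ≤ η := (norm_nonneg _).trans hdiff
    linarith

end DiagonalFunctions

/-! ### Norms and diagonal matrices over a C*-algebra -/

section MatrixNorm

open CStarMatrix

variable {N : Type} [Fintype N] [DecidableEq N] {B : Type u} [NonUnitalCStarAlgebra B]
  [PartialOrder B] [StarOrderedRing B]

theorem star_single_mul_single (i j : N) (a : B) :
    star (ofMatrix (Matrix.single i j a)) * ofMatrix (Matrix.single i j a) =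
      (ofMatrix (Matrix.single j j (star a * a)) : CStarMatrix N N B) := by
  change (Matrix.single i j a).conjTranspose * Matrix.single i j a = _
  rw [Matrix.conjTranspose_single, Matrix.single_mul_single_same]
  rfl

/-- The embedding as a diagonal entry. -/
def singleHom (i : N) : B →⋆ₙₐ[ℂ] CStarMatrix N N B where
  toFun a := ofMatrix (Matrix.single i i a)
  map_smul' c a := (Matrix.smul_single c i i a).symm
  map_zero' := Matrix.single_zero i i
  map_add' a b := Matrix.single_add i i a b
  map_mul' a b := by
    change Matrix.single i i (a * b) = Matrix.single i i a * Matrix.single i i b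
    rw [Matrix.single_mul_single_same]
  map_star' a := (Matrix.conjTranspose_single i i a).symm

/-- The C*-identity moves the entry to the diagonal, where the embedding is a homomorphism and hence
contractive. -/
theorem norm_single_le (i j : N) (a : B) :
    ‖(ofMatrix (Matrix.single i j a) : CStarMatrix N N B)‖ ≤ ‖a‖ := by
  refine abs_le_of_sq_le_sq' ?_ (norm_nonneg _) |>.2
  rw [sq, sq, ← CStarRing.norm_star_mul_self, ← CStarRing.norm_star_mul_self,
    star_single_mul_single]
  exact NonUnitalStarAlgHom.norm_apply_le (singleHom j) _

theorem norm_le_sum_norm_entry (x : CStarMatrix N N B) : ‖x‖ ≤ ∑ i, ∑ j, ‖x i j‖ := by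
  have h : x = ∑ i, ∑ j, ofMatrix (Matrix.single i j (x i j)) :=
    Matrix.matrix_eq_sum_single (ofMatrix.symm x)
  conv_lhs => rw [h]
  exact (norm_sum_le _ _).trans (Finset.sum_le_sum fun i _ => (norm_sum_le _ _).trans
    (Finset.sum_le_sum fun j _ => norm_single_le i j _))

/-- The diagonal matrices with entries in the image of `ρ`. -/
def diagMatHom (ρ : C(I, ℂ) →⋆ₙₐ[ℂ] B) : (N → C(I, ℂ)) →⋆ₙₐ[ℂ] CStarMatrix N N B where
  toFun g := ofMatrix (Matrix.diagonal fun r => ρ (g r))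
  map_smul' c g := by
    change Matrix.diagonal _ = c • (Matrix.diagonal _ : Matrix N N B)
    rw [← Matrix.diagonal_smul]
    congr 1
    funext r
    exact map_smul ρ c (g r)
  map_zero' := by
    change Matrix.diagonal _ = (0 : Matrix N N B)
    simp
  map_add' g h := by
    refine Eq.trans (b := (Matrix.diagonal fun r => ρ (g r) + ρ (h r) : Matrix N N B)) ?_
      (Matrix.diagonal_add _ _).symm
    exact congrArg Matrix.diagonal (funext fun r => map_add ρ (g r) (h r))
  map_mul' g h := by
    refine Eq.trans (b := (Matrix.diagonal fun r => ρ (g r) * ρ (h r) : Matrix N N B)) ?_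
      (Matrix.diagonal_mul_diagonal _ _).symm
    exact congrArg Matrix.diagonal (funext fun r => map_mul ρ (g r) (h r))
  map_star' g := by
    change Matrix.diagonal _ = (Matrix.diagonal _ : Matrix N N B).conjTranspose
    rw [Matrix.diagonal_conjTranspose]
    congr 1
    funext r
    exact map_star ρ (g r)

theorem diagMatHom_apply (ρ : C(I, ℂ) →⋆ₙₐ[ℂ] B) (g : N → C(I, ℂ)) (i j : N) :
    diagMatHom ρ g i j = if i = j then ρ (g i) else 0 :=
  Matrix.diagonal_apply ..

end MatrixNorm

/-! ### Orthogonal families as rows of matrices -/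

section Rows

open CStarMatrix

variable {S : Type} [Fintype S] [DecidableEq S] {B : Type u} [NonUnitalCStarAlgebra B]

theorem continuous_entry [PartialOrder B] [StarOrderedRing B] {N : Type} [Fintype N]
    (i j : N) : Continuous fun z : CStarMatrix N N B => z i j := by
  refine LipschitzWith.continuous (K := 1) (LipschitzWith.of_dist_le_mul fun z w => ?_)
  rw [dist_eq_norm, dist_eq_norm, NNReal.coe_one, one_mul]
  exact norm_entry_le_norm (M := z - w)

/-- The matrix with the row of the elements `(X s)⋆`. -/
def rowMatrix (X : S → B) : CStarMatrix (Option S) (Option S) B :=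
  ofMatrix fun i j => i.elim (j.elim 0 fun s => star (X s)) fun _ => 0

@[simp] theorem rowMatrix_none_none (X : S → B) : rowMatrix X none none = 0 := rfl

@[simp] theorem rowMatrix_none_some (X : S → B) (s : S) :
    rowMatrix X none (some s) = star (X s) := rfl

@[simp] theorem rowMatrix_some (X : S → B) (s : S) (j : Option S) :
    rowMatrix X (some s) j = 0 := rfl

/-- Thus orthogonality of the X s and the formulas for X s X s* become a single statement about x*x.
-/
theorem star_rowMatrix_mul_self_apply (X : S → B) (i j : Option S) :
    (star (rowMatrix X) * rowMatrix X) i j =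
      i.elim 0 fun s => j.elim 0 fun s' => X s * star (X s') := by
  rw [CStarMatrix.mul_apply, Fintype.sum_option]
  simp only [CStarMatrix.star_apply]
  cases i <;> cases j <;> simp

/-- Under the hypothesis, (pz - z)(pz - z)* = 0. -/
theorem mul_eq_self_of_mul_star_self {p z : B} (hp : IsSelfAdjoint p)
    (h : p * (z * star z) = z * star z) : p * z = z := by
  have h' : z * star z * p = z * star z := by
    have := congrArg star h
    rwa [star_mul, hp.star_eq, star_mul, star_star] at this
  rw [← sub_eq_zero, ← CStarRing.mul_star_self_eq_zero_iff]
  have e : (p * z - z) * star (p * z - z) =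
      p * (z * star z) * p - p * (z * star z) - z * star z * p + z * star z := by
    simp only [star_sub, star_mul, sub_mul, mul_sub, mul_assoc, hp.star_eq]
    abel
  rw [e, h, h']
  abel

/-- Both conditions are closed and hold for every product x d y. So a factor found in the closed
right ideal is again a single row and inherits the relation X P = 0. -/
theorem row_conditions_of_mem_closure [PartialOrder B] [StarOrderedRing B] {p : B}
    (hp : IsSelfAdjoint p) {X : S → B} (hX : ∀ s, X s * p = 0)
    {d z : CStarMatrix (Option S) (Option S) B}
    (hz : z ∈ closure (Set.range fun y => rowMatrix X * d * y)) :
    (∀ s j, z (some s) j = 0) ∧ ∀ j, p * z none j = 0 := by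
  have hcl : IsClosed ({z | ∀ s j, z (some s) j = 0} ∩ {z | ∀ j, p * z none j = 0} :
      Set (CStarMatrix (Option S) (Option S) B)) := by
    refine IsClosed.inter ?_ ?_
    · rw [Set.setOf_forall]
      refine isClosed_iInter fun s => ?_
      rw [Set.setOf_forall]
      exact isClosed_iInter fun j => isClosed_eq (continuous_entry _ _) continuous_const
    · rw [Set.setOf_forall]
      exact isClosed_iInter fun j =>
        isClosed_eq ((continuous_const_mul p).comp (continuous_entry _ _)) continuous_const
  refine closure_minimal ?_ hcl hz
  rintro _ ⟨y, rfl⟩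
  dsimp only
  rw [mul_assoc]
  refine ⟨fun s j => ?_, fun j => ?_⟩
  · rw [CStarMatrix.mul_apply]
    exact Finset.sum_eq_zero fun l _ => zero_mul _
  · rw [CStarMatrix.mul_apply, Finset.mul_sum]
    refine Finset.sum_eq_zero fun l _ => ?_
    rw [← mul_assoc]
    cases l with
    | none => rw [rowMatrix_none_none, mul_zero, zero_mul]
    | some s =>
      rw [rowMatrix_none_some, ← hp.star_eq, ← star_mul, hX, star_zero, zero_mul]

/-- A family of functions extended by `0`. -/
def extendZero (g : S → C(I, ℝ)) : Option S → C(I, ℝ) := fun r => r.elim 0 g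

@[simp] theorem extendZero_none (g : S → C(I, ℝ)) : extendZero g none = 0 := rfl

@[simp] theorem extendZero_some (g : S → C(I, ℝ)) (s : S) : extendZero g (some s) = g s := rfl

theorem norm_star_rowMatrix_mul_self_sub_le [PartialOrder B] [StarOrderedRing B]
    {f : S → C(I, ℝ)} {ε₁ : ℝ} (hε₁ : 0 ≤ ε₁) (ρ : C(I, ℂ) →⋆ₙₐ[ℂ] B) (X : S → B)
    (hXX : ∀ s, ‖X s * star (X s) - ρ (toComplexFun (f s * f s))‖ ≤ ε₁)
    (hXX' : ∀ s s', s ≠ s' → ‖X s * star (X s')‖ ≤ ε₁) :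
    ‖star (rowMatrix X) * rowMatrix X -
      diagFun (diagMatHom ρ) (extendZero f * extendZero f)‖ ≤
        (Fintype.card (Option S) : ℝ) ^ 2 * ε₁ := by
  refine (norm_le_sum_norm_entry _).trans ?_
  have : ∀ i j, ‖(star (rowMatrix X) * rowMatrix X -
      diagFun (diagMatHom ρ) (extendZero f * extendZero f)) i j‖ ≤ ε₁ := by
    intro i j
    rw [CStarMatrix.sub_apply, star_rowMatrix_mul_self_apply, diagFun, diagMatHom_apply]
    have h0 : toComplexFun 0 = 0 := by ext; simp
    cases i with
    | none => cases j <;> simp [h0, hε₁]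
    | some s =>
      cases j with
      | none => simp [hε₁]
      | some s' =>
        by_cases h : s = s'
        · subst h
          simpa using hXX s
        · simpa [h] using hXX' s s' h
  calc _ ≤ ∑ i : Option S, ∑ j : Option S, ε₁ :=
        Finset.sum_le_sum fun i _ => Finset.sum_le_sum fun j _ => this i j
    _ = _ := by
      simp only [Finset.sum_const, Finset.card_univ, nsmul_eq_mul]
      ring

theorem rowMatrix_mul_diagFun_apply [PartialOrder B] [StarOrderedRing B]
    (ρ : C(I, ℂ) →⋆ₙₐ[ℂ] B) (X : S → B) (r : S → C(I, ℝ)) (s : S) :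
    (rowMatrix X * diagFun (diagMatHom ρ) (extendZero r)) none (some s) =
      star (X s) * ρ (toComplexFun (r s)) := by
  rw [CStarMatrix.mul_apply, Finset.sum_eq_single_of_mem (some s) (Finset.mem_univ _)]
  · rw [diagFun, diagMatHom_apply, if_pos rfl, rowMatrix_none_some, extendZero_some]
  · intro j _ hj
    rw [diagFun, diagMatHom_apply, if_neg hj, mul_zero]

theorem entry_of_star_mul_self_eq [PartialOrder B] [StarOrderedRing B]
    (ρ : C(I, ℂ) →⋆ₙₐ[ℂ] B) {c : S → C(I, ℝ)} {z : CStarMatrix (Option S) (Option S) B}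
    (hz : ∀ s j, z (some s) j = 0)
    (hzz : star z * z = diagFun (diagMatHom ρ) (extendZero c) *
      diagFun (diagMatHom ρ) (extendZero c)) (s s' : S) :
    star (z none (some s)) * z none (some s') =
      if s = s' then ρ (toComplexFun (c s * c s)) else 0 := by
  have h1 : (star z * z) (some s) (some s') = star (z none (some s)) * z none (some s') := by
    rw [CStarMatrix.mul_apply, Fintype.sum_option]
    simp only [CStarMatrix.star_apply, hz, mul_zero, Finset.sum_const_zero, add_zero]
  rw [← h1, hzz, ← diagFun_mul, diagFun, diagMatHom_apply]
  simp

/-- Elements which are approximately orthogonal over a homomorphism from `C[0,1]` can be replaced by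
elements which are exactly orthogonal. -/
theorem exists_orthogonal_family {f r c : S → C(I, ℝ)} {ε₁ ε K κ η δ R : ℝ} (hK : 0 ≤ K)
    (hκ : 0 ≤ κ)
    (hUC : ∀ (M : Type u) [NonUnitalCStarAlgebra M] (a b : M), IsSelfAdjoint a → IsSelfAdjoint b →
      ‖a‖ ≤ R → ‖b‖ ≤ R → ‖a - b‖ ≤ η →
        ‖cfcₙ (sqrtFun : ℝ → ℝ) a - cfcₙ (sqrtFun : ℝ → ℝ) b‖ ≤ δ)
    (hc : ∀ s t, 0 ≤ c s t ∧ c s t ≤ 2) (hr : ∀ s t, |r s t| ≤ K)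
    (hcf : ∀ s t, c s t ^ 2 ≤ r s t ^ 2 * (f s t ^ 2 - ε))
    (hrf : ∀ s t, |(r s t * f s t) ^ 2 - c s t ^ 2| ≤ κ)
    (hη : K ^ 2 * ε + κ ≤ η) (hR : 4 + η ≤ R)
    (hε₁ : 0 ≤ ε₁) (hε : (Fintype.card (Option S) : ℝ) ^ 2 * ε₁ ≤ ε)
    (ρ : C(I, ℂ) →⋆ₙₐ[ℂ] B) (X : S → B) (hX' : ∀ s, X s * ρ 1 = 0)
    (hXX : ∀ s, ‖X s * star (X s) - ρ (toComplexFun (f s * f s))‖ ≤ ε₁)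
    (hXX' : ∀ s s', s ≠ s' → ‖X s * star (X s')‖ ≤ ε₁) :
    ∃ Z : S → B, (∀ s, ρ 1 * Z s = Z s) ∧ (∀ s, Z s * ρ 1 = 0) ∧
      (∀ s, Z s * star (Z s) = ρ (toComplexFun (c s * c s))) ∧
      (∀ s s', s ≠ s' → Z s * star (Z s') = 0) ∧
      ∀ s, ‖Z s - ρ (toComplexFun (r s)) * X s‖ ≤ δ := by
  -- The matrix lemmas assume an ordered algebra; the spectral order is used locally.
  letI : PartialOrder B := CStarAlgebra.spectralOrder B
  haveI : StarOrderedRing B := CStarAlgebra.spectralOrderedRing B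
  have p1 : IsSelfAdjoint (ρ 1) := by
    change star (ρ 1) = ρ 1
    rw [← map_star, star_one]
  have hx := (norm_star_rowMatrix_mul_self_sub_le hε₁ ρ X hXX hXX').trans hε
  have hUC' := hUC (CStarMatrix (Option S) (Option S) B)
  have hc' : ∀ s t, 0 ≤ extendZero c s t ∧ extendZero c s t ≤ 2 := by
    intro s t
    cases s with
    | none => exact ⟨le_rfl, zero_le_two⟩
    | some s => exact hc s t
  have hr' : ∀ s t, |extendZero r s t| ≤ K := by
    intro s t
    cases s with
    | none => simpa using hK
    | some s => exact hr s t
  have hcf' : ∀ s t,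
      extendZero c s t ^ 2 ≤ extendZero r s t ^ 2 * (extendZero f s t ^ 2 - ε) := by
    intro s t
    cases s with
    | none => simp
    | some s => exact hcf s t
  have hrf' : ∀ s t,
      |(extendZero r s t * extendZero f s t) ^ 2 - extendZero c s t ^ 2| ≤ κ := by
    intro s t
    cases s with
    | none => simpa using hκ
    | some s => exact hrf s t
  obtain ⟨z, hz, hzz, hzx⟩ := exists_star_mul_self_eq_diagFun
    (M := CStarMatrix (Option S) (Option S) B) (diagMatHom ρ) (x := rowMatrix X)
    (f := extendZero f) (r := extendZero r) (c := extendZero c) (R := R) (δ := δ) (ε := ε) (η := η)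
    hK hκ hUC' hx hc' hr' hcf' hrf' hη hR
  have hrange := row_conditions_of_mem_closure p1 hX' hz
  have hent := entry_of_star_mul_self_eq ρ hrange.1 hzz
  have hZZ : ∀ s, star (z none (some s)) * star (star (z none (some s))) =
      ρ (toComplexFun (c s * c s)) := fun s => by rw [star_star, hent, if_pos rfl]
  refine ⟨fun s => star (z none (some s)), fun s => ?_, fun s => ?_, hZZ, fun s s' h => ?_,
    fun s => ?_⟩
  -- This relation is not inherited from X; it follows from Z Z* = ρ(c²).
  · refine mul_eq_self_of_mul_star_self p1 ?_
    rw [hZZ, ← map_mul, one_mul]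
  · rw [← p1.star_eq, ← star_mul, hrange.2, star_zero]
  · rw [star_star, hent, if_neg h]
  · have h1 := (norm_entry_le_norm (i := none) (j := some s)).trans hzx
    rw [CStarMatrix.sub_apply, rowMatrix_mul_diagFun_apply] at h1
    rw [← norm_star]
    refine le_trans (le_of_eq (congrArg norm ?_)) h1
    rw [star_sub, star_star, star_mul, ← map_star, (isSelfAdjoint_toComplexFun _).star_eq]

end Rows

/-! ### From approximate to exact orthogonality -/

section Stability

/-- Since X X* ≈ f², the size of hX is governed by hf and not by h. It is meant for h = r - 1, which
is merely bounded while hf is small. -/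
theorem norm_hom_mul_sq_le {B : Type*} [NonUnitalCStarAlgebra B] (ρ : C(I, ℂ) →⋆ₙₐ[ℂ] B) {X : B}
    {f h : C(I, ℝ)} {ε K D : ℝ} (hX : ‖X * star X - ρ (toComplexFun (f * f))‖ ≤ ε)
    (hK : 0 ≤ K) (hh : ∀ t, |h t| ≤ K)
    (hf : ∀ t, |h t * f t| ≤ D) :
    ‖ρ (toComplexFun h) * X‖ ^ 2 ≤ K * ε * K + D ^ 2 := by
  have sh : star (ρ (toComplexFun h)) = ρ (toComplexFun h) := by
    rw [← map_star, (isSelfAdjoint_toComplexFun h).star_eq]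
  have hn : ∀ (g : C(I, ℝ)) (C : ℝ), 0 ≤ C → (∀ t, |g t| ≤ C) → ‖ρ (toComplexFun g)‖ ≤ C :=
    fun g C hC hg => (NonUnitalStarAlgHom.norm_apply_le ρ _).trans
      ((ContinuousMap.norm_le _ hC).2 fun t => by
        rw [toComplexFun_apply, Complex.norm_real]
        exact hg t)
  have e : ρ (toComplexFun h) * X * star (ρ (toComplexFun h) * X) =
      ρ (toComplexFun h) * (X * star X - ρ (toComplexFun (f * f))) * ρ (toComplexFun h) +
        ρ (toComplexFun (h * (f * f) * h)) := by
    rw [star_mul, sh, toComplexFun_mul _ h, toComplexFun_mul h, map_mul, map_mul]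
    simp only [mul_sub, sub_mul, mul_assoc]
    abel
  rw [sq, ← CStarRing.norm_self_mul_star, e]
  refine norm_add_le_of_le (norm_mul_le_of_le (norm_mul_le_of_le (hn h K hK hh) hX) (hn h K hK hh))
    (hn _ _ (sq_nonneg D) fun t => ?_)
  change |h t * (f t * f t) * h t| ≤ D ^ 2
  rw [show h t * (f t * f t) * h t = (h t * f t) ^ 2 by ring, abs_of_nonneg (sq_nonneg _)]
  exact sq_le_sq' (by linarith [abs_le.1 (hf t)]) (abs_le.1 (hf t)).2

/-- Approximately orthogonal elements over a homomorphism from `C[0,1]` are near to an exact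
representation of the relations. -/
theorem exists_exactRep_near {S : Type} [Finite S] {f : S → C(I, ℝ)} {C : S → Set I}
    (hf : ∀ s t, 0 ≤ f s t ∧ f s t ≤ 2) (hC : ∀ s t, f s t ≠ 0 ↔ t ∈ C s)
    (hfin : ∀ s, (frontier (C s)).Finite) {δ : ℝ} (hδ : 0 < δ) :
    ∃ ε > 0, ∀ (B : Type u) [NonUnitalCStarAlgebra B] (ρ : C(I, ℂ) →⋆ₙₐ[ℂ] B) (X : S → B),
      (∀ s, ρ 1 * X s = X s) → (∀ s, X s * ρ 1 = 0) →
      (∀ s, ‖X s * star (X s) - ρ (toComplexFun (f s * f s))‖ ≤ ε) →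
      (∀ s s', s ≠ s' → ‖X s * star (X s')‖ ≤ ε) →
      ∃ b : StepGen S → B, ExactRep (stepRelations f) b ∧ b .P = ρ 1 ∧
        ‖b .T - ρ (toComplexFun intervalCoe)‖ ≤ δ ∧ ∀ s, ‖b (.X s) - X s‖ ≤ δ := by
  classical
  have := Fintype.ofFinite S
  -- the collapsing map
  obtain ⟨θ, hθ, hθf⟩ : ∃ θ > 0, ∀ s (x y : I), |(x : ℝ) - y| ≤ θ → |f s x - f s y| ≤ δ / 8 := by
    have hc : UniformContinuous fun t s => f s t :=
      CompactSpace.uniformContinuous_of_continuous (by fun_prop)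
    obtain ⟨θ, hθ, h⟩ := Metric.uniformContinuous_iff.1 hc (δ / 8) (by positivity)
    refine ⟨θ / 2, half_pos hθ, fun s x y hxy => ?_⟩
    have h1 : dist x y < θ := by
      rw [Subtype.dist_eq, Real.dist_eq]
      exact hxy.trans_lt (half_lt_self hθ)
    exact (dist_le_pi_dist (fun s => f s x) (fun s => f s y) s).trans (h h1).le
  obtain ⟨γ, hm, hfix, hcon, hγ⟩ := exists_collapse
    (Set.finite_iUnion hfin).toFinset (lt_min hθ hδ)
  have hmemF : ∀ s, ∀ p ∈ frontier (C s), p ∈ (Set.finite_iUnion hfin).toFinset := fun s p hp =>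
    (Set.Finite.mem_toFinset _).2 (Set.mem_iUnion.2 ⟨s, hp⟩)
  choose L hLpos hL using fun s => exists_pos_lower_bound (f s) (fun t => (hf s t).1) (hC s) γ hm
    (fun p hp => hfix p (hmemF s p hp)) fun p hp => hcon p (hmemF s p hp)
  obtain ⟨L₀, hL₀, hL₀L⟩ : ∃ L₀ > 0, ∀ s, L₀ ≤ L s := by
    have hpos : ∀ s ∈ Finset.univ, 0 ≤ (L s)⁻¹ := fun s _ => (inv_pos.2 (hLpos s)).le
    have h0 := Finset.sum_nonneg hpos
    -- A positive lower bound for all L s that also makes sense when S is empty.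
    refine ⟨(1 + ∑ s, (L s)⁻¹)⁻¹, by positivity, fun s => inv_le_of_inv_le₀ (hLpos s) ?_⟩
    have := Finset.single_le_sum hpos (Finset.mem_univ s)
    linarith
  -- the constants
  obtain ⟨η₀, hη₀, hUC⟩ := exists_cfcₙ_uniform.{u} sqrtFun 5 (half_pos hδ)
  -- η ≤ 1 keeps 4 + η within the radius 5 of `hUC`; the 4 bounds c².
  obtain ⟨η, hη, hηη₀, hη1⟩ : ∃ η > 0, η ≤ η₀ ∧ η ≤ 1 :=
    ⟨min η₀ 1, lt_min hη₀ one_pos, min_le_left _ _, min_le_right _ _⟩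
  -- The rescaling r carries a factor 1 + τ, which makes room for the error ε. It costs (2τ + τ²)c²
  -- ≤ 12τ ≤ η/2 in the squares and τc ≤ 2τ ≤ δ/8 in (r - 1)f.
  obtain ⟨τ, hτ, hτη, hτδ⟩ : ∃ τ > 0, τ ≤ η / 24 ∧ τ ≤ δ / 16 :=
    ⟨min (η / 24) (δ / 16), lt_min (by positivity) (by positivity), min_le_left _ _,
      min_le_right _ _⟩
  set K := 4 / L₀ with hK
  have hKpos : 0 < K := by positivity
  -- The second bound gives r²ε ≤ (τ/2)(rL₀)² ≤ (τ/2)((1 + τ)c)², which fits because (1 + τ)²(1 -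
  -- τ/2) ≥ 1.
  obtain ⟨ε, hε, hεη, hετ⟩ : ∃ ε > 0, ε ≤ η / 2 / K ^ 2 ∧ ε ≤ τ * L₀ ^ 2 / 2 :=
    ⟨min (η / 2 / K ^ 2) (τ * L₀ ^ 2 / 2), lt_min (by positivity) (by positivity), min_le_left _ _,
      min_le_right _ _⟩
  have hn : 0 < (Fintype.card (Option S) : ℝ) := by exact_mod_cast Fintype.card_pos
  -- The first bound passes from entries to the matrix norm. The second makes (K + 1)²ε₁ + (δ/4)² ≤
  -- (δ/2)².
  obtain ⟨ε₁, hε₁, hε₁ε, hε₁δ⟩ : ∃ ε₁ > 0, ε₁ ≤ ε / (Fintype.card (Option S) : ℝ) ^ 2 ∧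
      ε₁ ≤ δ ^ 2 / 16 / (K + 1) ^ 2 :=
    ⟨min (ε / (Fintype.card (Option S) : ℝ) ^ 2) (δ ^ 2 / 16 / (K + 1) ^ 2),
      lt_min (by positivity) (by positivity), min_le_left _ _, min_le_right _ _⟩
  rw [le_div_iff₀ (by positivity)] at hεη hε₁ε hε₁δ
  have hτ1 : τ ≤ 1 := by linarith
  refine ⟨ε₁, hε₁, fun B _ ρ X hX hX' hXX hXX' => ?_⟩
  -- the functions
  set c : S → C(I, ℝ) := fun s => (f s).comp γ with hc
  have hmax : ∀ s t, 0 < max (f s t) L₀ := fun s t => lt_max_of_lt_right hL₀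
  -- Essentially (f∘γ)/f. Where f∘γ is nonzero, f ≥ L₀ and the maximum is f, so rf = (1 + τ)c
  -- everywhere.
  set r : S → C(I, ℝ) := fun s => ⟨fun t => (1 + τ) * f s (γ t) / max (f s t) L₀,
    Continuous.div (by fun_prop) (by fun_prop) fun t => (hmax s t).ne'⟩ with hr
  have hrK : ∀ s t, |r s t| ≤ K := by
    intro s t
    have h1 := hf s (γ t)
    change |(1 + τ) * f s (γ t) / max (f s t) L₀| ≤ K
    rw [abs_of_nonneg (div_nonneg (mul_nonneg (by linarith) h1.1) (hmax s t).le), hK]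
    gcongr
    · nlinarith
    · exact le_max_right _ _
  have hrf : ∀ s t, r s t * f s t = (1 + τ) * c s t := by
    intro s t
    change (1 + τ) * f s (γ t) / max (f s t) L₀ * f s t = (1 + τ) * f s (γ t)
    by_cases h0 : f s (γ t) = 0
    · simp [h0]
    · have h1 : L₀ ≤ f s t := (hL₀L s).trans (hL s t h0)
      rw [max_eq_left h1, div_mul_cancel₀ _ (hL₀.trans_le h1).ne']
  have hrL : ∀ s t, (r s t * L₀) ^ 2 ≤ ((1 + τ) * c s t) ^ 2 := by
    intro s t
    have h1 := hf s (γ t)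
    have h2 : 0 ≤ (1 + τ) * f s (γ t) := mul_nonneg (by linarith) h1.1
    refine pow_le_pow_left₀ (mul_nonneg (div_nonneg h2 (hmax s t).le) hL₀.le) ?_ 2
    change (1 + τ) * f s (γ t) / max (f s t) L₀ * L₀ ≤ (1 + τ) * f s (γ t)
    rw [div_mul_eq_mul_div, div_le_iff₀ (hmax s t)]
    exact mul_le_mul_of_nonneg_left (le_max_right _ _) h2
  have hcb : ∀ s t, 0 ≤ c s t ∧ c s t ≤ 2 := fun s t => hf s (γ t)
  have hcf : ∀ s t, c s t ^ 2 ≤ r s t ^ 2 * (f s t ^ 2 - ε) := by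
    intro s t
    have h1 := hrL s t
    have h2 : r s t ^ 2 * ε ≤ r s t ^ 2 * (τ * L₀ ^ 2 / 2) := by gcongr
    have h3 : r s t ^ 2 * f s t ^ 2 = ((1 + τ) * c s t) ^ 2 := by rw [← mul_pow, hrf]
    have h4 : τ / 2 * (r s t * L₀) ^ 2 ≤ τ / 2 * ((1 + τ) * c s t) ^ 2 := by gcongr
    have h5 : 0 ≤ (1 + τ) ^ 2 * (1 - τ / 2) - 1 := by nlinarith [mul_pos hτ hτ]
    have h6 := mul_nonneg h5 (sq_nonneg (c s t))
    rw [mul_sub, h3]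
    nlinarith
  have hrc : ∀ s t, |(r s t * f s t) ^ 2 - c s t ^ 2| ≤ η / 2 := by
    intro s t
    obtain ⟨h1, h2⟩ := hcb s t
    rw [hrf, show ((1 + τ) * c s t) ^ 2 - c s t ^ 2 = (2 * τ + τ ^ 2) * c s t ^ 2 by ring,
      abs_of_nonneg (by positivity)]
    have h3 : c s t ^ 2 ≤ 4 := by nlinarith
    calc (2 * τ + τ ^ 2) * c s t ^ 2 ≤ (3 * τ) * 4 := by
          gcongr
          nlinarith
      _ ≤ η / 2 := by linarith
  obtain ⟨Z, hZ, hZ', hZZ, hZZ', hZX⟩ := exists_orthogonal_family (R := 5) (η := η) (δ := δ / 2)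
    hKpos.le (half_pos hη).le
    (fun M _ a b ha hb ha' hb' hab => hUC M a b ha hb ha' hb' (hab.trans hηη₀)) hcb hrK hcf hrc
    (by linarith) (by linarith) hε₁.le (by linarith) ρ X hX' hXX hXX'
  -- T becomes ρ(γ), for which f²(T) = ρ((f∘γ)²), the value of Z Z*.
  refine ⟨_, exactRep_of_hom ρ γ Z hf hZ hZ' hZZ hZZ', rfl, ?_, fun s => ?_⟩
  · change ‖ρ (toComplexFun (intervalCoe.comp γ)) - ρ (toComplexFun intervalCoe)‖ ≤ δ
    rw [← map_sub]
    refine (NonUnitalStarAlgHom.norm_apply_le ρ _).trans ((ContinuousMap.norm_le _ hδ.le).2 fun t => ?_)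
    change ‖((γ t : ℝ) : ℂ) - ((t : ℝ) : ℂ)‖ ≤ δ
    rw [← Complex.ofReal_sub, Complex.norm_real]
    exact (hγ t).trans (min_le_right _ _)
  · change ‖Z s - X s‖ ≤ δ
    have h1 : ‖ρ (toComplexFun (r s - 1)) * X s‖ ≤ δ / 2 := by
      have h2 := norm_hom_mul_sq_le ρ (h := r s - 1) (K := K + 1) (D := δ / 4) (hXX s)
        (by positivity) (fun t => ?_) (fun t => ?_)
      · refine abs_le_of_sq_le_sq' ?_ (by positivity) |>.2
        nlinarith
      · change |r s t - 1| ≤ K + 1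
        exact (abs_sub _ _).trans (add_le_add (hrK s t) (by simp))
      · change |(r s t - 1) * f s t| ≤ δ / 4
        rw [sub_mul, hrf, one_mul]
        have h3 : |c s t - f s t| ≤ δ / 8 := hθf s (γ t) t ((hγ t).trans (min_le_left _ _))
        have h4 := hcb s t
        rw [abs_le] at h3 ⊢
        constructor <;> nlinarith
    have h2 : Z s - X s = (Z s - ρ (toComplexFun (r s)) * X s) + ρ (toComplexFun (r s - 1)) * X s := by
      have : toComplexFun (r s - 1) = toComplexFun (r s) - 1 := by
        ext t
        simp
      rw [this, map_sub, sub_mul, hX]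
      abel
    rw [h2]
    exact (norm_add_le_of_le (hZX s) h1).trans (by linarith)

end Stability

/-! ### Weak stability -/

section WeakStability

open Filter Topology

/-- Relations of the step type are weakly stable. -/
theorem isWeaklyStable_stepRelations {S : Type} [Finite S] {f : S → C(I, ℝ)} {C : S → Set I}
    (hf : ∀ s t, 0 ≤ f s t ∧ f s t ≤ 2) (hC : ∀ s t, f s t ≠ 0 ↔ t ∈ C s)
    (hfin : ∀ s, (frontier (C s)).Finite) {A : Type} [NonUnitalCStarAlgebra A]
    {a : StepGen S → A} (ha : IsUniversalCStar.{u} (stepRelations f) a) :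
    IsWeaklyStable.{u} (stepRelations f) a := by
  intro δ hδ
  obtain ⟨ε₀, hε₀, H⟩ := exists_exactRep_near.{u} hf hC hfin (half_pos hδ)
  by_contra hcon
  -- Failure for some δ gives counterexamples with ε = 1/(k+1), to which the asymptotic corrections
  -- apply.
  have hseq : ∀ k : ℕ, ∃ (B : Type u) (_ : NonUnitalCStarAlgebra B) (b : StepGen S → B),
      ApproxRep (stepRelations f) (1 / ((k : ℝ) + 1)) b ∧
        ∀ ψ : A →⋆ₙₐ[ℂ] B, ∃ g, δ < ‖ψ (a g) - b g‖ := by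
    intro k
    by_contra hk
    refine hcon ⟨1 / ((k : ℝ) + 1), by positivity, fun B _ b hb => ?_⟩
    by_contra hψ
    refine hk ⟨B, _, b, hb, fun ψ => ?_⟩
    by_contra hg
    push Not at hg
    exact hψ ⟨ψ, hg⟩
  choose B inst b hb hno using hseq
  obtain ⟨ρ, Y, hY, hY', hP, hT, hX, hYY, hYY'⟩ := exists_asymptotic_hom
    tendsto_one_div_add_atTop_nhds_zero_nat
    (fun k => div_le_one_of_le₀ (by linarith [k.cast_nonneg (α := ℝ)]) (by positivity)) hb
  have ev : ∀ {x y : ∀ k, B k}, AsympEq x y → ∀ {η : ℝ}, 0 < η →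
      ∀ᶠ k in atTop, ‖x k - y k‖ ≤ η := fun h η hη =>
    (h.eventually_lt_const hη).mono fun k hk => hk.le
  -- As S is finite, one index k serves for all generators and pairs at once.
  obtain ⟨k, hkP, hkT, hkX, hkY, hkY'⟩ := ((ev hP hδ).and ((ev hT (half_pos hδ)).and
    ((eventually_all.2 fun s => ev (hX s) (half_pos hδ)).and
      ((eventually_all.2 fun s => ev (hYY s) hε₀).and
        (eventually_all.2 fun s => eventually_all.2 fun s' => eventually_imp_distrib_left.2
          fun h : s ≠ s' => ev (hYY' s s' h) hε₀))))).exists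
  simp only [sub_zero] at hkY'
  obtain ⟨b', hb', hbP, hbT, hbX⟩ := H (B k) (ρ k) (fun s => Y s k) (fun s => hY s k)
    (fun s => hY' s k) hkY hkY'
  obtain ⟨ψ, hψ, -⟩ := ha.2 (B k) b' hb'
  obtain ⟨g, hg⟩ := hno k ψ
  rw [hψ] at hg
  refine hg.not_ge ?_
  cases g with
  | P => rw [hbP]; exact hkP
  | T =>
    exact (norm_sub_le_norm_sub_add_norm_sub _ _ _).trans
      ((add_le_add hbT hkT).trans (add_halves δ).le)
  | X s =>
    exact (norm_sub_le_norm_sub_add_norm_sub _ _ _).trans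
      ((add_le_add (hbX s) (hkX s)).trans (add_halves δ).le)

end WeakStability

end

/-! ### The main theorem -/

theorem theorem10p2p5 (m : ℕ) (A : NonUnitalStarSubalgebra ℂ (IntervalAlg (m + 1)))
    [hclosed : IsClosed (A : Set (IntervalAlg (m + 1)))]
    (hher : IsHereditarySubalg A) (hfull : IsFullSubalg A) (hstep : IsStepSubalg A) :
    Finite (StepGen (CompIndex A)) ∧
    (∃ f : CompIndex A → C(I, ℝ), IsComponentFamily A f) ∧
    ∃ φ : A ≃⋆ₐ[ℂ] modelAlg (levelSet A),
      ∀ f : CompIndex A → C(I, ℝ), IsComponentFamily A f →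
        (stepRelations f).Finite ∧
        ∃ a : StepGen (CompIndex A) → A,
          (∀ g, (φ (a g) : IntervalAlg (m + 1)) = concreteGen f g) ∧
          IsUniversalCStar.{u} (stepRelations f) a ∧
          IsWeaklyStable.{u} (stepRelations f) a := by
  have hfinite := finite_compIndex hstep
  have hlast := levelSet_last_of_isFullSubalg hfull
  obtain ⟨hopen, ⟨φ⟩⟩ := exists_starAlgEquiv_modelAlg A hclosed hher
  refine ⟨finite_stepGen, exists_isComponentFamily hopen, φ, fun f hf =>
    ⟨finite_stepRelations f, fun g => φ.symm ⟨_, concreteGen_mem_modelAlg hf hlast g⟩, ?_⟩⟩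
  have ha : ∀ g, (φ (φ.symm ⟨_, concreteGen_mem_modelAlg hf hlast g⟩) : IntervalAlg (m + 1)) =
      concreteGen f g := fun g => by rw [φ.apply_symm_apply]
  have huniv := isUniversalCStar_stepRelations.{u} hlast φ hf ha
  exact ⟨ha, huniv, isWeaklyStable_stepRelations (fun s t => ⟨(hf s t).1, (hf s t).2.1⟩)
    (fun s t => (hf s t).2.2) finite_frontier_compIndex huniv⟩
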